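/- **Definitions.** A CNF formula is a finite set of clauses, each a finite disjunction of literals; $|A|$ is the number of clauses of $A$, and $A$ is a $k$-CNF formula if each clause has at most $k$ literals, over distinct variables. Let $F$ be a set of Boolean functions $\{0,1\}^n\to\{0,1\}$, viewed as indicators of sets of ruled-out assignments. A $\mathrm{Sem}(F)$ refutation of an $n$-variate CNF formula $A$ is a sequence $(f_1,\dots,f_t)$ with $f_t$ the constant $1$ in which each $f_i$ either is the indicator of the assignments falsifying some clause of $A$, or belongs to $F$ and is derived from $f_j,f_k$ with $j,k<i$ such that $f_i\le f_j\vee f_k$ pointwise. Its length is $t$, and it is tree-like if each line is used to derive at most one other line. For integers $c,m,k$ let $G$ be a $k$-partite graph with blocks $V_i=\{v_{i,\alpha}:\alpha\in\{0,\dots,m-1\}^c\}$, $i\in[k]$. The $c$-ary clique formula of $G$ has variables $x_{i,j,a}$ ($i\in[k]$, $j\in[c]$, $0\le a<m$) and extension variables $y_{i,j,a}$ ($i\in[k]$, $j\in[c]$, $0\le a\le m$). Its clauses are the edge axioms $\bigvee_{j}\bar x_{i,j,\alpha_j}\vee\bigvee_{j}\bar x_{i',j,\beta_j}$ for all pairs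 of distinct non-adjacent vertices $v_{i,\alpha},v_{i',\beta}$, and, for all $i,j$, the 3-CNF form of the range axiom $\bigvee_{a<m}x_{i,j,a}$, namely the clauses $\bar y_{i,j,0}$, $\;y_{i,j,a}\vee x_{i,j,a}\vee\bar y_{i,j,a+1}$ for $0\le a<m$, and $y_{i,j,m}$. Let $k=k(c,m)=\lceil 4\log_2(m^c)\rceil$. For $n\in\mathbb N$ let $m$ be the largest integer for which this formula has at most $n$ variables, that is, $k(c,m)\cdot c\cdot(2m+1)\le n$, and let $\mathcal A^{(c)}_n$ be the set of the $c$-ary clique formulas of all $k$-partite graphs with blocks of size $m^c$, their variables being named (injectively, the same way for all graphs) by $n$ variables; superfluous variables do not occur in the formula. **Theorem.** (1) Let $\ell\ge4$ be an even integer and $c=\ell/2$. For all $n$, each $A\in\mathcal A^{(c)}_n$ is an $n$-variate $\ell$-CNF formula. If $A$ is sampled uniformly from $\mathcal A^{(c)}_n$, then the following holds. - Asymptotically almost surely (with probability tending to $1$ as $n\to\infty$), $A$ is unsatisfiable. - For every $\varepsilon>0$ there is a superpolynomial function $L\colon\mathbb N\to\mathbb N$ (for each $K$, $L(n)\ge n^K$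 for all large $n$) such that for any sequence $(F_n)_{n\in\mathbb N}$ of sets $F_n$ of $n$-variate Boolean functions with $|F_n|\le\exp(n^{\ell-\varepsilon})$ for all large $n$, asymptotically almost surely every tree-like $\mathrm{Sem}(F_n)$ refutation of $A$ has length at least $L(n)$. (2) Consequently there is a strict hierarchy of tree-like semantic systems: there are sequences $\mathcal F_\ell=(F_{\ell,n})_{n\in\mathbb N}$ of sets of $n$-variate Boolean functions such that for every even $\ell\ge4$ - $F_{\ell,n}\subseteq F_{\ell+2,n}$ for all $n$; - there is a constant $C$ such that, for all $k<\ell$ and all $n$, every unsatisfiable $n$-variate $k$-CNF formula $A$ has a tree-like $\mathrm{Sem}(F_{\ell,n})$ refutation of length at most $C\,|A|$; - for every $K$ and all large $n$ there is an unsatisfiable $n$-variate $\ell$-CNF formula $A$ all of whose tree-like $\mathrm{Sem}(F_{\ell,n})$ refutations have length greater than $(n+|A|)^K$. -/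

import Mathlib

open Filter Topology

/-! Clauses, CNF formulas and Boolean functions over a set `X` of Boolean variables. -/

/-- A literal over `X` is a pair `(x, b)`: the literal `x` if `b = true`, and its negation if
`b = false`. A clause is a finite set (a disjunction) of literals. -/
abbrev Clause (X : Type) : Type := Finset (X × Bool)

/-- A CNF formula is a finite set (a conjunction) of clauses. Its size is its number of clauses,
that is, its cardinality. -/
abbrev CNF (X : Type) : Type := Finset (Clause X)

/-- A Boolean function on the variables `X`, viewed as the indicator of the assignments that it
rules out. -/
abbrev BoolFun (X : Type) : Type := (X → Bool) → Bool

/-- The assignment `α` satisfies the clause `C`. -/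
def Clause.Sat {X : Type} (C : Clause X) (α : X → Bool) : Prop := ∃ l ∈ C, α l.1 = l.2

/-- The assignment `α` satisfies the CNF formula `A`. -/
def CNF.Sat {X : Type} (A : CNF X) (α : X → Bool) : Prop := ∀ C ∈ A, Clause.Sat C α

/-- The CNF formula `A` has no satisfying assignment. -/
def CNF.Unsat {X : Type} (A : CNF X) : Prop := ∀ α, ¬ A.Sat α

/-- `A` is an `ℓ`-CNF formula: each clause is a disjunction of at most `ℓ` literals over distinct
variables. -/
def CNF.IsKCNF {X : Type} (ℓ : ℕ) (A : CNF X) : Prop :=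
  ∀ C ∈ A, C.card ≤ ℓ ∧ ∀ x, ¬ ((x, true) ∈ C ∧ (x, false) ∈ C)

/-- `f` is the indicator of the assignments that falsify the clause `C`. -/
def IsFalsifyingIndicator {X : Type} (C : Clause X) (f : BoolFun X) : Prop :=
  ∀ α, f α = true ↔ ¬ Clause.Sat C α

/-! Semantic refutations. -/

/-- A `Sem(F)` refutation of the CNF formula `A`, together with a justification of each line:
`premises i = none` says that line `i` is an axiom, and `premises i = some (j, k)` says that line
`i` belongs to `F` and is semantically implied by the earlier lines `j` and `k`. The last line is
the constant `1` function, that is, contradiction. -/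
structure SemRefutation {X : Type} (F : Set (BoolFun X)) (A : CNF X) where
  /-- the number of lines -/
  length : ℕ
  length_pos : 0 < length
  /-- the lines -/
  line : Fin length → BoolFun X
  /-- the premises from which a line is derived -/
  premises : Fin length → Option (Fin length × Fin length)
  initial_line : ∀ i, premises i = none → ∃ C ∈ A, IsFalsifyingIndicator C (line i)
  derived_line : ∀ i j k, premises i = some (j, k) →
    line i ∈ F ∧ j < i ∧ k < i ∧
      ∀ α, line i α = true → line j α = true ∨ line k α = true
  final : ∀ α, line ⟨length - 1, Nat.sub_lt length_pos Nat.one_pos⟩ α = true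

/-- Line `j` is used in the derivation of line `i`. -/
def SemRefutation.Uses {X : Type} {F : Set (BoolFun X)} {A : CNF X} (π : SemRefutation F A)
    (i j : Fin π.length) : Prop :=
  ∃ p, π.premises i = some p ∧ (j = p.1 ∨ j = p.2)

/-- The refutation is tree-like: each line is used in the derivation of at most one line. -/
def SemRefutation.TreeLike {X : Type} {F : Set (BoolFun X)} {A : CNF X}
    (π : SemRefutation F A) : Prop :=
  ∀ j i i', π.Uses i j → π.Uses i' j → i = i'

/-! The `c`-ary clique formulas over `k`-partite graphs with blocks of size `m ^ c`. -/

/-- The vertices of a `k`-partite graph with blocks of size `m ^ c`: the vertex `(i, α)` is the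
vertex of the `i`th block with coordinates `α`. -/
abbrev BlockVertex (k c m : ℕ) : Type := Fin k × (Fin c → Fin m)

/-- `G` is `k`-partite with respect to the blocks. -/
def IsBlockGraph {k c m : ℕ} (G : SimpleGraph (BlockVertex k c m)) : Prop :=
  ∀ u v, G.Adj u v → u.1 ≠ v.1

/-- The variables of the clique formula. The variable `x_{i,j,a} = Sum.inl (i, j, a)` says that
the `j`th coordinate of the vertex chosen from the `i`th block is `a`. The variables
`y_{i,j,0}, …, y_{i,j,m}`, with `y_{i,j,a} = Sum.inr (i, j, a)`, are the extension variables used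
to write the clause `x_{i,j,0} ∨ ⋯ ∨ x_{i,j,m-1}` as a 3-CNF formula. -/
abbrev CliqueVar (k c m : ℕ) : Type :=
  (Fin k × Fin c × Fin m) ⊕ (Fin k × Fin c × Fin (m + 1))

/-- The clause `⋁_j ¬x_{i,j,α_j}`, which says that the vertex `(i, α)` is not chosen. -/
def vertexClause {k c m : ℕ} (v : BlockVertex k c m) : Clause (CliqueVar k c m) :=
  Finset.univ.image fun j : Fin c => (Sum.inl (v.1, j, v.2 j), false)

open Classical in
/-- The 3-CNF form of the range axiom `x_{i,j,0} ∨ ⋯ ∨ x_{i,j,m-1}`: the clauses `¬y_{i,j,0}`,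
`y_{i,j,a} ∨ x_{i,j,a} ∨ ¬y_{i,j,a+1}` for `a < m`, and `y_{i,j,m}`. -/
noncomputable def rangeCNF {k c m : ℕ} (i : Fin k) (j : Fin c) : CNF (CliqueVar k c m) :=
  {{(Sum.inr (i, j, 0), false)}, {(Sum.inr (i, j, Fin.last m), true)}} ∪
    Finset.univ.image fun a : Fin m =>
      {(Sum.inr (i, j, a.castSucc), true), (Sum.inl (i, j, a), true),
        (Sum.inr (i, j, a.succ), false)}

open Classical in
/-- The `c`-ary clique formula of the graph `G`: an edge axiom for each pair of distinct
non-adjacent vertices, and the 3-CNF forms of the range axioms. -/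
noncomputable def cliqueCNF {k c m : ℕ} (G : SimpleGraph (BlockVertex k c m)) :
    CNF (CliqueVar k c m) :=
  ((Finset.univ.filter fun p : BlockVertex k c m × BlockVertex k c m =>
      p.1 ≠ p.2 ∧ ¬ G.Adj p.1 p.2).image fun p => vertexClause p.1 ∪ vertexClause p.2) ∪
    Finset.univ.biUnion fun p : Fin k × Fin c => rangeCNF p.1 p.2

/-- The clique size `⌈4 log₂ N⌉`, where `N = m ^ c` is the size of the blocks. -/
def cliqueSize (c m : ℕ) : ℕ := Nat.clog 2 ((m ^ c) ^ 4)

/-- The number of variables of the `c`-ary formula for cliques of size `cliqueSize c m`, namely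
`cliqueSize c m * c * (2 * m + 1)`. -/
def numCliqueVars (c m : ℕ) : ℕ := Fintype.card (CliqueVar (cliqueSize c m) c m)

/-- The largest `m` for which the clique formula has at most `n` variables. -/
def coordRange (c n : ℕ) : ℕ := Nat.findGreatest (fun m => numCliqueVars c m ≤ n) n

theorem numCliqueVars_coordRange_le (c n : ℕ) : numCliqueVars c (coordRange c n) ≤ n := by
  refine Nat.findGreatest_spec (P := fun m => numCliqueVars c m ≤ n) (Nat.zero_le n) ?_
  rcases Nat.eq_zero_or_pos c with rfl | h
  · simp [numCliqueVars]
  · simp [numCliqueVars, cliqueSize, Nat.ne_of_gt h]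

/-- The variables of the clique formula, named by numbers below `n`. If there are fewer than `n`
of them, then the remaining numbers are variables that do not occur in the formula. -/
noncomputable def cliqueVarEmb (c n : ℕ) :
    CliqueVar (cliqueSize c (coordRange c n)) c (coordRange c n) ↪ Fin n :=
  (Fintype.equivFin _).toEmbedding.trans (Fin.castLEEmb (numCliqueVars_coordRange_le c n))

/-- Renaming of the variables of a CNF formula. -/
def CNF.rename {X Y : Type} (e : X ↪ Y) (A : CNF X) : CNF Y :=
  A.map (Finset.mapEmbedding (e.prodMap (Function.Embedding.refl Bool))).toEmbedding

/-- The family of `n`-variate `c`-ary clique formulas: one formula for each `k`-partite graph. -/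
def cliqueFamily (c n : ℕ) : Set (CNF (Fin n)) :=
  {A | ∃ G : SimpleGraph (BlockVertex (cliqueSize c (coordRange c n)) c (coordRange c n)),
    IsBlockGraph G ∧ A = (cliqueCNF G).rename (cliqueVarEmb c n)}

/-! Random members of a family. -/

/-- The probability that a uniformly random element of the finite set `S` has the property `P`. -/
noncomputable def uniformProb {α : Type} (S : Set α) (P : α → Prop) : ℝ :=
  ({a ∈ S | P a}.ncard : ℝ) / (S.ncard : ℝ)

/-- Asymptotically almost surely, a uniformly random element of `S n` has the property `P n`. -/
def AAS {α : ℕ → Type} (S : ∀ n, Set (α n)) (P : ∀ n, α n → Prop) : Prop :=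
  Tendsto (fun n => uniformProb (S n) (P n)) atTop (𝓝 1)

/-- A function of superpolynomial growth. -/
def IsSuperpolynomial (L : ℕ → ℕ) : Prop := ∀ K : ℕ, ∀ᶠ n in atTop, n ^ K ≤ L n

/-! Only assignments selecting one vertex per block matter. They satisfy all range axioms, so a
refutation has to rule out every tuple `x : I → V`, while an axiom rules out only tuples through one
fixed non-edge. Let `N = m ^ c` be the block size, so that `k` is about `4 log₂ N` and `N ^ 2` is
about `n ^ ℓ` up to logarithmic factors. Unsatisfiability is a first moment computation. The lower
bound is an adversary argument showing that small proof trees cannot certify that no clique exists.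

A tree-like refutation unfolds into a proof tree without growing
(`SemRefutation.TreeLike.exists_tree`). A tree can be cut at a node into two parts with at most
three quarters of its inner nodes each (`PTree.Valid.exists_split`). The adversary holds a set `P`
of tuples that the tree claims to rule out; given the label of the cut node, it keeps the larger
half of `P`, inside or outside the label, and the corresponding part of the tree. If it survives `D
* k` such queries with every axiom still sparse in its set, the tree has more than `(4/3) ^ (D * k)`
inner nodes, a power of `n` with exponent proportional to `D`.

The invariant is `IsState` together with `StarAdj`: `P` fixes the coordinates in a set `T`, is
spread on the remaining blocks, and the fixed vertices are adjacent to everything else in the tuples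
of `P`. Halving destroys spreadness; `exists_spread_pieces` restores it by fixing further
coordinates `S`. This raises the density of `P` by about `a ^ S.card`, whereas a query costs only a
factor 4. As the density is at most one and `a` is a small power of `N`, only a constant number `q`
of coordinates is ever fixed. The newly fixed vertices must form a clique, and the other blocks
shrink to their common neighbourhoods; for constant `q` both are cheap in a random graph.

For a fixed state and a fixed half, the probability that no next state exists is `exp (-N ^ (2 -
δ))` with `δ` as small as desired (`prob_no_next_state_le`). Almost `N ^ 2` edge-disjoint candidates
would have to fail to be cliques, or almost `N` vertex-disjoint tuples would all have atypical
neighbourhoods, each with probability about `exp (-N ^ (1 - δ))`. This is small enough for a union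
bound over all labels in `F` and all conceivable next states, in every round
(`prob_exists_tree_le`). Here the bound `exp (n ^ (ℓ - ε))` on the number of lines is used.

For the hierarchy, the lines at level `ℓ` are the functions given by `(ℓ - 1)`-CNF formulas:
conjoining clauses refutes narrower formulas, and there are few enough of these functions for the
lower bound. -/

set_option linter.unusedSectionVars false

/-! ## Uniform probability on finite types -/

/-- The probability of `p` under the uniform distribution on `Ω`. -/
noncomputable def prob {Ω : Type*} (p : Ω → Prop) : ℝ := (Nat.card {ω // p ω} : ℝ) / Nat.card Ω

namespace prob

theorem nonneg {Ω : Type*} (p : Ω → Prop) : 0 ≤ prob p := by unfold prob; positivity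

theorem mono {Ω : Type*} [Finite Ω] {p q : Ω → Prop} (h : ∀ ω, p ω → q ω) : prob p ≤ prob q := by
  unfold prob
  gcongr
  exact Nat.card_le_card_of_injective (fun x : {ω // p ω} => (⟨x.1, h _ x.2⟩ : {ω // q ω}))
    (fun x y hxy => Subtype.ext (by simpa using hxy))

theorem congr {Ω : Type*} {p q : Ω → Prop} (h : ∀ ω, p ω ↔ q ω) : prob p = prob q := by
  rw [show p = q from funext fun ω => propext (h ω)]

theorem le_one {Ω : Type*} [Finite Ω] (p : Ω → Prop) : prob p ≤ 1 := by
  unfold prob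
  apply div_le_one_of_le₀ _ (by positivity)
  exact_mod_cast Nat.card_le_card_of_injective (fun x : {ω // p ω} => x.1)
    Subtype.val_injective

theorem of_false {Ω : Type*} {p : Ω → Prop} (h : ∀ ω, ¬ p ω) : prob p = 0 := by
  unfold prob
  have : IsEmpty {ω // p ω} := ⟨fun x => h _ x.2⟩
  simp

theorem eq_sum {Ω : Type*} [Fintype Ω] (p : Ω → Prop) [DecidablePred p] :
    prob p = (∑ ω, if p ω then (1 : ℝ) else 0) / Fintype.card Ω := by
  unfold prob
  rw [Nat.card_eq_fintype_card, Nat.card_eq_fintype_card, Fintype.card_subtype]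
  simp

theorem or_le {Ω : Type*} [Finite Ω] (p q : Ω → Prop) :
    prob (fun ω => p ω ∨ q ω) ≤ prob p + prob q := by
  classical
  cases nonempty_fintype Ω
  simp only [eq_sum, ← add_div, ← Finset.sum_add_distrib]
  gcongr with ω
  by_cases hp : p ω <;> by_cases hq : q ω <;> simp [hp, hq]

theorem add_not {Ω : Type*} [Finite Ω] [Nonempty Ω] (p : Ω → Prop) :
    prob p + prob (fun ω => ¬ p ω) = 1 := by
  classical
  cases nonempty_fintype Ω
  simp only [eq_sum, ← add_div, ← Finset.sum_add_distrib]
  rw [div_eq_one_iff_eq (by exact_mod_cast Fintype.card_ne_zero)]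
  rw [Finset.sum_congr rfl (g := fun _ => (1 : ℝ))
    (fun ω _ => by by_cases hp : p ω <;> simp [hp])]
  simp

theorem finset_exists_le {Ω ι : Type*} [Finite Ω] (s : Finset ι) (p : ι → Ω → Prop) :
    prob (fun ω => ∃ i ∈ s, p i ω) ≤ ∑ i ∈ s, prob (p i) := by
  classical
  induction s using Finset.induction_on with
  | empty => simp [of_false (p := fun _ : Ω => False) (fun _ => id)]
  | insert a s ha ih =>
    rw [Finset.sum_insert ha]
    refine le_trans (mono (q := fun ω => p a ω ∨ ∃ i ∈ s, p i ω) ?_) ((or_le _ _).trans (by gcongr))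
    rintro ω ⟨i, hi, h⟩
    rcases Finset.mem_insert.1 hi with rfl | hi
    exacts [Or.inl h, Or.inr ⟨i, hi, h⟩]

theorem finset_exists_le_card {Ω ι : Type*} [Finite Ω] (s : Finset ι) (p : ι → Ω → Prop) {ε : ℝ}
    (h : ∀ i ∈ s, prob (p i) ≤ ε) : prob (fun ω => ∃ i ∈ s, p i ω) ≤ s.card * ε := by
  refine (finset_exists_le s p).trans ((Finset.sum_le_sum h).trans ?_)
  simp

theorem exists_le_card {Ω ι : Type*} [Finite Ω] [Fintype ι] (p : ι → Ω → Prop) {ε : ℝ}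
    (h : ∀ i, prob (p i) ≤ ε) : prob (fun ω => ∃ i, p i ω) ≤ Fintype.card ι * ε := by
  simpa using finset_exists_le_card Finset.univ p (fun i _ => h i)

theorem comp_equiv {Ω Ω' : Type*} (e : Ω ≃ Ω') (p : Ω' → Prop) :
    prob (fun ω => p (e ω)) = prob p := by
  unfold prob
  rw [Nat.card_congr (e.subtypeEquiv (fun ω => Iff.rfl) : {ω // p (e ω)} ≃ {ω // p ω}),
    Nat.card_congr e]

theorem comp_fst {Ω Ω' : Type*} [Finite Ω'] [Nonempty Ω'] (p : Ω → Prop) :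
    prob (fun ω : Ω × Ω' => p ω.1) = prob p := by
  unfold prob
  have e : {ω : Ω × Ω' // p ω.1} ≃ {ω : Ω // p ω} × Ω' :=
    ⟨fun x => (⟨x.1.1, x.2⟩, x.1.2), fun x => ⟨(x.1.1, x.2), x.1.2⟩, fun _ => rfl, fun _ => rfl⟩
  rw [Nat.card_congr e, Nat.card_prod, Nat.card_prod]
  push_cast
  rw [mul_div_mul_right]
  exact_mod_cast Nat.card_pos.ne'

/-- Restricting a uniformly random function along an injection yields a uniformly random
function. -/
theorem comp_injective {ι ι' β : Type*} [Finite ι] [Finite β] [Nonempty β] {φ : ι' → ι}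
    (hφ : Function.Injective φ) (p : (ι' → β) → Prop) :
    prob (fun ω : ι → β => p (fun i => ω (φ i))) = prob p := by
  classical
  rw [← comp_fst (Ω' := {i // i ∉ Set.range φ} → β) p,
    ← comp_equiv ((Equiv.piEquivPiSubtypeProd (· ∈ Set.range φ) (fun _ : ι => β)).trans
      (Equiv.prodCongr (Equiv.arrowCongr (Equiv.ofInjective φ hφ).symm (Equiv.refl β))
        (Equiv.refl _)))]
  rfl

theorem pi {D : Type*} [Fintype D] {Ω : D → Type*} [∀ d, Finite (Ω d)]
    (p : ∀ d, Ω d → Prop) : prob (fun ω : ∀ d, Ω d => ∀ d, p d (ω d)) = ∏ d, prob (p d) := by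
  unfold prob
  have e : {ω : ∀ d, Ω d // ∀ d, p d (ω d)} ≃ ∀ d, {ω : Ω d // p d ω} :=
    ⟨fun x d => ⟨x.1 d, x.2 d⟩, fun x => ⟨fun d => (x d).1, fun d => (x d).2⟩,
      fun _ => rfl, fun _ => rfl⟩
  rw [Nat.card_congr e, Nat.card_pi, Nat.card_pi]
  push_cast
  rw [Finset.prod_div_distrib]

theorem prod_le {Ω Ω' : Type*} [Finite Ω] [Finite Ω'] (p : Ω × Ω' → Prop) {ε : ℝ} (hε : 0 ≤ ε)
    (h : ∀ ω', prob (fun ω => p (ω, ω')) ≤ ε) : prob p ≤ ε := by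
  classical
  cases nonempty_fintype Ω
  cases nonempty_fintype Ω'
  simp only [eq_sum] at h ⊢
  rcases isEmpty_or_nonempty Ω with hΩ | hΩ
  · simpa using hε
  rcases isEmpty_or_nonempty Ω' with hΩ | hΩ
  · simpa using hε
  have h1 : (0 : ℝ) < Fintype.card Ω := by exact_mod_cast Fintype.card_pos
  have h2 : (0 : ℝ) < Fintype.card Ω' := by exact_mod_cast Fintype.card_pos
  rw [div_le_iff₀ (by simp; positivity), Fintype.sum_prod_type_right]
  refine (Finset.sum_le_sum (g := fun _ => ε * Fintype.card Ω) fun ω' _ => ?_).trans ?_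
  · exact (div_le_iff₀ h1).1 (h ω')
  · simp
    exact le_of_eq (by ring)

/-- To bound a probability it suffices to bound it conditionally on all coordinates but one. -/
theorem le_of_update {ι : Type*} [Finite ι] [DecidableEq ι] {β : Type*} [Finite β]
    (i : ι) (p : (ι → β) → Prop) {ε : ℝ} (hε : 0 ≤ ε)
    (h : ∀ ω : ι → β, prob (fun y => p (Function.update ω i y)) ≤ ε) : prob p ≤ ε := by
  classical
  rcases isEmpty_or_nonempty β with hβ | ⟨⟨y0⟩⟩
  · rw [of_false]
    · exact hε
    · intro ω; exact (hβ.false (ω i)).elim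
  rw [← comp_equiv (Equiv.funSplitAt i β).symm]
  refine prod_le _ hε fun ω' => ?_
  refine le_trans (mono ?_) (h ((Equiv.funSplitAt i β).symm (y0, ω')))
  intro y hy
  convert hy using 1
  ext j
  by_cases hj : j = i
  · subst hj; simp
  · simp [hj]

theorem markov {Ω : Type*} [Fintype Ω] [Nonempty Ω] (p : Ω → Prop) (f : Ω → ℝ)
    (hf : ∀ ω, 0 ≤ f ω) (h : ∀ ω, p ω → 1 ≤ f ω) : prob p ≤ (∑ ω, f ω) / Fintype.card Ω := by
  classical
  rw [eq_sum]
  gcongr with ω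
  split_ifs with hp
  exacts [h ω hp, hf ω]

end prob

/-! ## Concentration for weighted random subsets -/

/-- Independence factorizes the exponential moment, and `exp y ≤ 1 + y + y ^ 2` for `|y| ≤ 1` bounds
each factor. The signs of the weights are arbitrary, so both tails follow from this. -/
theorem sum_exp_indicator_le {V β : Type*} [Fintype V] [DecidableEq V] [Fintype β] [Nonempty β]
    (A : β → Prop) [DecidablePred A] (y : V → ℝ) (hy : ∀ w, |y w| ≤ 1) :
    (∑ ω : V → β, Real.exp (∑ w, if A (ω w) then y w else 0)) / Fintype.card (V → β) ≤
      Real.exp (prob A * ∑ w, (y w + y w ^ 2)) := by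
  have key : ∀ w, (∑ b : β, Real.exp (if A b then y w else 0)) ≤
      Fintype.card β * Real.exp (prob A * (y w + y w ^ 2)) := by
    intro w
    have hβ : (0 : ℝ) < Fintype.card β := by exact_mod_cast Fintype.card_pos
    have h1 : (∑ b : β, Real.exp (if A b then y w else 0)) =
        Fintype.card β * (1 + prob A * (Real.exp (y w) - 1)) := by
      have : ∀ b, Real.exp (if A b then y w else 0) =
          1 + (if A b then (1 : ℝ) else 0) * (Real.exp (y w) - 1) := by
        intro b; split_ifs <;> simp
      simp only [this, Finset.sum_add_distrib, ← Finset.sum_mul, prob.eq_sum]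
      field_simp
      simp
    rw [h1]
    gcongr
    have h2 := (abs_le.1 (Real.abs_exp_sub_one_sub_id_le (hy w))).2
    have h3 := prob.nonneg A
    calc 1 + prob A * (Real.exp (y w) - 1) ≤ prob A * (y w + y w ^ 2) + 1 := by nlinarith
      _ ≤ _ := Real.add_one_le_exp _
  have h2 : (∑ ω : V → β, Real.exp (∑ w, if A (ω w) then y w else 0)) =
      ∏ w, ∑ b : β, Real.exp (if A b then y w else 0) := by
    rw [Finset.prod_univ_sum]
    simp [Real.exp_sum]
  rw [h2, div_le_iff₀ (by exact_mod_cast Fintype.card_pos), Finset.mul_sum, Real.exp_sum]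
  refine (Finset.prod_le_prod (fun w _ => Finset.sum_nonneg fun b _ => (Real.exp_pos _).le)
    (fun w _ => key w)).trans (le_of_eq ?_)
  rw [Finset.prod_mul_distrib]
  simp [mul_comm]

/-- Chernoff's method: Markov's inequality for `exp (s X)` with `s = θ / (2 M)`, which minimizes the
exponent `-s θ q m + s ^ 2 M q m`. -/
theorem prob_weight_gt_le {V β : Type*} [Fintype V] [Fintype β] [Nonempty β]
    (A : β → Prop) [DecidablePred A] (a : V → ℝ) {M m θ : ℝ} (ha : ∀ w, 0 ≤ a w)
    (haM : ∀ w, a w ≤ M) (hM : 0 < M) (hm : ∑ w, a w ≤ m) (hθ : 0 < θ) (hθ1 : θ ≤ 1) :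
    prob (fun ω : V → β => (1 + θ) * prob A * m < ∑ w, if A (ω w) then a w else 0) ≤
      Real.exp (-(θ ^ 2 * prob A * m / (4 * M))) := by
  classical
  set q := prob A
  have hq : 0 ≤ q := prob.nonneg A
  set s := θ / (2 * M) with hs
  have hs0 : 0 < s := by positivity
  have hsM : s * M = θ / 2 := by rw [hs]; field_simp
  have hy : ∀ w, |s * a w| ≤ 1 := fun w => by
    rw [abs_of_nonneg (mul_nonneg hs0.le (ha w))]
    nlinarith [haM w]
  refine (prob.markov _ (fun ω => Real.exp (-(s * ((1 + θ) * q * m))) *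
    Real.exp (∑ w, if A (ω w) then s * a w else 0)) (fun ω => by positivity) ?_).trans ?_
  · intro ω hω
    rw [← Real.exp_add]
    apply Real.one_le_exp
    have : (∑ w, if A (ω w) then s * a w else 0) = s * ∑ w, if A (ω w) then a w else 0 := by
      simp [Finset.mul_sum]
    rw [this]
    nlinarith
  · rw [← Finset.mul_sum, mul_div_assoc]
    refine (mul_le_mul_of_nonneg_left (sum_exp_indicator_le A _ hy) (by positivity)).trans ?_
    rw [← Real.exp_add]
    apply Real.exp_le_exp.2
    have h1 : ∑ w, (s * a w + (s * a w) ^ 2) ≤ s * m + s ^ 2 * M * m := by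
      have : ∀ w, s * a w + (s * a w) ^ 2 ≤ (s + s ^ 2 * M) * a w := fun w => by
        have := mul_le_mul_of_nonneg_left (haM w) (mul_nonneg (sq_nonneg s) (ha w))
        nlinarith
      refine (Finset.sum_le_sum fun w _ => this w).trans ?_
      rw [← Finset.mul_sum]
      nlinarith [mul_le_mul_of_nonneg_left hm (by positivity : 0 ≤ s + s ^ 2 * M)]
    have h2 := mul_le_mul_of_nonneg_left h1 hq
    have h3 : -(s * ((1 + θ) * q * m)) + q * (s * m + s ^ 2 * M * m) =
        -(θ ^ 2 * q * m / (4 * M)) := by rw [hs]; field_simp; ring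
    linarith

theorem prob_weight_lt_le {V β : Type*} [Fintype V] [Fintype β] [Nonempty β]
    (A : β → Prop) [DecidablePred A] (a : V → ℝ) {M m θ : ℝ} (ha : ∀ w, 0 ≤ a w)
    (haM : ∀ w, a w ≤ M) (hM : 0 < M) (hm : m ≤ ∑ w, a w) (hθ : 0 < θ) (hθ1 : θ ≤ 1) :
    prob (fun ω : V → β => (∑ w, if A (ω w) then a w else 0) < (1 - θ) * prob A * m) ≤
      Real.exp (-(θ ^ 2 * prob A * m / (4 * M))) := by
  classical
  set q := prob A
  have hq : 0 ≤ q := prob.nonneg A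
  set s := θ / (2 * M) with hs
  have hs0 : 0 < s := by positivity
  have hsM : s * M = θ / 2 := by rw [hs]; field_simp
  have hy : ∀ w, |-s * a w| ≤ 1 := fun w => by
    rw [neg_mul, abs_neg, abs_of_nonneg (mul_nonneg hs0.le (ha w))]
    nlinarith [haM w]
  refine (prob.markov _ (fun ω => Real.exp (s * ((1 - θ) * q * m)) *
    Real.exp (∑ w, if A (ω w) then -s * a w else 0)) (fun ω => by positivity) ?_).trans ?_
  · intro ω hω
    rw [← Real.exp_add]
    apply Real.one_le_exp
    have : (∑ w, if A (ω w) then -s * a w else 0) = -s * ∑ w, if A (ω w) then a w else 0 := by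
      simp [Finset.mul_sum]
    rw [this]
    nlinarith
  · rw [← Finset.mul_sum, mul_div_assoc]
    refine (mul_le_mul_of_nonneg_left (sum_exp_indicator_le A _ hy) (by positivity)).trans ?_
    rw [← Real.exp_add]
    apply Real.exp_le_exp.2
    have h1 : ∑ w, (-s * a w + (-s * a w) ^ 2) ≤ -(s - s ^ 2 * M) * m := by
      have : ∀ w, -s * a w + (-s * a w) ^ 2 ≤ -(s - s ^ 2 * M) * a w := fun w => by
        have := mul_le_mul_of_nonneg_left (haM w) (mul_nonneg (sq_nonneg s) (ha w))
        nlinarith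
      refine (Finset.sum_le_sum fun w _ => this w).trans ?_
      rw [← Finset.mul_sum]
      have : 0 ≤ s - s ^ 2 * M := by nlinarith
      nlinarith [mul_le_mul_of_nonneg_left hm this]
    have h2 := mul_le_mul_of_nonneg_left h1 hq
    have h3 : s * ((1 - θ) * q * m) + q * (-(s - s ^ 2 * M) * m) =
        -(θ ^ 2 * q * m / (4 * M)) := by rw [hs]; field_simp; ring
    linarith

/-! ## Random restrictions of spread sets -/

open Classical in
/-- The elements of `R` whose coordinates in `S` agree with `v`. -/
noncomputable def slice {X J V : Type*} (π : X → J → V) (R : Finset X) (S : Finset J)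
    (v : J → V) : Finset X := R.filter fun x => ∀ j ∈ S, π x j = v j

section slice

variable {X J V : Type*} {π : X → J → V} {R R' : Finset X} {S : Finset J} {v : J → V}

theorem mem_slice {x : X} : x ∈ slice π R S v ↔ x ∈ R ∧ ∀ j ∈ S, π x j = v j := by
  simp [slice]

theorem slice_empty : slice π R ∅ v = R := by ext; simp [mem_slice]

theorem slice_subset : slice π R S v ⊆ R := fun _ hx => (mem_slice.1 hx).1

theorem slice_mono (h : R ⊆ R') : slice π R S v ⊆ slice π R' S v := fun _ hx =>
  mem_slice.2 ⟨h (mem_slice.1 hx).1, (mem_slice.1 hx).2⟩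

theorem slice_subset_slice {S' : Finset J} {v' : J → V} (h : S' ⊆ S)
    (hv : ∀ j ∈ S', v j = v' j) : slice π R S v ⊆ slice π R S' v' := fun _ hx =>
  mem_slice.2 ⟨(mem_slice.1 hx).1, fun j hj => ((mem_slice.1 hx).2 j (h hj)).trans (hv j hj)⟩

/-- Restricting block `i` acts on a slice that leaves `i` free as a random subset acts on a weighted
set: the weight of `w` is the size of the slice with coordinate `i` equal to `w`. This makes the
concentration bounds applicable. -/
theorem card_slice_filter [Fintype V] [DecidableEq J] {β : Type*} (A : β → Prop)
    [DecidablePred A] {i : J} (hi : i ∉ S) (y : V → β) :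
    ((slice π (R.filter fun x => A (y (π x i))) S v).card : ℝ) =
      ∑ w, if A (y w) then ((slice π R (insert i S) (Function.update v i w)).card : ℝ) else 0 := by
  classical
  rw [Finset.card_eq_sum_card_fiberwise (f := fun x => π x i) (t := Finset.univ)
    (fun x _ => by simp)]
  push_cast
  refine Finset.sum_congr rfl fun w _ => ?_
  split_ifs with hA
  · congr 2
    ext x
    simp only [mem_slice, Finset.mem_filter, Finset.mem_insert]
    constructor
    · rintro ⟨⟨⟨hx, _⟩, hS⟩, rfl⟩
      refine ⟨hx, ?_⟩
      rintro j (rfl | hj)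
      · simp
      · rw [hS j hj, Function.update_of_ne (by rintro rfl; exact hi hj)]
    · rintro ⟨hx, h⟩
      have hw : π x i = w := by simpa using h i (Or.inl rfl)
      refine ⟨⟨⟨hx, by rwa [hw]⟩, fun j hj => ?_⟩, hw⟩
      rw [h j (Or.inr hj), Function.update_of_ne (by rintro rfl; exact hi hj)]
  · simp only [Nat.cast_eq_zero, Finset.card_eq_zero]
    ext x
    simp only [mem_slice, Finset.mem_filter, Finset.notMem_empty, iff_false]
    rintro ⟨⟨⟨_, hx⟩, _⟩, rfl⟩
    exact hA hx

theorem sum_card_slice_insert [Fintype V] [DecidableEq J] {i : J} (hi : i ∉ S) :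
    ∑ w, ((slice π R (insert i S) (Function.update v i w)).card : ℝ) = (slice π R S v).card := by
  classical
  have := card_slice_filter (π := π) (R := R) (S := S) (v := v) (fun _ : Unit => True) hi
    (fun _ => ())
  simpa using this.symm

end slice

theorem prod_update_card {J V : Type*} [Fintype J] [DecidableEq J] {W : J → Finset V} (i : J) (U : Finset V) (S : Finset J) (hi : i ∉ S) :
    (∏ j ∈ Sᶜ, ((Function.update W i U j).card : ℝ)) =
      U.card * ∏ j ∈ (insert i S)ᶜ, ((W j).card : ℝ) := by
  have h : Sᶜ = insert i (insert i S)ᶜ := by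
    ext j; by_cases hj : j = i <;> simp [hj, hi]
  rw [h, Finset.prod_insert (by simp)]
  simp only [Function.update_self]
  congr 1
  refine Finset.prod_congr rfl fun j hj => ?_
  rw [Function.update_of_ne]
  rintro rfl
  simp at hj

theorem prod_card_eq {J V : Type*} [Fintype J] [DecidableEq J] {W : J → Finset V} (i : J)
    (S : Finset J) (hi : i ∉ S) :
    (∏ j ∈ Sᶜ, ((W j).card : ℝ)) = (W i).card * ∏ j ∈ (insert i S)ᶜ, ((W j).card : ℝ) := by
  simpa using prod_update_card (W := W) i (W i) S hi

theorem card_filter_eq_sum {V β : Type*} [Fintype V] [DecidableEq V] (A : β → Prop)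
    [DecidablePred A] (U : Finset V) (y : V → β) : ((U.filter fun u => A (y u)).card : ℝ) =
      ∑ u, if A (y u) then (if u ∈ U then (1 : ℝ) else 0) else 0 := by
  rw [Finset.card_filter, ← Finset.univ_inter U, Nat.cast_sum, ← Finset.sum_ite_mem]
  refine Finset.sum_congr rfl fun u _ => ?_
  simp only [Finset.univ_inter]
  split_ifs <;> simp

/-- The deterministic part of the restriction of a block to a subset. -/
theorem restrict_block {X J V : Type*} [Fintype J] [DecidableEq J] {π : X → J → V}
    {R R' : Finset X} {W : J → Finset V} {U : Finset V} {a B L θ q : ℝ} (i : J)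
    (ha : 1 ≤ a) (hL : 0 < L) (hB : 0 < B) (hθ : 0 < θ) (hθ1 : θ < 1)
    (hRR : R' ⊆ R)
    (hs : ∀ S v, ((slice π R S v).card : ℝ) ≤ B * a ^ S.card * ∏ j ∈ Sᶜ, ((W j).card : ℝ))
    (hd : L * ∏ j, ((W j).card : ℝ) ≤ R.card) (hq : 0 < q)
    (h1 : (1 - θ) * q * (W i).card ≤ U.card) (h2 : (U.card : ℝ) ≤ (1 + θ) * q * (W i).card)
    (h3 : (1 - θ) * q * R.card ≤ R'.card)
    (h4 : ∀ S v, i ∉ S → ((slice π R' S v).card : ℝ) ≤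
      (1 + θ) * q * (B * a ^ S.card * ∏ j ∈ Sᶜ, ((W j).card : ℝ))) :
    (∀ S v, ((slice π R' S v).card : ℝ) ≤ (1 + θ) / (1 - θ) * B * a ^ S.card *
        ∏ j ∈ Sᶜ, ((Function.update W i U j).card : ℝ)) ∧
      L * ∏ j, ((Function.update W i U j).card : ℝ) ≤ (1 + θ) / (1 - θ) * R'.card := by
  have hκ : 1 ≤ (1 + θ) / (1 - θ) := by rw [le_div_iff₀ (by linarith)]; linarith
  have hprod : ∀ S : Finset J, 0 ≤ ∏ j ∈ S, ((W j).card : ℝ) := fun S => by positivity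
  refine ⟨fun S v => ?_, ?_⟩
  -- If `i ∈ S`, the size of block `i` does not enter the bound and monotonicity suffices. Otherwise
  -- slice and block both shrink by `q` up to `1 ± θ`, and the quotient of these errors is the new
  -- factor.
  · by_cases hi : i ∈ S
    · have h5 : (∏ j ∈ Sᶜ,
          ((Function.update W i U j).card : ℝ)) =
          ∏ j ∈ Sᶜ, ((W j).card : ℝ) := by
        refine Finset.prod_congr rfl fun j hj => ?_
        rw [Function.update_of_ne]
        rintro rfl
        simp [hi] at hj
      rw [h5]
      calc ((slice π R' S v).card : ℝ)
          ≤ (slice π R S v).card := by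
            exact_mod_cast Finset.card_le_card (slice_mono hRR)
        _ ≤ 1 * (B * a ^ S.card * ∏ j ∈ Sᶜ, ((W j).card : ℝ)) := by rw [one_mul]; exact hs S v
        _ ≤ (1 + θ) / (1 - θ) * (B * a ^ S.card * ∏ j ∈ Sᶜ, ((W j).card : ℝ)) := by
            have := hprod Sᶜ
            generalize ∏ j ∈ Sᶜ, ((W j).card : ℝ) = Q at this
            gcongr
        _ = _ := by ring
    · refine (h4 S v hi).trans ?_
      rw [prod_update_card i _ S hi, prod_card_eq i S hi]
      have hQ := hprod (insert i S)ᶜ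
      generalize ∏ j ∈ (insert i S)ᶜ, ((W j).card : ℝ) = Q at hQ
      have h6 : (1 + θ) * q * (W i).card ≤
          (1 + θ) / (1 - θ) * U.card := by
        rw [div_mul_eq_mul_div, le_div_iff₀ (by linarith)]
        nlinarith
      have h7 := mul_le_mul_of_nonneg_left h6
        (by positivity : 0 ≤ B * a ^ S.card * Q)
      calc _ = _ := by ring
        _ ≤ _ := h7
        _ = _ := by ring
  · have h5 := prod_update_card (W := W) i U ∅ (by simp)
    have h6 := prod_card_eq (W := W) i ∅ (by simp)
    rw [Finset.compl_empty] at h5 h6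
    rw [h5]
    rw [h6] at hd
    have hQ := hprod (insert i ∅)ᶜ
    generalize ∏ j ∈ (insert i ∅)ᶜ, ((W j).card : ℝ) = Q at hQ hd
    calc L * (U.card * Q)
        ≤ L * ((1 + θ) * q * (W i).card * Q) := by gcongr
      _ = (1 + θ) * q * (L * ((W i).card * Q)) := by ring
      _ ≤ (1 + θ) * q * R.card := by gcongr
      _ = (1 + θ) / (1 - θ) * ((1 - θ) * q * R.card) := by
          have : 1 - θ ≠ 0 := by linarith
          field_simp
      _ ≤ _ := by gcongr

/-! ### Random restriction of a single block -/

section restrict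

variable {X J V β : Type*} [DecidableEq J] [Fintype V] [Fintype β] [Nonempty β]
  (π : X → J → V) (A : β → Prop) [DecidablePred A]

theorem prob_card_restrict_lt_le (U : Finset V) {θ : ℝ} (hθ : 0 < θ) (hθ1 : θ ≤ 1) :
    prob (fun y : V → β => ((U.filter fun u => A (y u)).card : ℝ) <
      (1 - θ) * prob A * U.card) ≤ Real.exp (-(θ ^ 2 * prob A * U.card / (4 * 1))) := by
  classical
  simp only [card_filter_eq_sum A U]
  refine prob_weight_lt_le A _ (M := 1) (fun u => ?_) (fun u => ?_) one_pos (by simp) hθ hθ1 <;>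
    split_ifs <;> simp

theorem prob_card_restrict_gt_le (U : Finset V) {θ : ℝ} (hθ : 0 < θ) (hθ1 : θ ≤ 1) :
    prob (fun y : V → β => (1 + θ) * prob A * U.card <
      ((U.filter fun u => A (y u)).card : ℝ)) ≤
      Real.exp (-(θ ^ 2 * prob A * U.card / (4 * 1))) := by
  classical
  simp only [card_filter_eq_sum A U]
  refine prob_weight_gt_le A _ (M := 1) (fun u => ?_) (fun u => ?_) one_pos (by simp) hθ hθ1 <;>
    split_ifs <;> simp

theorem prob_card_slice_gt_le {R : Finset X} {S : Finset J} {v : J → V} {i : J} (hi : i ∉ S)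
    {M m θ : ℝ} (hM : 0 < M)
    (hfib : ∀ u, ((slice π R (insert i S) (Function.update v i u)).card : ℝ) ≤ M)
    (hm : ((slice π R S v).card : ℝ) ≤ m) (hθ : 0 < θ) (hθ1 : θ ≤ 1) :
    prob (fun y : V → β => (1 + θ) * prob A * m <
      ((slice π (R.filter fun x => A (y (π x i))) S v).card : ℝ)) ≤
      Real.exp (-(θ ^ 2 * prob A * m / (4 * M))) := by
  simp only [card_slice_filter A hi]
  rw [← sum_card_slice_insert hi] at hm
  exact prob_weight_gt_le A _ (fun u => by positivity) hfib hM hm hθ hθ1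

theorem prob_card_slice_lt_le {R : Finset X} {S : Finset J} {v : J → V} {i : J} (hi : i ∉ S)
    {M θ : ℝ} (hM : 0 < M)
    (hfib : ∀ u, ((slice π R (insert i S) (Function.update v i u)).card : ℝ) ≤ M)
    (hθ : 0 < θ) (hθ1 : θ ≤ 1) :
    prob (fun y : V → β => ((slice π (R.filter fun x => A (y (π x i))) S v).card : ℝ) <
      (1 - θ) * prob A * (slice π R S v).card) ≤
      Real.exp (-(θ ^ 2 * prob A * (slice π R S v).card / (4 * M))) := by
  simp only [card_slice_filter A hi]
  exact prob_weight_lt_le A _ (fun u => by positivity) hfib hM (sum_card_slice_insert hi).ge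
    hθ hθ1

/-- Restricting a block to a random subset preserves spreadness and density up to small factors,
except with small probability. -/
theorem prob_restrict_block_le [Fintype J] {R : Finset X} {W : J → Finset V} {a B L θ w : ℝ} (i : J)
    (ha : 1 ≤ a) (hL : 0 < L) (hLB : L ≤ B) (hBL : B ≤ 8 * L) (hθ : 0 < θ) (hθ1 : θ < 1)
    (hA : 0 < prob A) (hpos : ∀ j, 0 < (W j).card) (hw : w ≤ (W i).card)
    (hs : ∀ S v, ((slice π R S v).card : ℝ) ≤ B * a ^ S.card * ∏ j ∈ Sᶜ, ((W j).card : ℝ))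
    (hd : L * ∏ j, ((W j).card : ℝ) ≤ R.card) :
    prob (fun y : V → β => ¬ ((1 - θ) * prob A * (W i).card ≤
        ((W i).filter fun u => A (y u)).card ∧
      (∀ S v, ((slice π (R.filter fun x => A (y (π x i))) S v).card : ℝ) ≤
        (1 + θ) / (1 - θ) * B * a ^ S.card *
          ∏ j ∈ Sᶜ, ((Function.update W i ((W i).filter fun u => A (y u)) j).card : ℝ)) ∧
      L * ∏ j, ((Function.update W i ((W i).filter fun u => A (y u)) j).card : ℝ) ≤
        (1 + θ) / (1 - θ) * (R.filter fun x => A (y (π x i))).card)) ≤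
    (Fintype.card (Finset J × (J → V)) + 3) *
      Real.exp (-(θ ^ 2 * prob A * w / (32 * a))) := by
  classical
  set q := prob A with hq
  set η := Real.exp (-(θ ^ 2 * q * w / (32 * a))) with hη
  have hB : 0 < B := hL.trans_le hLB
  have hposR : ∀ j, (0 : ℝ) < (W j).card := fun j => by exact_mod_cast hpos j
  have hprod : ∀ S : Finset J, 0 < ∏ j ∈ S, ((W j).card : ℝ) := fun S =>
    Finset.prod_pos fun j _ => hposR j
  have hwi := hposR i
  have hκ : 1 ≤ (1 + θ) / (1 - θ) := by rw [le_div_iff₀ (by linarith)]; linarith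
  have hηle : ∀ t : ℝ, θ ^ 2 * q * (W i).card / (32 * a) ≤ t → Real.exp (-t) ≤ η := by
    intro t ht
    apply Real.exp_le_exp.2
    have : θ ^ 2 * q * w / (32 * a) ≤ θ ^ 2 * q * (W i).card / (32 * a) := by gcongr
    linarith
  have hexp1 : θ ^ 2 * q * (W i).card / (32 * a) ≤ θ ^ 2 * q * (W i).card / (4 * 1) := by
    gcongr; linarith
  have e1 : prob (fun y : V → β => (((W i).filter fun u => A (y u)).card : ℝ) <
      (1 - θ) * q * (W i).card) ≤ η := by
    exact (prob_card_restrict_lt_le A _ hθ hθ1.le).trans (hηle _ hexp1)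
  have e2 : prob (fun y : V → β => (1 + θ) * q * (W i).card <
      (((W i).filter fun u => A (y u)).card : ℝ)) ≤ η := by
    exact (prob_card_restrict_gt_le A _ hθ hθ1.le).trans (hηle _ hexp1)
  have hfib : ∀ S v, i ∉ S → ∀ w', ((slice π R (insert i S) (Function.update v i w')).card : ℝ) ≤
      B * a ^ (S.card + 1) * ∏ j ∈ (insert i S)ᶜ, ((W j).card : ℝ) := by
    intro S v hi w'
    refine (hs _ _).trans (le_of_eq ?_)
    rw [Finset.card_insert_of_notMem hi]
  -- A single weight is at most the spread bound with one more coordinate fixed, so the bound for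
  -- the total weight divided by that for a single weight is `|W i| / a`.
  have e3 : ∀ p : Finset J × (J → V), prob (fun y : V → β => i ∉ p.1 ∧
      (1 + θ) * q * (B * a ^ p.1.card * ∏ j ∈ p.1ᶜ, ((W j).card : ℝ)) <
      ((slice π (R.filter fun x => A (y (π x i))) p.1 p.2).card : ℝ)) ≤ η := by
    rintro ⟨S, v⟩
    by_cases hi : i ∈ S
    · rw [prob.of_false (fun y h => h.1 hi)]; positivity
    have hMpos : 0 < B * a ^ (S.card + 1) * ∏ j ∈ (insert i S)ᶜ, ((W j).card : ℝ) := by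
      exact mul_pos (by positivity) (hprod _)
    refine (prob.mono (fun y h => h.2)).trans ?_
    refine (prob_card_slice_gt_le π A hi hMpos (hfib S v hi) (hs S v) hθ hθ1.le).trans (hηle _ ?_)
    rw [prod_card_eq i S hi, pow_succ a, ← hq]
    have hQ := hprod (insert i S)ᶜ
    generalize ∏ j ∈ (insert i S)ᶜ, ((W j).card : ℝ) = Q at hQ
    rw [div_le_div_iff₀ (by positivity) (by positivity)]
    have h0 : 0 ≤ θ ^ 2 * q * (W i).card * (B * a ^ S.card * a * Q) := by positivity
    linarith
  -- For a lower tail the total weight must be bounded from below, and only `L` is available there.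
  -- Replacing `B` by `8 L` turns the 4 of the tail bound into 32.
  have e4 : prob (fun y : V → β => ((R.filter fun x => A (y (π x i))).card : ℝ) <
      (1 - θ) * q * R.card) ≤ η := by
    by_cases hV : Nonempty V
    · have v : J → V := fun _ => Classical.arbitrary V
      have hMpos : 0 < B * a ^ (0 + 1) * ∏ j ∈ (insert i ∅)ᶜ, ((W j).card : ℝ) := by
        exact mul_pos (by positivity) (hprod _)
      have := prob_card_slice_lt_le π A (R := R) (Finset.notMem_empty i) hMpos
        (fun u => by simpa using hfib ∅ v (Finset.notMem_empty i) u) hθ hθ1.le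
      simp only [slice_empty] at this
      refine this.trans (hηle _ ?_)
      have h1 := prod_card_eq (W := W) i ∅ (Finset.notMem_empty i)
      rw [Finset.compl_empty] at h1
      rw [h1] at hd
      have hQ := hprod (insert i ∅)ᶜ
      generalize ∏ j ∈ (insert i ∅)ᶜ, ((W j).card : ℝ) = Q at hQ hd
      rw [div_le_div_iff₀ (by positivity) (by positivity)]
      have h2 : B * ((W i).card * Q) ≤ 8 * R.card := by
        have := mul_le_mul_of_nonneg_right hBL (by positivity : (0 : ℝ) ≤ (W i).card * Q)
        linarith
      have h3 := mul_le_mul_of_nonneg_left h2 (by positivity : 0 ≤ 4 * θ ^ 2 * q * a)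
      calc θ ^ 2 * q * (W i).card * (4 * (B * a ^ (0 + 1) * Q))
          = 4 * θ ^ 2 * q * a * (B * ((W i).card * Q)) := by ring
        _ ≤ _ := h3
        _ = _ := by ring
    · exact (hV ⟨(Finset.card_pos.1 (hpos i)).choose⟩).elim
  refine le_trans (prob.mono (q := fun y : V → β =>
    ((((W i).filter fun u => A (y u)).card : ℝ) < (1 - θ) * q * (W i).card ∨
      (1 + θ) * q * (W i).card < (((W i).filter fun u => A (y u)).card : ℝ)) ∨
    ((R.filter fun x => A (y (π x i))).card : ℝ) < (1 - θ) * q * R.card ∨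
    ∃ p : Finset J × (J → V), i ∉ p.1 ∧
      (1 + θ) * q * (B * a ^ p.1.card * ∏ j ∈ p.1ᶜ, ((W j).card : ℝ)) <
      ((slice π (R.filter fun x => A (y (π x i))) p.1 p.2).card : ℝ)) ?_) ?_
  · intro y hy
    contrapose! hy
    obtain ⟨⟨h1, h2⟩, h3, h4⟩ := hy
    exact ⟨h1, restrict_block i ha hL hB hθ hθ1 (Finset.filter_subset _ _) hs hd hA h1 h2 h3
      fun S v => h4 (S, v)⟩
  · refine (prob.or_le _ _).trans ((add_le_add ((prob.or_le _ _).trans (add_le_add e1 e2))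
      ((prob.or_le _ _).trans (add_le_add e4 (prob.exists_le_card _ e3)))).trans (le_of_eq ?_))
    ring

end restrict

/-! ### Random restriction of all blocks -/

section restrictAll

variable {X J V β : Type*} [Fintype J] [DecidableEq J] [Fintype V] [Fintype β] [Nonempty β]
  (π : X → J → V) (A : β → Prop) [DecidablePred A]

/-- The blocks in `Y` are restricted to random subsets. -/
def restrictBlocks (W : J → Finset V) (Y : Finset J) (ω : J → V → β) (j : J) : Finset V :=
  if j ∈ Y then (W j).filter fun u => A (ω j u) else W j

/-- The tuples whose coordinates in `Y` survive the random restriction. -/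
def restrictSet (R : Finset X) (Y : Finset J) (ω : J → V → β) : Finset X :=
  R.filter fun x => ∀ j ∈ Y, A (ω j (π x j))

/-- After the restriction of the blocks in `Y`, the blocks are still large and the set of tuples is
still spread and dense. -/
structure RestrictGood (R : Finset X) (W : J → Finset V) (a B θ : ℝ) (Y : Finset J)
    (ω : J → V → β) : Prop where
  size : ∀ j ∈ Y, (1 - θ) * prob A * (W j).card ≤ (restrictBlocks A W Y ω j).card
  spread : ∀ S v, ((slice π (restrictSet π A R Y ω) S v).card : ℝ) ≤
    ((1 + θ) / (1 - θ)) ^ Y.card * B * a ^ S.card *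
      ∏ j ∈ Sᶜ, ((restrictBlocks A W Y ω j).card : ℝ)
  dense : B * ∏ j, ((restrictBlocks A W Y ω j).card : ℝ) ≤
    ((1 + θ) / (1 - θ)) ^ Y.card * (restrictSet π A R Y ω).card

variable {π A}

theorem restrictBlocks_insert {W : J → Finset V} {Y : Finset J} {ω : J → V → β} {i : J}
    (hi : i ∉ Y) (y : V → β) : restrictBlocks A W (insert i Y) (Function.update ω i y) =
      Function.update (restrictBlocks A W Y ω) i
        ((restrictBlocks A W Y ω i).filter fun u => A (y u)) := by
  ext j : 1
  by_cases hj : j = i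
  · subst hj; simp [restrictBlocks, hi]
  · simp [restrictBlocks, hj]

theorem restrictBlocks_update {W : J → Finset V} {Y : Finset J} {ω : J → V → β} {i : J}
    (hi : i ∉ Y) (y : V → β) : restrictBlocks A W Y (Function.update ω i y) =
      restrictBlocks A W Y ω := by
  ext j : 1
  by_cases hj : j = i
  · subst hj; simp [restrictBlocks, hi]
  · simp [restrictBlocks, hj]

theorem restrictSet_insert {R : Finset X} {Y : Finset J} {ω : J → V → β} {i : J}
    (hi : i ∉ Y) (y : V → β) : restrictSet π A R (insert i Y) (Function.update ω i y) =
      (restrictSet π A R Y ω).filter fun x => A (y (π x i)) := by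
  ext x
  have : ∀ j ∈ Y, Function.update ω i y j = ω j := fun j hj =>
    Function.update_of_ne (by rintro rfl; exact hi hj) _ _
  simp only [restrictSet, Finset.mem_filter, Finset.mem_insert, forall_eq_or_imp,
    Function.update_self]
  constructor
  · rintro ⟨h1, h2, h3⟩; exact ⟨⟨h1, fun j hj => this j hj ▸ h3 j hj⟩, h2⟩
  · rintro ⟨⟨h1, h3⟩, h2⟩; exact ⟨h1, h2, fun j hj => (this j hj).symm ▸ h3 j hj⟩

theorem restrictSet_update {R : Finset X} {Y : Finset J} {ω : J → V → β} {i : J}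
    (hi : i ∉ Y) (y : V → β) : restrictSet π A R Y (Function.update ω i y) =
      restrictSet π A R Y ω := by
  ext x
  have : ∀ j ∈ Y, Function.update ω i y j = ω j := fun j hj =>
    Function.update_of_ne (by rintro rfl; exact hi hj) _ _
  simp only [restrictSet, Finset.mem_filter]
  exact and_congr_right fun _ => forall₂_congr fun j hj => by rw [this j hj]

theorem RestrictGood.update {R : Finset X} {W : J → Finset V} {a B θ : ℝ} {Y : Finset J}
    {ω : J → V → β} {i : J} (hi : i ∉ Y) {y : V → β}
    (h : RestrictGood π A R W a B θ Y (Function.update ω i y)) :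
    RestrictGood π A R W a B θ Y ω := by
  constructor
  · simpa only [restrictBlocks_update hi] using h.size
  · simpa only [restrictBlocks_update hi, restrictSet_update hi] using h.spread
  · simpa only [restrictBlocks_update hi, restrictSet_update hi] using h.dense

/-- The blocks are restricted one at a time, conditionally on all others; each step is
`prob_restrict_block_le`. Upper and lower bounds drift apart by `(1 + θ) / (1 - θ)` each per block,
and the bound 8 on the total drift is the hypothesis `B ≤ 8 * L` needed for the next block. -/
theorem prob_not_restrictGood_le {R : Finset X} {W : J → Finset V} {a B θ w : ℝ}
    (ha : 1 ≤ a) (hB : 0 < B) (hθ : 0 < θ) (hθ1 : θ < 1) (hA : 0 < prob A)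
    (hκ : ((1 + θ) / (1 - θ)) ^ (2 * Fintype.card J) ≤ 8)
    (hpos : ∀ j, 0 < (W j).card) (hw : ∀ j, w ≤ (W j).card)
    (hs : ∀ S v, ((slice π R S v).card : ℝ) ≤ B * a ^ S.card * ∏ j ∈ Sᶜ, ((W j).card : ℝ))
    (hd : B * ∏ j, ((W j).card : ℝ) ≤ R.card) (Y : Finset J) :
    prob (fun ω : J → V → β => ¬ RestrictGood π A R W a B θ Y ω) ≤
      Y.card * ((Fintype.card (Finset J × (J → V)) + 3) *
        Real.exp (-(θ ^ 2 * prob A * w / (32 * a)))) := by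
  set κ := (1 + θ) / (1 - θ) with hκdef
  have hκ1 : 1 ≤ κ := by rw [hκdef, le_div_iff₀ (by linarith)]; linarith
  set E := (Fintype.card (Finset J × (J → V)) + 3) *
    Real.exp (-(θ ^ 2 * prob A * w / (32 * a))) with hE
  have hE0 : 0 ≤ E := by positivity
  induction Y using Finset.induction_on with
  | empty =>
    rw [prob.of_false]
    · simp
    · intro ω
      rw [not_not]
      constructor
      · simp
      · intro S v
        simpa [restrictSet, restrictBlocks] using hs S v
      · simpa [restrictSet, restrictBlocks] using hd
  | insert i Y hi ih =>
    rw [Finset.card_insert_of_notMem hi]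
    push_cast
    rw [add_mul, one_mul]
    refine (prob.mono (q := fun ω : J → V → β => ¬ RestrictGood π A R W a B θ Y ω ∨
      (RestrictGood π A R W a B θ Y ω ∧ ¬ RestrictGood π A R W a B θ (insert i Y) ω)) ?_).trans
      ((prob.or_le _ _).trans (add_le_add ih ?_))
    · intro ω h
      by_cases h' : RestrictGood π A R W a B θ Y ω
      · exact Or.inr ⟨h', h⟩
      · exact Or.inl h'
    refine prob.le_of_update i _ hE0 fun ω => ?_
    by_cases hgood : RestrictGood π A R W a B θ Y ω
    swap
    · rw [prob.of_false (fun y h => hgood (h.1.update hi))]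
      exact hE0
    have hκY : 1 ≤ κ ^ Y.card := one_le_pow₀ hκ1
    have hκ0 : 0 < κ := by linarith
    have hWi : restrictBlocks A W Y ω i = W i := by simp [restrictBlocks, hi]
    have key := prob_restrict_block_le π A (R := restrictSet π A R Y ω)
      (W := restrictBlocks A W Y ω) (a := a) (B := κ ^ Y.card * B) (L := B / κ ^ Y.card) (θ := θ)
      (w := w) i ha (by positivity)
      (by rw [div_le_iff₀ (by positivity)]; nlinarith [mul_le_mul hκY hκY zero_le_one (by linarith)])
      (by
        have h1 : κ ^ (2 * Y.card) ≤ 8 := le_trans (pow_le_pow_right₀ hκ1 (by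
          have := Finset.card_le_univ Y; omega)) hκ
        have h2 : κ ^ Y.card * B = κ ^ (2 * Y.card) * (B / κ ^ Y.card) := by
          rw [two_mul, pow_add]; field_simp
        rw [h2]
        gcongr)
      hθ hθ1 hA
      (by
        intro j
        by_cases hj : j ∈ Y
        · have h1 := hgood.size j hj
          have h2 : (0 : ℝ) < (W j).card := by exact_mod_cast hpos j
          have h3 : 0 < (1 - θ) * prob A * (W j).card :=
            mul_pos (mul_pos (by linarith) hA) h2
          exact_mod_cast h3.trans_le h1
        · simpa [restrictBlocks, hj] using Finset.card_pos.1 (hpos j))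
      (by rw [hWi]; exact hw i) hgood.spread
      (by
        have := hgood.dense
        rw [div_mul_eq_mul_div, div_le_iff₀ (by positivity)]
        linarith)
    refine le_trans (prob.mono fun y hy => ?_) key
    contrapose! hy
    intro _
    obtain ⟨h1, h2, h3⟩ := hy
    constructor
    · intro j hj
      rw [restrictBlocks_insert hi]
      rcases eq_or_ne j i with rfl | hji
      · rw [Function.update_self]
        simpa only [hWi] using h1
      · rw [Function.update_of_ne hji]
        exact hgood.size j (Finset.mem_of_mem_insert_of_ne hj hji)
    · intro S v
      rw [restrictBlocks_insert hi, restrictSet_insert hi, Finset.card_insert_of_notMem hi]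
      refine (h2 S v).trans (le_of_eq ?_)
      rw [pow_succ]; ring
    · rw [restrictBlocks_insert hi, restrictSet_insert hi, Finset.card_insert_of_notMem hi]
      rw [div_mul_eq_mul_div, div_le_iff₀ (by positivity)] at h3
      refine h3.trans (le_of_eq ?_)
      rw [pow_succ]; ring

end restrictAll

/-! ## Restoring spreadness -/

section spread

variable {I V : Type*} [DecidableEq I]

/-- `P` is spread outside `T`: fixing the coordinates in a set `S` disjoint from `T` decreases the
size of `P` at least by the factor `∏ j ∈ S, c j`. -/
def IsSpread (c : I → ℝ) (T : Finset I) (P : Finset (I → V)) : Prop :=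
  ∀ S v, Disjoint S T → ((slice id P S v).card : ℝ) * ∏ j ∈ S, c j ≤ P.card

/-- Allows pieces with the same fixed values to be merged, so that one piece per pair `(S, v)` is
enough. -/
theorem IsSpread.union [DecidableEq (I → V)] {c : I → ℝ} (hc : ∀ j, 0 ≤ c j) {T : Finset I}
    {P Q : Finset (I → V)} (hP : IsSpread c T P) (hQ : IsSpread c T Q) (h : Disjoint P Q) :
    IsSpread c T (P ∪ Q) := by
  intro S v hS
  have h1 := hP S v hS
  have h2 := hQ S v hS
  have h3 : (slice id (P ∪ Q) S v).card ≤ (slice id P S v).card + (slice id Q S v).card := by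
    refine le_trans (Finset.card_le_card fun x hx => ?_) (Finset.card_union_le _ _)
    simp only [mem_slice, Finset.mem_union] at hx ⊢
    tauto
  have h4 : ((slice id (P ∪ Q) S v).card : ℝ) ≤ (slice id P S v).card + (slice id Q S v).card := by
    exact_mod_cast h3
  have h5 : 0 ≤ ∏ j ∈ S, c j := Finset.prod_nonneg fun j _ => hc j
  rw [Finset.card_union_of_disjoint h]
  push_cast
  nlinarith

variable [Fintype I] [Fintype V]

/-- Every nonempty set of tuples can be covered up to one half by spread pieces. -/
theorem exists_spread_pieces {c : I → ℝ} (hc : ∀ j, 0 < c j) (T : Finset I)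
    {Q : Finset (I → V)} (hQ : Q.Nonempty) :
    ∃ f : Finset I → (I → V) → Finset (I → V),
      (∀ S v, f S v ⊆ slice id Q S v ∧ IsSpread c (T ∪ S) (f S v) ∧
        ((f S v).Nonempty → Disjoint S T ∧ (Q.card : ℝ) ≤ 2 * (f S v).card * ∏ j ∈ S, c j)) ∧
      ∃ C : Finset (I → V), Q.card ≤ 2 * C.card ∧ ∀ x ∈ C, ∃ S v, x ∈ f S v := by
  classical
  -- Choose the pieces so that they cover as many tuples as possible. If more than half of `Q` were
  -- left over, as `Q'`, take a maximal `S` with a slice of `Q'` of size at least `|Q'| / ∏ c j`.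
  -- Maximality makes this slice spread, since a violation on `S'` would turn `S ∪ S'` into a larger
  -- candidate; so the slice could be added to the pieces.
  let good : Set (Finset I → (I → V) → Finset (I → V)) := {f | ∀ S v, f S v ⊆ slice id Q S v ∧
    IsSpread c (T ∪ S) (f S v) ∧
        ((f S v).Nonempty → Disjoint S T ∧ (Q.card : ℝ) ≤ 2 * (f S v).card * ∏ j ∈ S, c j)}
  let cov : (Finset I → (I → V) → Finset (I → V)) → Finset (I → V) := fun f =>
    Q.filter fun x => ∃ S v, x ∈ f S v
  have hne : good.Nonempty := ⟨fun _ _ => ∅, fun S v => ⟨by simp, fun S v _ => by simp [slice],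
    by simp⟩⟩
  obtain ⟨f, hf, hmax⟩ := Set.exists_max_image good (fun f => (cov f).card) (Set.toFinite _) hne
  refine ⟨f, hf, cov f, ?_, fun x hx => (Finset.mem_filter.1 hx).2⟩
  by_contra! hlt
  let Q' := Q.filter fun x => ¬ ∃ S v, x ∈ f S v
  have hQQ' : (cov f).card + Q'.card = Q.card := Finset.card_filter_add_card_filter_not _
  have hQ'pos : 0 < Q'.card := by omega
  let cand := (Finset.univ : Finset (Finset I)).filter fun S => Disjoint S T ∧
    ∃ v, (Q'.card : ℝ) ≤ (slice id Q' S v).card * ∏ j ∈ S, c j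
  have hcand : cand.Nonempty := by
    refine ⟨∅, Finset.mem_filter.2 ⟨Finset.mem_univ _, by simp, hQ.choose, ?_⟩⟩
    simp [slice_empty]
  obtain ⟨S, hS, hSmax⟩ := Finset.exists_max_image cand Finset.card hcand
  obtain ⟨-, hST, v, hv⟩ := Finset.mem_filter.1 hS
  have hprod : ∀ S : Finset I, 0 < ∏ j ∈ S, c j := fun S => Finset.prod_pos fun j _ => hc j
  set R := slice id Q' S v with hR
  have hRspread : IsSpread c (T ∪ S) R := by
    intro S' v' hS'
    rw [Finset.disjoint_union_right] at hS'
    by_contra! hgt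
    have hslice : slice id R S' v' = slice id Q' (S ∪ S') (fun j => if j ∈ S then v j else v' j) := by
      ext x
      simp only [hR, mem_slice, Finset.mem_union, id]
      constructor
      · rintro ⟨⟨h1, h2⟩, h3⟩
        refine ⟨h1, fun j hj => ?_⟩
        split_ifs with hjS
        · exact h2 j hjS
        · exact h3 j (hj.resolve_left hjS)
      · rintro ⟨h1, h2⟩
        refine ⟨⟨h1, fun j hj => by simpa [hj] using h2 j (Or.inl hj)⟩, fun j hj => ?_⟩
        have := h2 j (Or.inr hj)
        rwa [if_neg (Finset.disjoint_left.1 hS'.2 hj)] at this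
    have hmem : S ∪ S' ∈ cand := by
      refine Finset.mem_filter.2 ⟨Finset.mem_univ _, Finset.disjoint_union_left.2 ⟨hST, hS'.1⟩,
        fun j => if j ∈ S then v j else v' j, ?_⟩
      · rw [← hslice, Finset.prod_union hS'.2.symm]
        refine hv.trans ?_
        have := mul_le_mul_of_nonneg_right hgt.le (hprod S).le
        linarith
    have hcard := hSmax _ hmem
    rw [Finset.card_union_of_disjoint hS'.2.symm] at hcard
    have hS'0 : S' = ∅ := Finset.card_eq_zero.1 (by omega)
    subst hS'0
    simp [slice_empty] at hgt
  have hRdisj : ∀ S v, Disjoint (f S v) R := fun S v => Finset.disjoint_right.2 fun x hx hx' =>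
    (Finset.mem_filter.1 (slice_subset hx)).2 ⟨S, v, hx'⟩
  have hRne : R.Nonempty := by
    rw [← Finset.card_pos]
    by_contra! h0
    have : R.card = 0 := by omega
    rw [this] at hv
    simp only [Nat.cast_zero, zero_mul] at hv
    have : (0 : ℝ) < Q'.card := by exact_mod_cast hQ'pos
    linarith
  let f' : Finset I → (I → V) → Finset (I → V) :=
    fun S₁ v₁ => if S₁ = S ∧ v₁ = v then f S v ∪ R else f S₁ v₁
  have hf' : f' ∈ good := by
    intro S₁ v₁
    by_cases h : S₁ = S ∧ v₁ = v
    · obtain ⟨rfl, rfl⟩ := h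
      simp only [f', and_self, if_true]
      obtain ⟨h1, h2, h3⟩ := hf S₁ v₁
      refine ⟨Finset.union_subset h1 (slice_mono (Finset.filter_subset _ _)),
        h2.union (fun j => (hc j).le) hRspread (hRdisj _ _), fun _ => ⟨hST, ?_⟩⟩
      have h4 : (Q.card : ℝ) ≤ 2 * Q'.card := by exact_mod_cast (by omega : Q.card ≤ 2 * Q'.card)
      have h5 : (R.card : ℝ) ≤ (f S₁ v₁ ∪ R).card := by
        exact_mod_cast Finset.card_le_card Finset.subset_union_right
      have := mul_le_mul_of_nonneg_right h5 (hprod S₁).le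
      linarith
    · simp only [f', if_neg h]
      exact hf S₁ v₁
  have hsub : cov f ⊂ cov f' := by
    refine Finset.ssubset_iff_of_subset ?_ |>.2 ?_
    · intro x hx
      obtain ⟨h1, S₁, v₁, h2⟩ := Finset.mem_filter.1 hx
      refine Finset.mem_filter.2 ⟨h1, S₁, v₁, ?_⟩
      by_cases h : S₁ = S ∧ v₁ = v
      · simp only [f', if_pos h]
        rw [h.1, h.2] at h2
        exact Finset.mem_union_left _ h2
      · simpa only [f', if_neg h] using h2
    · obtain ⟨x, hx⟩ := hRne
      have hx' := Finset.mem_filter.1 (slice_subset hx)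
      refine ⟨x, Finset.mem_filter.2 ⟨hx'.1, S, v, ?_⟩, fun h => hx'.2 (Finset.mem_filter.1 h).2⟩
      simp only [f', and_self, if_true]
      exact Finset.mem_union_right _ hx
  exact absurd (hmax f' hf') (not_le.2 (Finset.card_lt_card hsub))

end spread

/-- The number of sets of size at most `r`. -/
theorem card_finset_card_le {Y : Type*} [Fintype Y] [DecidableEq Y] (r : ℕ) :
    ((Finset.univ : Finset (Finset Y)).filter fun D => D.card ≤ r).card ≤
      (Fintype.card Y + 1) ^ r := by
  classical
  let g : (Fin r → Option Y) → Finset Y := fun h =>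
    Finset.univ.filter fun y => ∃ i, h i = some y
  have h1 : ((Finset.univ : Finset (Finset Y)).filter fun D => D.card ≤ r) ⊆
      Finset.univ.image g := by
    intro D hD
    have hD := (Finset.mem_filter.1 hD).2
    refine Finset.mem_image.2 ⟨fun i => if h : i.1 < D.card then
      some (D.equivFin.symm ⟨i.1, h⟩).1 else none, Finset.mem_univ _, ?_⟩
    ext y
    simp only [g, Finset.mem_filter, Finset.mem_univ, true_and]
    constructor
    · rintro ⟨i, hi⟩
      split_ifs at hi with h
      simp only [Option.some.injEq] at hi
      exact hi ▸ (D.equivFin.symm ⟨i.1, h⟩).2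
    · intro hy
      have hlt := (D.equivFin ⟨y, hy⟩).2
      refine ⟨⟨(D.equivFin ⟨y, hy⟩).1, hlt.trans_le hD⟩, ?_⟩
      simp [hlt]
  refine (Finset.card_le_card h1).trans (Finset.card_image_le.trans ?_)
  simp

/-! ## Cliques in random graphs inside large spread sets -/

theorem prob.forall_of_injective {D E ι β : Type*} [Fintype D] [Fintype E] [Finite ι] [Finite β]
    [Nonempty β] {φ : D × E → ι} (hφ : Function.Injective φ) (p : D → (E → β) → Prop) :
    prob (fun ω : ι → β => ∀ d, p d (fun e => ω (φ (d, e)))) = ∏ d, prob (p d) := by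
  rw [← prob.pi, ← prob.comp_equiv (Equiv.curry D E β),
    ← prob.comp_injective hφ (fun ω : D × E → β => ∀ d, p d (Equiv.curry D E β ω d))]
  rfl

theorem prob_bool_true : prob (fun b : Bool => b = true) = 1 / 2 := by
  rw [prob.eq_sum]; simp

theorem prob_forall_true (E : Type*) [Fintype E] :
    prob (fun ω : E → Bool => ∀ e, ω e = true) = (1 / 2) ^ Fintype.card E := by
  rw [prob.pi (fun (_ : E) (b : Bool) => b = true)]
  simp [prob_bool_true]

section clique

variable {I V : Type*} [LinearOrder I] [Fintype I] [Fintype V] [DecidableEq V]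

/-- The vertices `(s, v s)` with `s ∈ S` form a clique. -/
def IsCliqueOn (ω : Sym2 (I × V) → Bool) (S : Finset I) (v : I → V) : Prop :=
  ∀ s ∈ S, ∀ t ∈ S, s ≠ t → ω s((s, v s), (t, v t)) = true

/-- Distinct tuples of `Λ` agree in at most one coordinate of `S`. Hence they use disjoint sets of
edges, and being a clique is independent for them, with probability at least `2 ^ (-|S| ^ 2)` each.
The order on `I` only selects one orientation of every edge. -/
theorem prob_no_clique_le (S : Finset I) (Λ : Finset (I → V))
    (hΛ : ∀ v ∈ Λ, ∀ v' ∈ Λ, ∀ s ∈ S, ∀ t ∈ S, s ≠ t → v s = v' s → v t = v' t → v = v') :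
    prob (fun ω : Sym2 (I × V) → Bool => ∀ v ∈ Λ, ¬ IsCliqueOn ω S v) ≤
      Real.exp (-((1 / 2) ^ (S.card ^ 2) * Λ.card)) := by
  let E := {e : I × I // e ∈ S ×ˢ S ∧ e.1 < e.2}
  let φ : Λ × E → Sym2 (I × V) := fun x => s((x.2.1.1, x.1.1 x.2.1.1), (x.2.1.2, x.1.1 x.2.1.2))
  have hφ : Function.Injective φ := by
    rintro ⟨⟨v, hv⟩, ⟨⟨s, t⟩, hst, hlt⟩⟩ ⟨⟨v', hv'⟩, ⟨⟨s', t'⟩, hst', hlt'⟩⟩ h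
    simp only [φ, Sym2.eq_iff, Prod.mk.injEq] at h
    simp only at hlt hlt'
    rcases h with ⟨⟨rfl, h1⟩, rfl, h2⟩ | ⟨⟨rfl, h1⟩, rfl, h2⟩
    · rw [Finset.mem_product] at hst
      have := hΛ v hv v' hv' s hst.1 t hst.2 hlt.ne h1 h2
      subst this
      rfl
    · exact absurd hlt hlt'.asymm
  have hcardE : Fintype.card E ≤ S.card ^ 2 := by
    rw [Fintype.card_subtype, sq, ← Finset.card_product]
    exact Finset.card_le_card fun e he => (Finset.mem_filter.1 he).2.1
  have h1 := prob.forall_of_injective (β := Bool) hφ (fun _ (ω : E → Bool) => ¬ ∀ e, ω e = true)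
  have h2 : prob (fun ω : E → Bool => ¬ ∀ e, ω e = true) = 1 - (1 / 2) ^ Fintype.card E := by
    have := prob.add_not (fun ω : E → Bool => ∀ e, ω e = true)
    rw [prob_forall_true] at this
    linarith
  rw [Finset.prod_const, h2, Finset.card_univ, Fintype.card_coe] at h1
  refine (prob.mono ?_).trans (h1.le.trans ?_)
  · rintro ω hω ⟨v, hv⟩ hall
    refine hω v hv fun s hs t ht hst => ?_
    rcases lt_or_gt_of_ne hst with hlt | hlt
    · exact hall ⟨(s, t), Finset.mem_product.2 ⟨hs, ht⟩, hlt⟩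
    · rw [Sym2.eq_swap]
      exact hall ⟨(t, s), Finset.mem_product.2 ⟨ht, hs⟩, hlt⟩
  · have h3 : (1 / 2 : ℝ) ^ (S.card ^ 2) ≤ (1 / 2) ^ Fintype.card E :=
      pow_le_pow_of_le_one (by norm_num) (by norm_num) hcardE
    have h4 : (1 / 2 : ℝ) ^ Fintype.card E ≤ 1 := pow_le_one₀ (by norm_num) (by norm_num)
    calc (1 - (1 / 2 : ℝ) ^ Fintype.card E) ^ Λ.card
        ≤ Real.exp (-(1 / 2) ^ (S.card ^ 2)) ^ Λ.card := by
          apply pow_le_pow_left₀ (by linarith)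
          have := Real.add_one_le_exp (-(1 / 2 : ℝ) ^ (S.card ^ 2))
          linarith
      _ = _ := by rw [← Real.exp_nat_mul]; congr 1; ring

theorem card_slice_union_le {P C : Finset (I → V)} {ι : Type*} (Λ : Finset ι)
    (S : ι → Finset I) (v : ι → I → V) {B : ℝ}
    (hB : ∀ i ∈ Λ, ((slice id P (S i) (v i)).card : ℝ) ≤ B)
    (hC : ∀ x ∈ C, ∃ i ∈ Λ, x ∈ slice id P (S i) (v i)) : (C.card : ℝ) ≤ Λ.card * B := by
  classical
  have h1 : C ⊆ Λ.biUnion fun i => slice id P (S i) (v i) := fun x hx =>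
    Finset.mem_biUnion.2 (hC x hx)
  calc (C.card : ℝ) ≤ ∑ i ∈ Λ, ((slice id P (S i) (v i)).card : ℝ) := by
        exact_mod_cast (Finset.card_le_card h1).trans Finset.card_biUnion_le
    _ ≤ ∑ i ∈ Λ, B := Finset.sum_le_sum hB
    _ = _ := by simp

/-- In a spread set, it is very unlikely that none of the tuples extending a vertex-free part is
a clique on `S`. -/
theorem prob_no_clique_of_cover_le {P C : Finset (I → V)} {S : Finset I} {M : Finset (I → V)}
    {b z : ℝ} (hP : P.Nonempty) (hb : 0 < b) (hz : 0 < z)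
    (hP2 : ∀ s ∈ S, ∀ t ∈ S, s ≠ t → ∀ v, ((slice id P {s, t} v).card : ℝ) * b ^ 2 ≤ P.card)
    (hcov : ∀ x ∈ C, ∃ v ∈ M, x ∈ slice id P S v) (hC : (P.card : ℝ) ≤ z * C.card) :
    prob (fun ω : Sym2 (I × V) → Bool => ∀ v ∈ M, ¬ IsCliqueOn ω S v) ≤
      Real.exp (-((1 / 2) ^ (S.card ^ 2) * (b ^ 2 / (z * S.card ^ 2)))) := by
  classical
  have hPpos : (0 : ℝ) < P.card := by exact_mod_cast hP.card_pos
  have hCpos : 0 < C.card := by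
    by_contra! h0
    have : C.card = 0 := by omega
    rw [this] at hC
    simp at hC
    exact hP.ne_empty hC
  obtain ⟨x, hx⟩ := Finset.card_pos.1 hCpos
  -- On fewer than two blocks every tuple is a clique.
  rcases Nat.lt_or_ge S.card 2 with hS | hS
  · obtain ⟨v, hv, -⟩ := hcov x hx
    rw [prob.of_false]
    · positivity
    · intro ω h
      exact h v hv fun s hs t ht hst => (hst (Finset.card_le_one.1 (by omega) s hs t ht)).elim
  -- A maximal edge-disjoint family. Every tuple of `M` shares two coordinates with a member, so at
  -- most `|Λ| * |S| ^ 2` slices with two fixed coordinates, each of size at most `|P| / b ^ 2`,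
  -- cover `C`. This forces `Λ` to be large.
  obtain ⟨Λ, hΛ, hmax⟩ := Finset.exists_max_image (M.powerset.filter fun Λ : Finset (I → V) =>
    ∀ v ∈ Λ, ∀ v' ∈ Λ, ∀ s ∈ S, ∀ t ∈ S, s ≠ t → v s = v' s → v t = v' t → v = v') Finset.card
    ⟨∅, by simp⟩
  rw [Finset.mem_filter, Finset.mem_powerset] at hΛ
  have hshare : ∀ v ∈ M, ∃ u ∈ Λ, ∃ s ∈ S, ∃ t ∈ S, s ≠ t ∧ v s = u s ∧ v t = u t := by
    intro v hv
    by_contra! hcon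
    obtain ⟨s, hs, t, ht, hst⟩ := Finset.one_lt_card.1 hS
    have hvΛ : v ∉ Λ := fun h => hcon v h s hs t ht hst rfl rfl
    have := hmax (insert v Λ) (by
      rw [Finset.mem_filter, Finset.mem_powerset]
      refine ⟨Finset.insert_subset hv hΛ.1, ?_⟩
      intro a ha a' ha' s hs t ht hst h1 h2
      rcases Finset.mem_insert.1 ha with rfl | h <;> rcases Finset.mem_insert.1 ha' with rfl | h'
      · rfl
      · exact (hcon a' h' s hs t ht hst h1 h2).elim
      · exact (hcon a h s hs t ht hst h1.symm h2.symm).elim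
      · exact hΛ.2 a h a' h' s hs t ht hst h1 h2)
    rw [Finset.card_insert_of_notMem hvΛ] at this
    omega
  have hcard : (C.card : ℝ) ≤ (Λ ×ˢ S.offDiag).card * (P.card / b ^ 2) := by
    refine card_slice_union_le (P := P) (Λ ×ˢ S.offDiag) (fun i => {i.2.1, i.2.2}) (fun i => i.1)
      ?_ ?_
    · rintro ⟨u, s, t⟩ h
      simp only [Finset.mem_product, Finset.mem_offDiag] at h
      rw [le_div_iff₀ (by positivity)]
      exact hP2 s h.2.1 t h.2.2.1 h.2.2.2 u
    · intro x hx
      obtain ⟨v, hv, hxv⟩ := hcov x hx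
      obtain ⟨u, hu, s, hs, t, ht, hst, h1, h2⟩ := hshare v hv
      refine ⟨(u, s, t), by simp [hu, hs, ht, hst], ?_⟩
      refine slice_subset_slice (by intro j; simp; rintro (rfl | rfl) <;> assumption) ?_ hxv
      intro j hj
      simp only [Finset.mem_insert, Finset.mem_singleton] at hj
      rcases hj with rfl | rfl <;> assumption
  have hoff : ((Λ ×ˢ S.offDiag).card : ℝ) ≤ Λ.card * (S.card : ℝ) ^ 2 := by
    rw [Finset.card_product, Finset.offDiag_card]
    push_cast
    gcongr
    rw [sq]
    exact_mod_cast Nat.sub_le _ _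
  have hSpos : (0 : ℝ) < S.card := by exact_mod_cast (by omega : 0 < S.card)
  have hΛcard : b ^ 2 / (z * S.card ^ 2) ≤ Λ.card := by
    rw [div_le_iff₀ (by positivity)]
    have h1 : (P.card : ℝ) ≤ z * (Λ.card * (S.card : ℝ) ^ 2 * (P.card / b ^ 2)) :=
      hC.trans (mul_le_mul_of_nonneg_left (hcard.trans (by gcongr)) hz.le)
    have h2 : z * (Λ.card * (S.card : ℝ) ^ 2 * (P.card / b ^ 2)) =
      (Λ.card * (z * S.card ^ 2)) / b ^ 2 * P.card := by ring
    rw [h2] at h1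
    have h3 := le_of_mul_le_mul_right ((one_mul (P.card : ℝ)).le.trans h1) hPpos
    rwa [le_div_iff₀ (by positivity), one_mul] at h3
  refine (prob.mono fun ω h v hv => h v (hΛ.1 hv)).trans ((prob_no_clique_le S Λ hΛ.2).trans ?_)
  gcongr

/-- Let `D` be a largest family of at most `r` vertex-disjoint cliques. If it has `r` members, all
of them are bad, which has probability at most `p ^ r`. Otherwise no tuple of `M` avoiding the
vertices of `D` is a clique, although by `hr` these tuples still cover half of `C`. The union bound
runs over fixed families `D`, so no independence between cliques and bad events is needed. -/
theorem prob_all_cliques_bad_le {P C : Finset (I → V)} {S : Finset I} {M : Finset (I → V)}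
    {b z p : ℝ} {r : ℕ} (hP : P.Nonempty) (hSe : S.Nonempty) (hb : 0 < b) (hz : 0 < z) (hp : 0 ≤ p)
    (hP1 : ∀ s ∈ S, ∀ v, ((slice id P {s} v).card : ℝ) * b ≤ P.card)
    (hP2 : ∀ s ∈ S, ∀ t ∈ S, s ≠ t → ∀ v, ((slice id P {s, t} v).card : ℝ) * b ^ 2 ≤ P.card)
    (hcov : ∀ x ∈ C, ∃ v ∈ M, x ∈ slice id P S v) (hC : (P.card : ℝ) ≤ z * C.card)
    (hr : 2 * z * (r * S.card) ≤ b)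
    (bad : (I → V) → (Sym2 (I × V) → Bool) → Prop)
    (hbad : ∀ D ⊆ M, (∀ v ∈ D, ∀ v' ∈ D, ∀ s ∈ S, v s = v' s → v = v') →
      prob (fun ω => ∀ v ∈ D, bad v ω) ≤ p ^ D.card) :
    prob (fun ω : Sym2 (I × V) → Bool => ∀ v ∈ M, IsCliqueOn ω S v → bad v ω) ≤
      (Fintype.card (I → V) + 1) ^ r *
        (Real.exp (-((1 / 2) ^ (S.card ^ 2) * (b ^ 2 / (2 * z * S.card ^ 2)))) + p ^ r) := by
  classical
  have hPpos : (0 : ℝ) < P.card := by exact_mod_cast hP.card_pos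
  set X := Real.exp (-((1 / 2) ^ (S.card ^ 2) * (b ^ 2 / (2 * z * S.card ^ 2)))) with hX
  let Ev : Finset (I → V) → (Sym2 (I × V) → Bool) → Prop := fun D ω =>
    (∀ v ∈ M.filter fun v => ∀ u ∈ D, ∀ s ∈ S, v s ≠ u s, ¬ IsCliqueOn ω S v) ∨
    (D ⊆ M ∧ (∀ v ∈ D, ∀ v' ∈ D, ∀ s ∈ S, v s = v' s → v = v') ∧ D.card = r ∧
      ∀ v ∈ D, bad v ω)
  have hEv : ∀ D ∈ (Finset.univ : Finset (Finset (I → V))).filter (fun D => D.card ≤ r),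
      prob (Ev D) ≤ X + p ^ r := by
    intro D hD
    have hD := (Finset.mem_filter.1 hD).2
    refine (prob.or_le _ _).trans (add_le_add ?_ ?_)
    · set M' := M.filter fun v => ∀ u ∈ D, ∀ s ∈ S, v s ≠ u s
      let C' := C.filter fun x => ∃ v ∈ M', x ∈ slice id P S v
      have h1 : ((C.filter fun x => ¬ ∃ v ∈ M', x ∈ slice id P S v).card : ℝ) ≤
          (D ×ˢ S).card * (P.card / b) := by
        refine card_slice_union_le (P := P) (D ×ˢ S) (fun i => {i.2}) (fun i => i.1) ?_ ?_
        · rintro ⟨u, s⟩ h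
          rw [le_div_iff₀ hb]
          exact hP1 s (Finset.mem_product.1 h).2 u
        · intro x hx
          obtain ⟨hxC, hx'⟩ := Finset.mem_filter.1 hx
          obtain ⟨v, hv, hxv⟩ := hcov x hxC
          have hvM' : v ∉ M' := fun h => hx' ⟨v, h, hxv⟩
          simp only [M', Finset.mem_filter, not_and, not_forall, not_not] at hvM'
          obtain ⟨u, hu, s, hs, hus⟩ := hvM' hv
          refine ⟨(u, s), Finset.mem_product.2 ⟨hu, hs⟩, ?_⟩
          exact slice_subset_slice (by simpa using hs) (by simpa using hus) hxv
      have h2 : (C'.card : ℝ) + (C.filter fun x => ¬ ∃ v ∈ M', x ∈ slice id P S v).card = C.card := by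
        exact_mod_cast Finset.card_filter_add_card_filter_not _
      have h3 : ((D ×ˢ S).card : ℝ) ≤ r * S.card := by
        rw [Finset.card_product]; push_cast
        gcongr
      have h4 : 2 * z * ((D ×ˢ S).card * (P.card / b)) ≤ P.card := by
        have h5 : 2 * z * (D ×ˢ S).card ≤ b := le_trans (by gcongr) hr
        calc 2 * z * ((D ×ˢ S).card * (P.card / b)) = 2 * z * (D ×ˢ S).card * (P.card / b) := by ring
          _ ≤ b * (P.card / b) := by gcongr
          _ = P.card := by field_simp
      refine prob_no_clique_of_cover_le (P := P) (C := C') hP hb (by positivity) hP2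
        (fun x hx => (Finset.mem_filter.1 hx).2) ?_
      have h6 := mul_le_mul_of_nonneg_left h1 (by positivity : 0 ≤ 2 * z)
      nlinarith
    · by_cases h : D ⊆ M ∧ (∀ v ∈ D, ∀ v' ∈ D, ∀ s ∈ S, v s = v' s → v = v') ∧ D.card = r
      · refine (prob.mono fun ω hω => hω.2.2.2).trans ((hbad D h.1 h.2.1).trans ?_)
        rw [h.2.2]
      · rw [prob.of_false fun ω hω => h ⟨hω.1, hω.2.1, hω.2.2.1⟩]
        positivity
  have hcardD : ((((Finset.univ : Finset (Finset (I → V))).filter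
      fun D => D.card ≤ r).card : ℕ) : ℝ) ≤ (Fintype.card (I → V) + 1) ^ r := by
    exact_mod_cast card_finset_card_le r
  refine (prob.mono ?_).trans ((prob.finset_exists_le_card _ Ev hEv).trans
    (mul_le_mul_of_nonneg_right hcardD (by positivity)))
  intro ω hω
  obtain ⟨D, hD, hmax⟩ := Finset.exists_max_image (M.powerset.filter fun D : Finset (I → V) =>
    D.card ≤ r ∧ (∀ v ∈ D, ∀ v' ∈ D, ∀ s ∈ S, v s = v' s → v = v') ∧
      ∀ v ∈ D, IsCliqueOn ω S v) Finset.card ⟨∅, by simp⟩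
  simp only [Finset.mem_filter, Finset.mem_powerset] at hD hmax
  refine ⟨D, by simpa using hD.2.1, ?_⟩
  rcases Nat.lt_or_ge D.card r with hlt | hge
  · left
    intro v hv hcl
    obtain ⟨hvM, hv⟩ := Finset.mem_filter.1 hv
    have hvD : v ∉ D := fun h => by
      obtain ⟨s, hs⟩ := hSe
      exact hv v h s hs rfl
    have := hmax (insert v D) ⟨Finset.insert_subset hvM hD.1,
      by have := Finset.card_insert_le v D; omega, by
      intro a ha a' ha' s hs h1
      rcases Finset.mem_insert.1 ha with rfl | h <;> rcases Finset.mem_insert.1 ha' with rfl | h'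
      · rfl
      · exact (hv a' h' s hs h1).elim
      · exact (hv a h s hs h1.symm).elim
      · exact hD.2.2.1 a h a' h' s hs h1, by
      intro a ha
      rcases Finset.mem_insert.1 ha with rfl | ha
      exacts [hcl, hD.2.2.2 a ha]⟩
    rw [Finset.card_insert_of_notMem hvD] at this
    omega
  · exact Or.inr ⟨hD.1, hD.2.2.1, le_antisymm hD.2.1 hge, fun v hv =>
      hω v (hD.1 hv) (hD.2.2.2 v hv)⟩

end clique

/-! ### Independence of vertex-disjoint stars -/

section star

variable {I V : Type*} [LinearOrder I] [Fintype I] [Fintype V]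

/-- The edges between the vertices `(s, v s)`, `s ∈ S`, and the blocks outside `K`. -/
def starBits (S K : Finset I) (v : I → V) (ω : Sym2 (I × V) → Bool) :
    {j // j ∉ K} → V → {s // s ∈ S} → Bool := fun j u s => ω s((s.1, v s.1), (j.1, u))

/-- A vertex is adjacent to all the vertices of the star. -/
abbrev AllTrue {S : Type*} (y : S → Bool) : Prop := ∀ s, y s = true

/-- A star only uses edges from `S` to blocks outside `K ⊇ S`, so an edge determines its end in `S`.
Stars of vertex-disjoint tuples therefore read disjoint sets of bits and are independent. -/
theorem prob_stars_le {S K : Finset I} (hSK : S ⊆ K) (D : Finset (I → V))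
    (hD : ∀ v ∈ D, ∀ v' ∈ D, ∀ s ∈ S, v s = v' s → v = v')
    (bad : (I → V) → ({j // j ∉ K} → V → {s // s ∈ S} → Bool) → Prop) {p : ℝ}
    (hp : ∀ v ∈ D, prob (bad v) ≤ p) :
    prob (fun ω : Sym2 (I × V) → Bool => ∀ v ∈ D, bad v (starBits S K v ω)) ≤ p ^ D.card := by
  let E := {j // j ∉ K} × V × {s // s ∈ S}
  let φ : D × E → Sym2 (I × V) := fun x =>
    s((x.2.2.2.1, x.1.1 x.2.2.2.1), (x.2.1.1, x.2.2.1))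
  have hφ : Function.Injective φ := by
    rintro ⟨⟨v, hv⟩, ⟨j, hj⟩, u, ⟨s, hs⟩⟩ ⟨⟨v', hv'⟩, ⟨j', hj'⟩, u', ⟨s', hs'⟩⟩ h
    simp only [φ, Sym2.eq_iff, Prod.mk.injEq] at h
    rcases h with ⟨⟨rfl, h1⟩, rfl, rfl⟩ | ⟨⟨rfl, h1⟩, rfl, h2⟩
    · have := hD v hv v' hv' s hs h1
      subst this
      rfl
    · exact absurd (hSK hs) hj'
  have h1 := prob.forall_of_injective (β := Bool) hφ
    (fun d (e : E → Bool) => bad d.1 fun j u s => e (j, u, s))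
  have h2 : ∀ d : D, prob (fun e : E → Bool => bad d.1 fun j u s => e (j, u, s)) =
      prob (bad d.1) := fun d =>
    prob.comp_equiv (⟨fun e j u s => e (j, u, s), fun e x => e x.1 x.2.1 x.2.2,
      fun _ => rfl, fun _ => rfl⟩ : (E → Bool) ≃ ({j // j ∉ K} → V → {s // s ∈ S} → Bool)) _
  calc _ ≤ prob (fun ω : Sym2 (I × V) → Bool =>
        ∀ d : D, bad d.1 fun j u s => ω (φ (d, (j, u, s)))) := prob.mono fun ω h d => h d.1 d.2
    _ = ∏ d : D, prob (bad d.1) := by rw [h1]; exact Finset.prod_congr rfl fun d _ => h2 d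
    _ ≤ ∏ d : D, p := Finset.prod_le_prod (fun d _ => prob.nonneg _) fun d _ => hp d.1 d.2
    _ = _ := by simp

end star

/-! ## States of the adversary -/

section state

variable {I V : Type*} [LinearOrder I] [Fintype I] [Fintype V]

/-- The spreadness parameters of the blocks. -/
noncomputable def spreadParam (a : ℝ) (T : Finset I) (W : I → Finset V) (j : I) : ℝ :=
  if j ∈ T then 1 else (W j).card / (a * 8 ^ T.card)

/-- The invariant of the adversary after `r` steps: the set `P` of tuples fixes the coordinates
in `T`, and it is spread and dense in the product of the large blocks `W j` with `j ∉ T`. -/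
structure IsState (a : ℝ) (r : ℕ) (T : Finset I) (W : I → Finset V) (P : Finset (I → V)) :
    Prop where
  nonempty : P.Nonempty
  mem : ∀ x ∈ P, ∀ j ∉ T, x j ∈ W j
  agree : ∀ x ∈ P, ∀ y ∈ P, ∀ j ∈ T, x j = y j
  size : ∀ j ∉ T, (Fintype.card V : ℝ) / 4 ^ T.card ≤ (W j).card
  spread : IsSpread (spreadParam a T W) T P
  -- The potential function of the argument: a fixed coordinate is credited with a gain of density
  -- of `a / 8`, a query with a loss of 4.
  dense : (a / 8) ^ T.card * ∏ j ∈ Tᶜ, ((W j).card : ℝ) ≤ 4 ^ r * P.card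

theorem card_le_prod_card {T : Finset I} {W : I → Finset V} {P : Finset (I → V)}
    (hmem : ∀ x ∈ P, ∀ j ∉ T, x j ∈ W j) (hagree : ∀ x ∈ P, ∀ y ∈ P, ∀ j ∈ T, x j = y j) :
    P.card ≤ ∏ j ∈ Tᶜ, (W j).card := by
  classical
  rcases P.eq_empty_or_nonempty with rfl | ⟨x, hx⟩
  · simp
  have h1 : P ⊆ Fintype.piFinset fun j => if j ∈ T then {x j} else W j := by
    intro y hy
    rw [Fintype.mem_piFinset]
    intro j
    split_ifs with hj
    · simpa using hagree y hy x hx j hj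
    · exact hmem y hy j hj
  refine (Finset.card_le_card h1).trans (le_of_eq ?_)
  rw [Fintype.card_piFinset, ← Finset.prod_mul_prod_compl T, Finset.prod_eq_one, one_mul]
  · exact Finset.prod_congr rfl fun j hj => by rw [if_neg (Finset.mem_compl.1 hj)]
  · intro j hj; simp [hj]

/-- The density of `P` in the product of the free blocks is at most one. This bounds the number of
coordinates that are ever fixed. -/
theorem IsState.pow_le [Nonempty V] {a : ℝ} {r : ℕ} {T : Finset I} {W : I → Finset V}
    {P : Finset (I → V)} (h : IsState a r T W P) : (a / 8) ^ T.card ≤ 4 ^ r := by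
  have h1 : (P.card : ℝ) ≤ ∏ j ∈ Tᶜ, ((W j).card : ℝ) := by
    exact_mod_cast card_le_prod_card h.mem h.agree
  have h2 : (0 : ℝ) < ∏ j ∈ Tᶜ, ((W j).card : ℝ) :=
    lt_of_lt_of_le (by exact_mod_cast h.nonempty.card_pos) h1
  refine le_of_mul_le_mul_right (h.dense.trans ?_) h2
  gcongr

end state

/-! ### Restriction to common neighbourhoods -/

section star

variable {I V : Type*} [LinearOrder I] [Fintype I] [Fintype V]

theorem slice_subtype (K : Finset I) (R : Finset (I → V)) (S' : Finset {j // j ∉ K})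
    (v : {j // j ∉ K} → V) (v' : I → V) (hv : ∀ j, v' j.1 = v j) :
    slice (fun (x : I → V) (j : {j // j ∉ K}) => x j.1) R S' v =
      slice id R (S'.map (Function.Embedding.subtype _)) v' := by
  ext x
  simp [mem_slice, ← hv]

theorem prod_compl_eq_prod_subtype (K : Finset I) (f : I → ℝ) :
    ∏ j ∈ Kᶜ, f j = ∏ j : {j // j ∉ K}, f j.1 :=
  Finset.prod_subtype Kᶜ (fun j => by simp) f

/-- A vertex survives if all its edges to the star are present, so the survival probability in
`prob_not_restrictGood_le` is `(1 / 2) ^ S.card`. The density of `R` serves as the constant both in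
the spread bound and in the density bound. -/
theorem prob_star_bad_le [Nonempty V] {R : Finset (I → V)} {K S : Finset I} {W : I → Finset V}
    {α θ w : ℝ} (hα : 1 ≤ α) (hθ : 0 < θ) (hθ1 : θ < 1)
    (hκ : ((1 + θ) / (1 - θ)) ^ (2 * Fintype.card I) ≤ 8) (hw : ∀ j ∉ K, w ≤ (W j).card)
    (hpos : ∀ j ∉ K, 0 < (W j).card) (hR : R.Nonempty) {c : I → ℝ}
    (hc : ∀ j ∉ K, c j = (W j).card / α) (hs : IsSpread c K R) :
    prob (fun ω : {j // j ∉ K} → V → ({s // s ∈ S} → Bool) =>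
      ¬ RestrictGood (fun (x : I → V) j => x j.1) AllTrue R (fun j => W j.1) α
        (R.card / ∏ j ∈ Kᶜ, ((W j).card : ℝ)) θ Finset.univ ω) ≤
      Fintype.card I * ((Fintype.card (Finset I × (I → V)) + 3) *
        Real.exp (-(θ ^ 2 * (1 / 2) ^ S.card * w / (32 * α)))) := by
  have hprob : prob (fun y : {s // s ∈ S} → Bool => AllTrue y) = (1 / 2) ^ S.card := by
    rw [prob_forall_true]; simp
  have hRpos : (0 : ℝ) < R.card := by exact_mod_cast hR.card_pos
  have hprodpos : 0 < ∏ j : {j // j ∉ K}, ((W j.1).card : ℝ) :=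
    Finset.prod_pos fun j _ => by exact_mod_cast hpos j.1 j.2
  rw [prod_compl_eq_prod_subtype]
  have hcardJ : Fintype.card {j // j ∉ K} ≤ Fintype.card I := Fintype.card_subtype_le _
  have hκ1 : 1 ≤ (1 + θ) / (1 - θ) := by rw [le_div_iff₀ (by linarith)]; linarith
  obtain ⟨B, hB⟩ : ∃ B, B = (R.card : ℝ) / ∏ j : {j // j ∉ K}, ((W j.1).card : ℝ) := ⟨_, rfl⟩
  have hBpos : 0 < B := hB ▸ div_pos hRpos hprodpos
  have hA : 0 < prob (fun y : {s // s ∈ S} → Bool => AllTrue y) := by rw [hprob]; positivity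
  rw [← hB]
  have key := prob_not_restrictGood_le (π := fun (x : I → V) (j : {j // j ∉ K}) => x j.1)
    (A := fun y : {s // s ∈ S} → Bool => AllTrue y) (R := R) (W := fun j => W j.1) (a := α)
    (B := B) (θ := θ) (w := w) hα hBpos hθ hθ1 hA
    ((pow_le_pow_right₀ hκ1 (by omega)).trans hκ) (fun j => hpos j.1 j.2) (fun j => hw j.1 j.2)
    ?_ ?_ Finset.univ
  · refine key.trans ?_
    rw [hprob, Finset.card_univ]
    have h1 : Fintype.card (Finset {j // j ∉ K} × ({j // j ∉ K} → V)) ≤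
        Fintype.card (Finset I × (I → V)) := by
      simp only [Fintype.card_prod, Fintype.card_finset, Fintype.card_fun]
      exact Nat.mul_le_mul (Nat.pow_le_pow_right (by norm_num) hcardJ)
        (Nat.pow_le_pow_right Fintype.card_pos hcardJ)
    gcongr
  · intro S' v
    let v' : I → V := fun j => if h : j ∉ K then v ⟨j, h⟩ else Classical.arbitrary V
    rw [slice_subtype K R S' v v' (fun j => by simp [v', j.2])]
    have h1 := hs (S'.map (Function.Embedding.subtype _)) v' (by
      rw [Finset.disjoint_left]
      intro j hj
      simp only [Finset.mem_map, Function.Embedding.subtype_apply] at hj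
      obtain ⟨j', -, rfl⟩ := hj
      exact j'.2)
    rw [Finset.prod_map] at h1
    have h2 : ∏ j ∈ S', c (Function.Embedding.subtype _ j) =
        (∏ j ∈ S', ((W j.1).card : ℝ)) / α ^ S'.card := by
      rw [← Finset.prod_const, ← Finset.prod_div_distrib]
      exact Finset.prod_congr rfl fun j _ => hc j.1 j.2
    rw [h2] at h1
    have h3 := Finset.prod_mul_prod_compl S' fun j : {j // j ∉ K} => ((W j.1).card : ℝ)
    rw [hB, ← h3]
    have h4 : 0 < ∏ j ∈ S', ((W j.1).card : ℝ) :=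
      Finset.prod_pos fun j _ => by exact_mod_cast hpos j.1 j.2
    have h5 : 0 < ∏ j ∈ S'ᶜ, ((W j.1).card : ℝ) :=
      Finset.prod_pos fun j _ => by exact_mod_cast hpos j.1 j.2
    generalize ∏ j ∈ S', ((W j.1).card : ℝ) = p1 at h1 h4 ⊢
    generalize ∏ j ∈ S'ᶜ, ((W j.1).card : ℝ) = p2 at h5 ⊢
    have h6 : (R.card : ℝ) / (p1 * p2) * α ^ S'.card * p2 = R.card * α ^ S'.card / p1 := by
      field_simp
    rw [h6, le_div_iff₀ h4]
    rw [← mul_div_assoc, div_le_iff₀ (by positivity)] at h1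
    exact h1
  · rw [hB, div_mul_cancel₀ _ hprodpos.ne']

/-- The restricted blocks, as a function on all indices. -/
noncomputable def nextBlocks (W : I → Finset V) (S K : Finset I) (v : I → V)
    (ω : Sym2 (I × V) → Bool) (j : I) : Finset V :=
  (W j).filter fun u => ∀ s ∈ S, ω s((s, v s), (j, u)) = true

open Classical in
/-- The tuples all of whose coordinates outside `K` lie in the blocks `W`. -/
noncomputable def insideBlocks (W : I → Finset V) (K : Finset I) (R : Finset (I → V)) :
    Finset (I → V) := R.filter fun x => ∀ j ∉ K, x j ∈ W j

theorem mem_insideBlocks {W : I → Finset V} {K : Finset I} {R : Finset (I → V)} {x : I → V} :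
    x ∈ insideBlocks W K R ↔ x ∈ R ∧ ∀ j ∉ K, x j ∈ W j := by
  simp [insideBlocks]

theorem restrictBlocks_starBits {W : I → Finset V} {S K : Finset I} {v : I → V}
    {ω : Sym2 (I × V) → Bool} (j : {j // j ∉ K}) :
    restrictBlocks AllTrue (fun j : {j // j ∉ K} => W j.1) Finset.univ (starBits S K v ω) j =
      nextBlocks W S K v ω j.1 := by
  ext u
  simp [restrictBlocks, nextBlocks, starBits, AllTrue]

theorem restrictSet_starBits {W : I → Finset V} {S K : Finset I} {v : I → V}
    {ω : Sym2 (I × V) → Bool} {R : Finset (I → V)} (hR : ∀ x ∈ R, ∀ j ∉ K, x j ∈ W j) :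
    restrictSet (fun (x : I → V) (j : {j // j ∉ K}) => x j.1) AllTrue R Finset.univ
      (starBits S K v ω) = insideBlocks (nextBlocks W S K v ω) K R := by
  ext x
  rw [mem_insideBlocks]
  simp only [restrictSet, nextBlocks, starBits, AllTrue, Finset.mem_filter,
    Finset.mem_univ, true_implies, Subtype.forall]
  refine and_congr_right fun hx => ?_
  exact ⟨fun h j hj => ⟨hR x hx j hj, h j hj⟩, fun h j hj => (h j hj).2⟩

/-- The next state of the adversary after a good random restriction. -/
theorem RestrictGood.isState [Nonempty V] {R : Finset (I → V)} {T S : Finset I}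
    {W : I → Finset V} {v : I → V} {ω : Sym2 (I × V) → Bool} {a θ : ℝ} {r : ℕ} (ha : 8 ≤ a)
    (hθ : 0 < θ) (hθ1 : θ ≤ 1 / 2) (hκ : ((1 + θ) / (1 - θ)) ^ (2 * Fintype.card I) ≤ 8)
    (hST : Disjoint S T) (hS : S.Nonempty)
    (hmem : ∀ x ∈ R, ∀ j ∉ T ∪ S, x j ∈ W j)
    (hagree : ∀ x ∈ R, ∀ y ∈ R, ∀ j ∈ T ∪ S, x j = y j)
    (hsize : ∀ j ∉ T ∪ S, (Fintype.card V : ℝ) / 4 ^ T.card ≤ (W j).card)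
    (hR : R.Nonempty)
    (hdense : (a / 8) ^ T.card * (a * 8 ^ T.card) ^ S.card *
      ∏ j ∈ (T ∪ S)ᶜ, ((W j).card : ℝ) ≤ 4 ^ r * R.card)
    (h : RestrictGood (fun (x : I → V) (j : {j // j ∉ T ∪ S}) => x j.1) AllTrue R
      (fun j => W j.1) (a * 8 ^ T.card) (R.card / ∏ j ∈ (T ∪ S)ᶜ, ((W j).card : ℝ)) θ
      Finset.univ (starBits S (T ∪ S) v ω)) :
    IsState a r (T ∪ S) (nextBlocks W S (T ∪ S) v ω)
      (insideBlocks (nextBlocks W S (T ∪ S) v ω) (T ∪ S) R) := by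
  set K := T ∪ S with hK
  set W' := nextBlocks W S K v ω with hW'
  set R' := insideBlocks W' K R with hR'
  set α := a * 8 ^ T.card with hα
  have hcardK : K.card = T.card + S.card := Finset.card_union_of_disjoint hST.symm
  have hprob : prob (fun y : {s // s ∈ S} → Bool => AllTrue y) = (1 / 2) ^ S.card := by
    rw [prob_forall_true]; simp
  have hN : (0 : ℝ) < Fintype.card V := by exact_mod_cast Fintype.card_pos
  have hWpos : ∀ j ∉ K, (0 : ℝ) < (W j).card := fun j hj =>
    lt_of_lt_of_le (by positivity) (hsize j hj)
  have hRpos : (0 : ℝ) < R.card := by exact_mod_cast hR.card_pos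
  have hprodW : 0 < ∏ j ∈ Kᶜ, ((W j).card : ℝ) :=
    Finset.prod_pos fun j hj => hWpos j (Finset.mem_compl.1 hj)
  have hκ1 : 1 ≤ (1 + θ) / (1 - θ) := by rw [le_div_iff₀ (by linarith)]; linarith
  set B := R.card / ∏ j ∈ Kᶜ, ((W j).card : ℝ) with hB
  have hBpos : 0 < B := div_pos hRpos hprodW
  have hcardJ : Fintype.card {j // j ∉ K} ≤ Fintype.card I := Fintype.card_subtype_le _
  set κ := ((1 + θ) / (1 - θ)) ^ Fintype.card {j // j ∉ K} with hκdef
  -- Spreadness relative to the size of `R'` loses `κ` twice: in the upper bound for slices and in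
  -- the lower bound for `R'`. The new factor `8 ^ S.card` in the spread parameter pays for this, as
  -- `S` is nonempty.
  have hκsq : κ * κ ≤ 8 := by
    rw [hκdef, ← pow_add]
    exact (pow_le_pow_right₀ hκ1 (by omega)).trans hκ
  have hκge : 1 ≤ κ := one_le_pow₀ hκ1
  have hκ8 : κ ≤ 8 := by nlinarith
  obtain ⟨h1, h2, h3⟩ := h
  rw [hprob] at h1
  simp only [restrictBlocks_starBits, restrictSet_starBits hmem, ← hW', ← hR', Finset.card_univ,
    ← hκdef] at h1 h2 h3
  have hsize' : ∀ j ∉ K, (Fintype.card V : ℝ) / 4 ^ K.card ≤ (W' j).card := by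
    intro j hj
    refine le_trans ?_ (h1 ⟨j, hj⟩ (Finset.mem_univ _))
    -- The expected shrinking is `(1 / 2) ^ S.card`; a second factor of this size covers the
    -- deviation, whence the powers of 4 in the invariant.
    have h4 : (1 / 2 : ℝ) ^ S.card ≤ 1 - θ := by
      calc (1 / 2 : ℝ) ^ S.card ≤ (1 / 2) ^ 1 :=
            pow_le_pow_of_le_one (by norm_num) (by norm_num) hS.card_pos
        _ ≤ 1 - θ := by linarith
    rw [hcardK, pow_add]
    calc (Fintype.card V : ℝ) / (4 ^ T.card * 4 ^ S.card)
        = (1 / 2) ^ S.card * (1 / 2) ^ S.card * (Fintype.card V / 4 ^ T.card) := by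
          rw [← mul_pow, show (1 / 2 * (1 / 2) : ℝ) = 1 / 4 by norm_num, one_div, inv_pow]
          field_simp
      _ ≤ (1 - θ) * (1 / 2) ^ S.card * (W j).card := by
          gcongr
          · exact mul_nonneg (by linarith) (by positivity)
          · exact hsize j hj
  have hW'pos : ∀ j ∉ K, (0 : ℝ) < (W' j).card := fun j hj =>
    lt_of_lt_of_le (by positivity) (hsize' j hj)
  have hprodW' : 0 < ∏ j ∈ Kᶜ, ((W' j).card : ℝ) :=
    Finset.prod_pos fun j hj => hW'pos j (Finset.mem_compl.1 hj)
  rw [← prod_compl_eq_prod_subtype K fun j => ((W' j).card : ℝ)] at h3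
  have hR'pos : (0 : ℝ) < R'.card := by
    have : 0 < κ * (R'.card : ℝ) := lt_of_lt_of_le (mul_pos hBpos hprodW') h3
    exact pos_of_mul_pos_right this (by linarith)
  have hα1 : 0 < α := by positivity
  refine ⟨?_, ?_, ?_, hsize', ?_, ?_⟩
  · rw [← Finset.card_pos]; exact_mod_cast hR'pos
  · intro x hx j hj
    exact (mem_insideBlocks.1 hx).2 j hj
  · intro x hx y hy j hj
    exact hagree x (mem_insideBlocks.1 hx).1 y (mem_insideBlocks.1 hy).1 j hj
  · intro S' u hS'
    rcases S'.eq_empty_or_nonempty with rfl | hne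
    · simp [slice_empty]
    have hmap : (S'.subtype (· ∉ K)).map (Function.Embedding.subtype _) = S' :=
      Finset.subtype_map_of_mem fun j hj => Finset.disjoint_left.1 hS' hj
    have h4 := h2 (S'.subtype (· ∉ K)) (fun j => u j.1)
    rw [slice_subtype K R' _ _ u (fun j => rfl), hmap] at h4
    have hcard : (S'.subtype (· ∉ K)).card = S'.card := by
      conv_rhs => rw [← hmap, Finset.card_map]
    have h5 := Finset.prod_mul_prod_compl (S'.subtype (· ∉ K))
      fun j : {j // j ∉ K} => ((W' j.1).card : ℝ)
    have h6 : ∏ j ∈ S'.subtype (· ∉ K), ((W' j.1).card : ℝ) = ∏ j ∈ S', ((W' j).card : ℝ) := by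
      conv_rhs => rw [← hmap, Finset.prod_map]
      rfl
    rw [← prod_compl_eq_prod_subtype K fun j => ((W' j).card : ℝ), h6] at h5
    have h7 : ∏ j ∈ S', spreadParam a K W' j =
        (∏ j ∈ S', ((W' j).card : ℝ)) / (a * 8 ^ K.card) ^ S'.card := by
      rw [← Finset.prod_const, ← Finset.prod_div_distrib]
      refine Finset.prod_congr rfl fun j hj => ?_
      rw [spreadParam, if_neg (Finset.disjoint_left.1 hS' hj)]
    rw [h7]
    rw [hcard] at h4
    have h8 : 0 < ∏ j ∈ S', ((W' j).card : ℝ) :=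
      Finset.prod_pos fun j hj => hW'pos j (Finset.disjoint_left.1 hS' hj)
    have h9 : a * 8 ^ K.card = α * 8 ^ S.card := by rw [hcardK, pow_add, hα]; ring
    rw [h9, mul_pow, ← pow_mul, mul_div_assoc', div_le_iff₀ (mul_pos (pow_pos hα1 _) (by positivity))]
    have h10 : (8 : ℝ) ≤ 8 ^ (S.card * S'.card) := by
      calc (8 : ℝ) = 8 ^ 1 := by norm_num
        _ ≤ _ := pow_le_pow_right₀ (by norm_num) (Nat.mul_pos hS.card_pos hne.card_pos)
    have h11 := mul_le_mul_of_nonneg_right h4 h8.le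
    have h12 : κ * B * α ^ S'.card * (∏ j ∈ (S'.subtype (· ∉ K))ᶜ, ((W' j.1).card : ℝ)) *
        ∏ j ∈ S', ((W' j).card : ℝ) = κ * α ^ S'.card * (B * ∏ j ∈ Kᶜ, ((W' j).card : ℝ)) := by
      rw [← h5]; ring
    rw [h12] at h11
    refine h11.trans ?_
    calc κ * α ^ S'.card * (B * ∏ j ∈ Kᶜ, ((W' j).card : ℝ))
        ≤ κ * α ^ S'.card * (κ * R'.card) := mul_le_mul_of_nonneg_left h3 (by positivity)
      _ = (κ * κ) * (α ^ S'.card * R'.card) := by ring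
      _ ≤ 8 ^ (S.card * S'.card) * (α ^ S'.card * R'.card) := by
          gcongr; exact hκsq.trans h10
      _ = _ := by ring
  -- The piece has gained at least `a ^ S.card`, and the invariant asks only for `(a / 8) ^ S.card`.
  -- The difference pays for the loss of density in the restriction.
  · have h4 : (a / 8) ^ K.card * 8 ≤ (a / 8) ^ T.card * α ^ S.card := by
      rw [hcardK, pow_add, mul_assoc]
      gcongr
      rw [div_pow]
      have h5 : (8 : ℝ) ≤ 8 ^ S.card := by
        calc (8 : ℝ) = 8 ^ 1 := by norm_num
          _ ≤ _ := pow_le_pow_right₀ (by norm_num) hS.card_pos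
      have h6 : a ^ S.card ≤ α ^ S.card := by
        apply pow_le_pow_left₀ (by linarith)
        rw [hα]
        exact le_mul_of_one_le_right (by linarith) (one_le_pow₀ (by norm_num))
      rw [div_mul_eq_mul_div, div_le_iff₀ (by positivity)]
      exact mul_le_mul h6 h5 (by norm_num) (by positivity)
    have h5 : (a / 8) ^ T.card * α ^ S.card ≤ 4 ^ r * B := by
      rw [hB, ← mul_div_assoc, le_div_iff₀ hprodW]; exact hdense
    have h6 : (a / 8) ^ K.card * 8 ≤ 4 ^ r * B := h4.trans h5
    have h7 := mul_le_mul_of_nonneg_right h6 hprodW'.le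
    have h8 : B * ∏ j ∈ Kᶜ, ((W' j).card : ℝ) ≤ 8 * R'.card := h3.trans (by gcongr)
    have h9 := mul_le_mul_of_nonneg_left h8 (by positivity : (0 : ℝ) ≤ 4 ^ r)
    nlinarith

end star

/-! ### One step of the adversary -/

section step

variable {I V : Type*} [LinearOrder I] [Fintype I] [Fintype V]

/-- The vertices fixed in the tuples of `P` are adjacent to all other vertices of the tuples. -/
def StarAdj (ω : Sym2 (I × V) → Bool) (T : Finset I) (P : Finset (I → V)) : Prop :=
  ∀ x ∈ P, ∀ t ∈ T, ∀ j, j ≠ t → ω s((t, x t), (j, x j)) = true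

/-- Edges at `T` are inherited, edges inside `S` come from the clique, and edges from `S` to the
free blocks from passing to common neighbourhoods. -/
theorem StarAdj.next {ω : Sym2 (I × V) → Bool} {T S : Finset I} {W : I → Finset V}
    {P R : Finset (I → V)} {v : I → V} (h : StarAdj ω T P) (hRP : R ⊆ slice id P S v)
    (hcl : IsCliqueOn ω S v) :
    StarAdj ω (T ∪ S) (insideBlocks (nextBlocks W S (T ∪ S) v ω) (T ∪ S) R) := by
  intro x hx t ht j hj
  obtain ⟨hxR, hx'⟩ := mem_insideBlocks.1 hx
  obtain ⟨hxP, hxS⟩ := mem_slice.1 (hRP hxR)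
  simp only [id] at hxS
  by_cases htT : t ∈ T
  · exact h x hxP t htT j hj
  have htS : t ∈ S := (Finset.mem_union.1 ht).resolve_left htT
  by_cases hjK : j ∈ T ∪ S
  · by_cases hjT : j ∈ T
    · rw [Sym2.eq_swap]; exact h x hxP j hjT t hj.symm
    · have hjS : j ∈ S := (Finset.mem_union.1 hjK).resolve_left hjT
      rw [hxS t htS, hxS j hjS]
      exact hcl t htS j hjS hj.symm
  · have := (Finset.mem_filter.1 (hx' j hjK)).2 t htS
    rwa [hxS t htS]

variable [Nonempty V] {a b : ℝ} {r q : ℕ} {T : Finset I} {W : I → Finset V} {P : Finset (I → V)}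

theorem IsState.spreadParam_pos (h : IsState a r T W P) (ha : 8 ≤ a) (j : I) :
    0 < spreadParam a T W j := by
  rw [spreadParam]
  split_ifs with hj
  · exact one_pos
  · have hN : (0 : ℝ) < Fintype.card V := by exact_mod_cast Fintype.card_pos
    have : (0 : ℝ) < (W j).card := lt_of_lt_of_le (by positivity) (h.size j hj)
    positivity

/-- As at most `q` coordinates are ever fixed, one number `b` bounds the spread parameters of the
free blocks from below throughout the game. -/
theorem IsState.le_spreadParam (h : IsState a r T W P) (ha : 8 ≤ a)
    (hb : b * (4 ^ q * (a * 8 ^ q)) ≤ Fintype.card V) (hT : T.card ≤ q) {j : I} (hj : j ∉ T) :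
    b ≤ spreadParam a T W j := by
  rw [spreadParam, if_neg hj, le_div_iff₀ (by positivity)]
  refine le_trans ?_ (h.size j hj)
  rw [le_div_iff₀ (by positivity)]
  rcases le_or_gt b 0 with hb0 | hb0
  · have : b * (a * 8 ^ T.card) * 4 ^ T.card ≤ 0 := by
      have : 0 ≤ a * 8 ^ T.card * 4 ^ T.card := by positivity
      nlinarith
    exact this.trans (by positivity)
  · refine le_trans ?_ hb
    have h1 : (8 : ℝ) ^ T.card ≤ 8 ^ q := pow_le_pow_right₀ (by norm_num) hT
    have h2 : (4 : ℝ) ^ T.card ≤ 4 ^ q := pow_le_pow_right₀ (by norm_num) hT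
    calc b * (a * 8 ^ T.card) * 4 ^ T.card = b * (4 ^ T.card * (a * 8 ^ T.card)) := by ring
      _ ≤ _ := by gcongr

/-- A large piece of a state is dense. -/
theorem IsState.piece_dense (h : IsState a r T W P) (ha : 8 ≤ a) {Q R : Finset (I → V)}
    {S : Finset I} (hPQ : P.card ≤ 2 * Q.card) (hST : Disjoint S T)
    (hR : (Q.card : ℝ) ≤ 2 * R.card * ∏ j ∈ S, spreadParam a T W j) :
    (a / 8) ^ T.card * (a * 8 ^ T.card) ^ S.card * ∏ j ∈ (T ∪ S)ᶜ, ((W j).card : ℝ) ≤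
      4 ^ (r + 1) * R.card := by
  have hN : (0 : ℝ) < Fintype.card V := by exact_mod_cast Fintype.card_pos
  have hWpos : ∀ j ∉ T, (0 : ℝ) < (W j).card := fun j hj =>
    lt_of_lt_of_le (by positivity) (h.size j hj)
  have h1 : ∏ j ∈ S, spreadParam a T W j =
      (∏ j ∈ S, ((W j).card : ℝ)) / (a * 8 ^ T.card) ^ S.card := by
    rw [← Finset.prod_const, ← Finset.prod_div_distrib]
    refine Finset.prod_congr rfl fun j hj => ?_
    rw [spreadParam, if_neg (Finset.disjoint_left.1 hST hj)]
  have h2 : ∏ j ∈ Tᶜ, ((W j).card : ℝ) =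
      (∏ j ∈ S, ((W j).card : ℝ)) * ∏ j ∈ (T ∪ S)ᶜ, ((W j).card : ℝ) := by
    rw [← Finset.prod_union (by
      rw [Finset.disjoint_left]; intro j hj hj'; simp [hj] at hj')]
    congr 1
    ext j
    simp only [Finset.mem_compl, Finset.mem_union, not_or]
    by_cases hj : j ∈ S
    · simp [hj, Finset.disjoint_left.1 hST hj]
    · simp [hj]
  have h3 : 0 < ∏ j ∈ S, ((W j).card : ℝ) :=
    Finset.prod_pos fun j hj => hWpos j (Finset.disjoint_left.1 hST hj)
  have h4 := h.dense
  rw [h2] at h4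
  rw [h1] at hR
  have h5 : (P.card : ℝ) ≤ 2 * Q.card := by exact_mod_cast hPQ
  generalize ∏ j ∈ S, ((W j).card : ℝ) = p1 at *
  generalize ∏ j ∈ (T ∪ S)ᶜ, ((W j).card : ℝ) = p2 at *
  have hα : 0 < (a * 8 ^ T.card) ^ S.card := by positivity
  generalize (a * 8 ^ T.card) ^ S.card = β at *
  rw [← mul_div_assoc, le_div_iff₀ hα] at hR
  -- The factor 4 per query consists of two halvings: from `P` to `Q`, and in the size guarantee of
  -- the pieces.
  have h6 : (a / 8) ^ T.card * (p1 * p2) ≤ 4 ^ r * (2 * Q.card) := h4.trans (by gcongr)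
  have h7 : (a / 8) ^ T.card * (p1 * p2) * β ≤ 4 ^ r * 2 * (2 * R.card * p1) := by
    calc _ ≤ 4 ^ r * (2 * Q.card) * β := by gcongr
      _ = 4 ^ r * 2 * (Q.card * β) := by ring
      _ ≤ _ := by gcongr
  refine le_of_mul_le_mul_right ?_ h3
  calc _ = (a / 8) ^ T.card * (p1 * p2) * β := by ring
    _ ≤ _ := h7
    _ = _ := by rw [pow_succ]; ring

/-- After each query the adversary finds, very likely, a next state inside the given half `Q` of
the current state. -/
theorem prob_no_next_state_le {Q : Finset (I → V)} {m : ℕ} {θ p : ℝ}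
    (h : IsState a r T W P) (hQP : Q ⊆ P) (hPQ : P.card ≤ 2 * Q.card) (ha : 8 ≤ a)
    (hq : (4 : ℝ) ^ (r + 1) < (a / 8) ^ (q + 1)) (hb0 : 0 < b)
    (hb : b * (4 ^ q * (a * 8 ^ q)) ≤ Fintype.card V) (hθ : 0 < θ) (hθ1 : θ ≤ 1 / 2)
    (hκ : ((1 + θ) / (1 - θ)) ^ (2 * Fintype.card I) ≤ 8)
    (hp : Fintype.card I * ((Fintype.card (Finset I × (I → V)) + 3) *
      Real.exp (-(θ ^ 2 * (1 / 2) ^ q * b / 32))) ≤ p)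
    (hm : 2 * (4 * ((Fintype.card I : ℝ) + 1) ^ q) * (m * q) ≤ b) :
    ∃ f : Finset I → (I → V) → Finset (I → V),
      prob (fun ω : Sym2 (I × V) → Bool => ¬ ∃ S v W',
        insideBlocks W' (T ∪ S) (f S v) ⊆ Q ∧
        IsState a (r + 1) (T ∪ S) W' (insideBlocks W' (T ∪ S) (f S v)) ∧
        (StarAdj ω T P → StarAdj ω (T ∪ S) (insideBlocks W' (T ∪ S) (f S v)))) ≤
      (Fintype.card (I → V) + 1) ^ m *
        (Real.exp (-((1 / 2) ^ (q ^ 2) *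
          (b ^ 2 / (2 * (4 * ((Fintype.card I : ℝ) + 1) ^ q) * q ^ 2)))) + p ^ m) := by
  classical
  have hPpos := h.nonempty.card_pos
  have hQ : Q.Nonempty := by rw [← Finset.card_pos]; omega
  -- The pieces depend only on `Q`, not on the graph. The candidates for the next state thus form a
  -- fixed list, which the later union bound requires.
  obtain ⟨f, hf, C, hC, hCf⟩ := exists_spread_pieces (h.spreadParam_pos ha) T hQ
  refine ⟨f, ?_⟩
  have hp0 : 0 ≤ p := le_trans (by positivity) hp
  have hfQ : ∀ S v, f S v ⊆ Q := fun S v => (hf S v).1.trans slice_subset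
  have hdense : ∀ S v, (f S v).Nonempty →
      (a / 8) ^ T.card * (a * 8 ^ T.card) ^ S.card * ∏ j ∈ (T ∪ S)ᶜ, ((W j).card : ℝ) ≤
      4 ^ (r + 1) * (f S v).card := fun S v hne =>
    h.piece_dense ha hPQ ((hf S v).2.2 hne).1 ((hf S v).2.2 hne).2
  have hmem : ∀ S v, ∀ x ∈ f S v, ∀ j ∉ T ∪ S, x j ∈ W j := fun S v x hx j hj =>
    h.mem x (hQP (hfQ S v hx)) j fun hjT => hj (Finset.mem_union_left _ hjT)
  have hagree : ∀ S v, ∀ x ∈ f S v, ∀ y ∈ f S v, ∀ j ∈ T ∪ S, x j = y j := by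
    intro S v x hx y hy j hj
    rcases Finset.mem_union.1 hj with hj | hj
    · exact h.agree x (hQP (hfQ S v hx)) y (hQP (hfQ S v hy)) j hj
    · have h1 := (mem_slice.1 ((hf S v).1 hx)).2 j hj
      have h2 := (mem_slice.1 ((hf S v).1 hy)).2 j hj
      exact h1.trans h2.symm
  have hN : (0 : ℝ) < Fintype.card V := by exact_mod_cast Fintype.card_pos
  have hWpos : ∀ j ∉ T, 0 < (W j).card := fun j hj => by
    have : (0 : ℝ) < (W j).card := lt_of_lt_of_le (by positivity) (h.size j hj)
    exact_mod_cast this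
  -- A piece that fixes nothing new is a next state with unchanged blocks, whatever the graph is.
  by_cases h0 : ∃ v, (f ∅ v).Nonempty
  · obtain ⟨v, hv⟩ := h0
    rw [prob.of_false]
    · positivity
    intro ω
    rw [not_not]
    have hin : insideBlocks W (T ∪ ∅) (f ∅ v) = f ∅ v := by
      ext x
      rw [mem_insideBlocks]
      exact and_iff_left_of_imp fun hx => hmem ∅ v x hx
    refine ⟨∅, v, W, ?_⟩
    rw [hin, Finset.union_empty]
    refine ⟨hfQ _ _, ⟨hv, ?_, ?_, h.size, ?_, ?_⟩, fun hadj x hx => hadj x (hQP (hfQ _ _ hx))⟩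
    · simpa using hmem ∅ v
    · simpa using hagree ∅ v
    · simpa using (hf ∅ v).2.1
    · simpa using hdense ∅ v hv
  have hSne : ∀ S v, (f S v).Nonempty → S.Nonempty := by
    intro S v hne
    rw [Finset.nonempty_iff_ne_empty]
    rintro rfl
    exact h0 ⟨v, hne⟩
  -- Fixing more than `q` coordinates in total would push the density above one.
  have hcardS : ∀ S v, (f S v).Nonempty → T.card + S.card ≤ q := by
    intro S v hne
    have h1 := hdense S v hne
    have h2 : ((f S v).card : ℝ) ≤ ∏ j ∈ (T ∪ S)ᶜ, ((W j).card : ℝ) := by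
      exact_mod_cast card_le_prod_card (hmem S v) (hagree S v)
    have h3 : (0 : ℝ) < (f S v).card := by exact_mod_cast hne.card_pos
    have h4 : (a / 8) ^ T.card * (a * 8 ^ T.card) ^ S.card ≤ 4 ^ (r + 1) := by
      refine le_of_mul_le_mul_right (h1.trans ?_) (h3.trans_le h2)
      gcongr
    have h5 : (a / 8) ^ (T.card + S.card) ≤ (a / 8) ^ T.card * (a * 8 ^ T.card) ^ S.card := by
      rw [pow_add]
      gcongr
      have : (1 : ℝ) ≤ 8 ^ T.card := one_le_pow₀ (by norm_num)
      nlinarith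
    have h6 := (h5.trans h4).trans_lt hq
    by_contra! hgt
    exact absurd h6 (not_lt.2 (pow_le_pow_right₀ (by linarith : (1 : ℝ) ≤ a / 8) hgt))
  set k := Fintype.card I with hk
  -- the most popular set of coordinates
  obtain ⟨S, hSC⟩ : ∃ S, C.card ≤ (k + 1) ^ q * (C.filter fun x => ∃ v, x ∈ f S v).card := by
    by_contra! hcon
    have h1 : C ⊆ ((Finset.univ : Finset (Finset I)).filter fun S => S.card ≤ q).biUnion
        fun S => C.filter fun x => ∃ v, x ∈ f S v := by
      intro x hx
      obtain ⟨S, v, hxS⟩ := hCf x hx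
      rw [Finset.mem_biUnion]
      refine ⟨S, Finset.mem_filter.2 ⟨Finset.mem_univ _, ?_⟩, Finset.mem_filter.2 ⟨hx, v, hxS⟩⟩
      have := hcardS S v ⟨x, hxS⟩
      omega
    have h2 := (Finset.card_le_card h1).trans Finset.card_biUnion_le
    have h3 := card_finset_card_le (Y := I) q
    rw [← hk] at h3
    have hCpos : 0 < C.card := by have := hQ.card_pos; omega
    set F := (Finset.univ : Finset (Finset I)).filter fun S => S.card ≤ q
    have hFne : F.Nonempty := ⟨∅, by simp [F]⟩
    have h4 : (k + 1) ^ q * C.card < F.card * C.card := by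
      calc (k + 1) ^ q * C.card
          ≤ (k + 1) ^ q * ∑ S ∈ F, (C.filter fun x => ∃ v, x ∈ f S v).card :=
            Nat.mul_le_mul_left _ h2
        _ = ∑ S ∈ F, (k + 1) ^ q * (C.filter fun x => ∃ v, x ∈ f S v).card :=
            Finset.mul_sum _ _ _
        _ < ∑ S ∈ F, C.card := Finset.sum_lt_sum_of_nonempty hFne fun S _ => hcon S
        _ = F.card * C.card := by simp
    have := Nat.lt_of_mul_lt_mul_right h4
    omega
  set CS := C.filter fun x => ∃ v, x ∈ f S v with hCS
  have hCpos : 0 < C.card := by have := hQ.card_pos; omega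
  have hCSpos : 0 < CS.card := by
    by_contra! h0
    have : CS.card = 0 := by omega
    rw [this] at hSC
    omega
  obtain ⟨x0, hx0⟩ := Finset.card_pos.1 hCSpos
  obtain ⟨-, v0, hv0⟩ := Finset.mem_filter.1 hx0
  have hS := hSne S v0 ⟨x0, hv0⟩
  have hTS := hcardS S v0 ⟨x0, hv0⟩
  have hST := ((hf S v0).2.2 ⟨x0, hv0⟩).1
  set M := (Finset.univ : Finset (I → V)).filter fun v => (f S v).Nonempty with hM
  have hbc : ∀ j ∉ T, b ≤ spreadParam a T W j := fun j hj => h.le_spreadParam ha hb (by omega) hj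
  have hθ' : θ < 1 := by linarith
  have hz : (0 : ℝ) < 4 * ((k : ℝ) + 1) ^ q := by positivity
  have hSq : (S.card : ℝ) ≤ q := by exact_mod_cast (by omega : S.card ≤ q)
  have hSpos : (0 : ℝ) < S.card := by exact_mod_cast hS.card_pos
  have hSnT : ∀ s ∈ S, s ∉ T := fun s hs => Finset.disjoint_left.1 hST hs
  let bad : (I → V) → (Sym2 (I × V) → Bool) → Prop := fun v ω =>
    ¬ RestrictGood (fun (x : I → V) (j : {j // j ∉ T ∪ S}) => x j.1) AllTrue (f S v)
      (fun j => W j.1) (a * 8 ^ T.card) ((f S v).card / ∏ j ∈ (T ∪ S)ᶜ, ((W j).card : ℝ)) θ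
      Finset.univ (starBits S (T ∪ S) v ω)
  -- The value of `z`: `Q` is at least half of `P`, the pieces cover at least half of `Q`, and those
  -- with the popular `S` at least a fraction `(k + 1) ^ (-q)` of what is covered.
  have key := prob_all_cliques_bad_le (P := P) (C := CS) (S := S) (M := M) (b := b)
    (z := 4 * ((k : ℝ) + 1) ^ q) (p := p) (r := m) h.nonempty hS hb0 hz hp0
    (by
      intro s hs v
      have := h.spread {s} v (by simpa using hSnT s hs)
      rw [Finset.prod_singleton] at this
      exact le_trans (mul_le_mul_of_nonneg_left (hbc s (hSnT s hs)) (by positivity)) this)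
    (by
      intro s hs t ht hst v
      have := h.spread {s, t} v (by simp [hSnT s hs, hSnT t ht])
      rw [Finset.prod_pair hst] at this
      refine le_trans (mul_le_mul_of_nonneg_left ?_ (by positivity)) this
      rw [sq]
      exact mul_le_mul (hbc s (hSnT s hs)) (hbc t (hSnT t ht)) hb0.le
        (h.spreadParam_pos ha s).le)
    (by
      intro x hx
      obtain ⟨-, v, hv⟩ := Finset.mem_filter.1 hx
      exact ⟨v, Finset.mem_filter.2 ⟨Finset.mem_univ _, x, hv⟩,
        slice_mono hQP ((hf S v).1 hv)⟩)
    (by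
      have h1 : P.card ≤ 4 * ((k + 1) ^ q * CS.card) := by omega
      have h2 : (P.card : ℝ) ≤ 4 * (((k : ℝ) + 1) ^ q * CS.card) := by exact_mod_cast h1
      linarith)
    (le_trans (by gcongr) hm) bad
    (by
      intro D hD hdiff
      refine prob_stars_le (K := T ∪ S) Finset.subset_union_right D hdiff (fun v ω' =>
        ¬ RestrictGood (fun (x : I → V) (j : {j // j ∉ T ∪ S}) => x j.1) AllTrue (f S v)
          (fun j => W j.1) (a * 8 ^ T.card)
          ((f S v).card / ∏ j ∈ (T ∪ S)ᶜ, ((W j).card : ℝ)) θ Finset.univ ω') ?_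
      intro v hv
      have hne := (Finset.mem_filter.1 (hD hv)).2
      have hα : 1 ≤ a * 8 ^ T.card := by
        have : (1 : ℝ) ≤ 8 ^ T.card := one_le_pow₀ (by norm_num)
        nlinarith
      refine (prob_star_bad_le (w := Fintype.card V / 4 ^ T.card) (c := spreadParam a T W) hα hθ
        hθ' hκ (fun j hj => h.size j fun hjT => hj (Finset.mem_union_left _ hjT))
        (fun j hj => hWpos j fun hjT => hj (Finset.mem_union_left _ hjT)) hne
        (fun j hj => by
          rw [spreadParam, if_neg fun hjT => hj (Finset.mem_union_left _ hjT)])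
        (hf S v).2.1).trans (le_trans ?_ hp)
      refine mul_le_mul_of_nonneg_left (mul_le_mul_of_nonneg_left
        (Real.exp_le_exp.2 (neg_le_neg ?_)) (by positivity)) (by positivity)
      have h1 : (1 / 2 : ℝ) ^ q ≤ (1 / 2) ^ S.card :=
        pow_le_pow_of_le_one (by norm_num) (by norm_num) (by omega)
      have h2 : b * (a * 8 ^ T.card) ≤ Fintype.card V / 4 ^ T.card := by
        rw [le_div_iff₀ (by positivity)]
        refine le_trans ?_ hb
        have h1 : (8 : ℝ) ^ T.card ≤ 8 ^ q := pow_le_pow_right₀ (by norm_num) (by omega)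
        have h2 : (4 : ℝ) ^ T.card ≤ 4 ^ q := pow_le_pow_right₀ (by norm_num) (by omega)
        calc b * (a * 8 ^ T.card) * 4 ^ T.card = b * (4 ^ T.card * (a * 8 ^ T.card)) := by ring
          _ ≤ _ := by gcongr
      rw [div_le_div_iff₀ (by positivity) (by positivity)]
      calc θ ^ 2 * (1 / 2) ^ q * b * (32 * (a * 8 ^ T.card))
          = θ ^ 2 * (1 / 2) ^ q * (b * (a * 8 ^ T.card)) * 32 := by ring
        _ ≤ _ := by gcongr)
  refine (prob.mono ?_).trans (key.trans ?_)
  · intro ω hω v hv hcl hgood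
    obtain ⟨-, hne⟩ := Finset.mem_filter.1 hv
    refine hω ⟨S, v, nextBlocks W S (T ∪ S) v ω, ?_, ?_, ?_⟩
    · exact fun x hx => hfQ S v (mem_insideBlocks.1 hx).1
    · exact RestrictGood.isState ha hθ hθ1 hκ hST hS (hmem S v) (hagree S v)
        (fun j hj => h.size j fun hjT => hj (Finset.mem_union_left _ hjT)) hne (hdense S v hne)
        hgood
    · intro hadj
      exact hadj.next ((hf S v).1.trans (slice_mono hQP)) hcl
  · have h1 : (1 / 2 : ℝ) ^ q ^ 2 ≤ (1 / 2) ^ S.card ^ 2 :=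
      pow_le_pow_of_le_one (by norm_num) (by norm_num)
        (Nat.pow_le_pow_left (by omega) 2)
    gcongr

end step

/-! ## Proof trees -/

/-- Binary proof trees whose nodes are labelled with sets of ruled-out elements. -/
inductive PTree (Y : Type*) where
  | leaf (A : Set Y) : PTree Y
  | node (A : Set Y) (l r : PTree Y) : PTree Y

namespace PTree

variable {Y : Type*}

/-- The label of the root. -/
def root : PTree Y → Set Y
  | leaf A => A
  | node A _ _ => A

/-- The number of inner nodes. -/
def inner : PTree Y → ℕ
  | leaf _ => 0
  | node _ l r => l.inner + r.inner + 1

/-- The tree is a proof relative to `P`: the leaves are axioms, the labels of inner nodes belong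
to `F` and follow from the labels of their children. -/
def Valid (ax : Set Y → Prop) (F : Set (Set Y)) (P : Set Y) : PTree Y → Prop
  | leaf A => ax (P ∩ A)
  | node A l r => A ∈ F ∧ P ∩ A ⊆ l.root ∪ r.root ∧ l.Valid ax F P ∧ r.Valid ax F P

variable {ax : Set Y → Prop} {F : Set (Set Y)} {P P' : Set Y}

theorem Valid.mono (hax : ∀ A B, A ⊆ B → ax B → ax A) (h : P' ⊆ P) :
    ∀ {τ : PTree Y}, τ.Valid ax F P → τ.Valid ax F P'
  | leaf _, hτ => hax _ _ (Set.inter_subset_inter_left _ h) hτ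
  | node _ _ _, hτ => ⟨hτ.1, (Set.inter_subset_inter_left _ h).trans hτ.2.1,
      hτ.2.2.1.mono hax h, hτ.2.2.2.mono hax h⟩

theorem Valid.root_mem : ∀ {τ : PTree Y}, τ.Valid ax F P → 0 < τ.inner → τ.root ∈ F
  | leaf _, _, h => absurd h (lt_irrefl 0)
  | node _ _ _, hτ, _ => hτ.1

/-- A large proof tree can be cut at an inner node into two smaller ones. -/
theorem Valid.exists_split (hax : ∀ A B, A ⊆ B → ax B → ax A) (hax0 : ax ∅) {M : ℕ} (hM : 1 ≤ M) :
    ∀ {τ : PTree Y}, τ.Valid ax F P → M < τ.inner → ∃ σ τ' : PTree Y, σ.root ∈ F ∧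
      σ.Valid ax F P ∧ σ.inner ≤ M ∧ M ≤ 2 * σ.inner ∧ τ'.root = τ.root ∧
      τ'.Valid ax F (P \ σ.root) ∧ τ'.inner + σ.inner = τ.inner
  | leaf _, _, h => absurd h (Nat.not_lt_zero _)
  | node A l r, hτ, h => by
    obtain ⟨hA, hsub, hl, hr⟩ := hτ
    have hcut : ∀ B, ax ((P \ B) ∩ B) := fun B => by
      rwa [Set.sdiff_inter_self]
    simp only [inner] at h ⊢
    -- Descend into the larger child until its size is at most `M`. Its parent has more than `M`
    -- inner nodes, so it has at least `M / 2`. It may be replaced by a leaf with the same label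
    -- `B`, since on `P \ B` this leaf rules out nothing.
    rcases le_total r.inner l.inner with hle | hle
    · by_cases hlM : M < l.inner
      · obtain ⟨σ, l', h1, h2, h3, h4, h5, h6, h7⟩ := hl.exists_split hax hax0 hM hlM
        refine ⟨σ, node A l' r, h1, h2, h3, h4, rfl, ⟨hA, ?_, h6, hr.mono hax Set.sdiff_subset⟩, ?_⟩
        · rw [h5]
          exact (Set.inter_subset_inter_left _ Set.sdiff_subset).trans hsub
        · simp only [inner]; omega
      · refine ⟨l, node A (leaf l.root) r, hl.root_mem (by omega), hl, by omega, by omega, rfl,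
          ⟨hA, (Set.inter_subset_inter_left _ Set.sdiff_subset).trans hsub, hcut _,
            hr.mono hax Set.sdiff_subset⟩, ?_⟩
        simp only [inner]; omega
    · by_cases hrM : M < r.inner
      · obtain ⟨σ, r', h1, h2, h3, h4, h5, h6, h7⟩ := hr.exists_split hax hax0 hM hrM
        refine ⟨σ, node A l r', h1, h2, h3, h4, rfl, ⟨hA, ?_, hl.mono hax Set.sdiff_subset, h6⟩, ?_⟩
        · rw [h5]
          exact (Set.inter_subset_inter_left _ Set.sdiff_subset).trans hsub
        · simp only [inner]; omega
      · refine ⟨r, node A l (leaf r.root), hr.root_mem (by omega), hr, by omega, by omega, rfl,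
          ⟨hA, (Set.inter_subset_inter_left _ Set.sdiff_subset).trans hsub,
            hl.mono hax Set.sdiff_subset, hcut _⟩, ?_⟩
        simp only [inner]; omega

end PTree

/-! ## The adversary argument -/

section game

variable {I V : Type*} [LinearOrder I] [Fintype I] [Fintype V]

/-- A set of tuples is an axiom if all its tuples contain a common non-edge. -/
def IsEdgeAxiom (ω : Sym2 (I × V) → Bool) (A : Set (I → V)) : Prop :=
  A = ∅ ∨ ∃ i j u u', i ≠ j ∧ ω s((i, u), (j, u')) = false ∧ ∀ x ∈ A, x i = u ∧ x j = u'

theorem IsEdgeAxiom.mono {ω : Sym2 (I × V) → Bool} (A B : Set (I → V)) (h : A ⊆ B)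
    (hB : IsEdgeAxiom ω B) : IsEdgeAxiom ω A := by
  rcases hB with rfl | ⟨i, j, u, u', hij, hω, hB⟩
  · exact Or.inl (Set.subset_empty_iff.1 h)
  · exact Or.inr ⟨i, j, u, u', hij, hω, fun x hx => hB x (h hx)⟩

variable [Nonempty V] {a b : ℝ} {r q : ℕ} {T : Finset I} {W : I → Finset V} {P : Finset (I → V)}

theorem IsState.card_le (h : IsState a r T W P) (ha : 8 ≤ a)
    (hq : (4 : ℝ) ^ r < (a / 8) ^ (q + 1)) : T.card ≤ q := by
  by_contra! hgt
  exact absurd (h.pow_le.trans_lt hq) (not_lt.2 (pow_le_pow_right₀ (by linarith) hgt))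

/-- By `StarAdj` the non-edge of an axiom that rules out a tuple of `P` avoids the fixed
coordinates, and fixing one free coordinate already leaves at most the fraction `1 / b` of `P`. -/
theorem IsState.card_axiom_le (h : IsState a r T W P) (ha : 8 ≤ a) (hT : T.card ≤ q)
    (hb0 : 0 ≤ b) (hb : b * (4 ^ q * (a * 8 ^ q)) ≤ Fintype.card V) {ω : Sym2 (I × V) → Bool}
    (hadj : StarAdj ω T P) {Q : Finset (I → V)} (hQ : Q ⊆ P) (hax : IsEdgeAxiom ω (Q : Set (I → V))) :
    (Q.card : ℝ) * b ≤ P.card := by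
  rcases hax with h0 | ⟨i, j, u, u', hij, hω, hax⟩
  · rw [Finset.coe_eq_empty] at h0
    simp [h0]
  rcases Q.eq_empty_or_nonempty with rfl | ⟨x, hx⟩
  · simp
  obtain ⟨rfl, rfl⟩ := hax x hx
  have hi : i ∉ T := fun hi => by
    simp [hadj x (hQ hx) i hi j hij.symm] at hω
  have h1 : Q ⊆ slice id P {i} x := fun y hy =>
    mem_slice.2 ⟨hQ hy, by simpa using (hax y hy).1⟩
  have h2 := h.spread {i} x (by simpa using hi)
  rw [Finset.prod_singleton] at h2
  calc (Q.card : ℝ) * b ≤ (slice id P {i} x).card * b := by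
        have h3 : (Q.card : ℝ) ≤ (slice id P {i} x).card := by
          exact_mod_cast Finset.card_le_card h1
        gcongr
    _ ≤ (slice id P {i} x).card * spreadParam a T W i := by
        gcongr
        exact h.le_spreadParam ha hb hT hi
    _ ≤ _ := h2

/-- A tree with at most one inner node has at most two leaves, which rule out at most the fraction
`2 / b < 1` of `P`. -/
theorem IsState.two_le_inner (h : IsState a r T W P) (ha : 8 ≤ a) (hT : T.card ≤ q) (hb2 : 2 < b)
    (hb : b * (4 ^ q * (a * 8 ^ q)) ≤ Fintype.card V) {ω : Sym2 (I × V) → Bool}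
    (hadj : StarAdj ω T P) {F : Set (Set (I → V))} {τ : PTree (I → V)}
    (hτ : τ.Valid (IsEdgeAxiom ω) F P) (hP : (P : Set (I → V)) ⊆ τ.root) : 2 ≤ τ.inner := by
  classical
  have hPpos : (0 : ℝ) < P.card := by exact_mod_cast h.nonempty.card_pos
  have hleaf : ∀ A : Set (I → V), IsEdgeAxiom ω (P ∩ A) →
      ((P.filter (· ∈ A)).card : ℝ) * b ≤ P.card := fun A hA =>
    h.card_axiom_le ha hT (by linarith) hb hadj (Finset.filter_subset _ _) (by
      convert hA
      ext x; simp)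
  by_contra! hlt
  match τ, hτ, hP, hlt with
  | .leaf A, hτ, hP, _ =>
    have h1 := hleaf A hτ
    rw [Finset.filter_true_of_mem (p := (· ∈ A)) fun x hx => hP hx] at h1
    nlinarith
  | .node B (.leaf A₁) (.leaf A₂), hτ, hP, _ =>
    have h1 := hleaf A₁ hτ.2.2.1
    have h2 := hleaf A₂ hτ.2.2.2
    have h3 : P ⊆ P.filter (· ∈ A₁) ∪ P.filter (· ∈ A₂) := by
      intro x hx
      have := hτ.2.1 ⟨hx, hP hx⟩
      simp only [PTree.root, Set.mem_union] at this
      simp only [Finset.mem_union, Finset.mem_filter]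
      tauto
    have h4 : (P.card : ℝ) ≤ (P.filter (· ∈ A₁)).card + (P.filter (· ∈ A₂)).card := by
      exact_mod_cast (Finset.card_le_card h3).trans (Finset.card_union_le _ _)
    nlinarith
  | .node B (.node _ _ _) _, _, _, hlt => simp only [PTree.inner] at hlt; omega
  | .node B (.leaf _) (.node _ _ _), _, _, hlt => simp only [PTree.inner] at hlt; omega

/-- Induction on the number `h` of queries left. For `h = 0` the tree is too small to be a proof. In
a step there are at most `2 f` halves; for each of them either no next state exists, or one of the
fixed candidates `(S, v, W')` is a state to which the induction hypothesis applies. Summing over all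
candidates replaces conditioning on what the game has revealed of the graph. -/
theorem prob_exists_tree_le {H m : ℕ} {θ p f : ℝ} (ha : 8 ≤ a)
    (hq : (4 : ℝ) ^ H < (a / 8) ^ (q + 1)) (hb2 : 2 < b)
    (hb : b * (4 ^ q * (a * 8 ^ q)) ≤ Fintype.card V) (hθ : 0 < θ) (hθ1 : θ ≤ 1 / 2)
    (hκ : ((1 + θ) / (1 - θ)) ^ (2 * Fintype.card I) ≤ 8)
    (hp : Fintype.card I * ((Fintype.card (Finset I × (I → V)) + 3) *
      Real.exp (-(θ ^ 2 * (1 / 2) ^ q * b / 32))) ≤ p)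
    (hm : 2 * (4 * ((Fintype.card I : ℝ) + 1) ^ q) * (m * q) ≤ b)
    (F : Finset (Set (I → V))) (hf1 : 1 ≤ f) (hf : F.card ≤ f) (h : ℕ) :
    ∀ (r : ℕ) (T : Finset I) (W : I → Finset V) (P : Finset (I → V)), r + h ≤ H →
      IsState a r T W P →
      prob (fun ω : Sym2 (I × V) → Bool => StarAdj ω T P ∧ ∃ τ : PTree (I → V),
        τ.Valid (IsEdgeAxiom ω) F P ∧ (P : Set (I → V)) ⊆ τ.root ∧ 3 ^ h * τ.inner ≤ 4 ^ h) ≤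
      (2 * f * (1 + Fintype.card (Finset I × (I → V) × (I → Finset V)))) ^ h *
        ((Fintype.card (I → V) + 1) ^ m *
          (Real.exp (-((1 / 2) ^ (q ^ 2) *
            (b ^ 2 / (2 * (4 * ((Fintype.card I : ℝ) + 1) ^ q) * q ^ 2)))) + p ^ m)) := by
  classical
  set p₁ := ((Fintype.card (I → V) + 1) ^ m *
          (Real.exp (-((1 / 2) ^ (q ^ 2) *
            (b ^ 2 / (2 * (4 * ((Fintype.card I : ℝ) + 1) ^ q) * q ^ 2)))) + p ^ m)) with hp₁
  set X := (Fintype.card (Finset I × (I → V) × (I → Finset V)) : ℝ) with hX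
  have hX0 : 0 ≤ X := by positivity
  have hp0 : 0 ≤ p := le_trans (by positivity) hp
  have hp₁0 : 0 ≤ p₁ := by positivity
  clear_value p₁ X
  have hpow : ∀ r, r ≤ H → (4 : ℝ) ^ r < (a / 8) ^ (q + 1) := fun r hr =>
    (pow_le_pow_right₀ (by norm_num) hr).trans_lt hq
  induction h with
  | zero =>
    intro r T W P hr hs
    rw [prob.of_false]
    · simpa using hp₁0
    · rintro ω ⟨hadj, τ, hτ, hroot, hin⟩
      have := hs.two_le_inner ha (hs.card_le ha (hpow r hr)) hb2 hb hadj hτ hroot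
      omega
  | succ h ih =>
    intro r T W P hr hs
    let half : Set (I → V) → Bool → Finset (I → V) := fun A β =>
      if β then P.filter (· ∈ A) else P.filter (· ∉ A)
    have hhalf : ∀ A β, half A β ⊆ P := by
      intro A β
      simp only [half]
      split_ifs <;> exact Finset.filter_subset _ _
    set Y := 2 * f * (1 + X) with hY
    have hY1 : 1 ≤ Y := by nlinarith
    have hsub : ∀ i ∈ F ×ˢ (Finset.univ : Finset Bool), prob (fun ω : Sym2 (I × V) → Bool =>
        P.card ≤ 2 * (half i.1 i.2).card ∧ StarAdj ω T P ∧ ∃ τ : PTree (I → V),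
          τ.Valid (IsEdgeAxiom ω) F (half i.1 i.2) ∧
          (half i.1 i.2 : Set (I → V)) ⊆ τ.root ∧ 3 ^ h * τ.inner ≤ 4 ^ h) ≤
        (1 + X) * Y ^ h * p₁ := by
      rintro ⟨A, β⟩ -
      simp only
      by_cases hcard : P.card ≤ 2 * (half A β).card
      swap
      · rw [prob.of_false fun ω hω => hcard hω.1]
        positivity
      obtain ⟨g, hg⟩ := prob_no_next_state_le (m := m) (θ := θ) (p := p) hs (hhalf A β) hcard ha
        (hpow (r + 1) (by omega)) (by linarith) hb hθ hθ1 hκ hp hm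
      rw [← hp₁] at hg
      let next : Finset I × (I → V) × (I → Finset V) → Finset (I → V) := fun i =>
        insideBlocks i.2.2 (T ∪ i.1) (g i.1 i.2.1)
      have hnext : ∀ i, prob (fun ω : Sym2 (I × V) → Bool =>
          IsState a (r + 1) (T ∪ i.1) i.2.2 (next i) ∧ StarAdj ω (T ∪ i.1) (next i) ∧
          ∃ τ : PTree (I → V), τ.Valid (IsEdgeAxiom ω) F (next i) ∧
            (next i : Set (I → V)) ⊆ τ.root ∧ 3 ^ h * τ.inner ≤ 4 ^ h) ≤ Y ^ h * p₁ := by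
        intro i
        by_cases hst : IsState a (r + 1) (T ∪ i.1) i.2.2 (next i)
        · exact (prob.mono fun ω hω => hω.2).trans
            (ih (r + 1) (T ∪ i.1) i.2.2 (next i) (by omega) hst)
        · rw [prob.of_false fun ω hω => hst hω.1]
          positivity
      refine (prob.mono ?_).trans ((prob.or_le _ _).trans
        ((add_le_add hg (prob.exists_le_card _ hnext)).trans ?_))
      · rintro ω ⟨-, hadj, τ, hτ, hroot, hin⟩
        by_cases hex : ∃ S v W', insideBlocks W' (T ∪ S) (g S v) ⊆ half A β ∧
          IsState a (r + 1) (T ∪ S) W' (insideBlocks W' (T ∪ S) (g S v)) ∧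
          (StarAdj ω T P → StarAdj ω (T ∪ S) (insideBlocks W' (T ∪ S) (g S v)))
        · right
          obtain ⟨S, v, W', h1, h2, h3⟩ := hex
          exact ⟨(S, v, W'), h2, h3 hadj, τ, hτ.mono IsEdgeAxiom.mono (Finset.coe_subset.2 h1),
            (Finset.coe_subset.2 h1).trans hroot, hin⟩
        · exact Or.inl hex
      · rw [← hX]
        have : 1 ≤ Y ^ h := one_le_pow₀ hY1
        nlinarith [mul_nonneg (sub_nonneg.2 this) hp₁0]
    have hunion := prob.finset_exists_le_card _ _ hsub
    refine (prob.mono ?_).trans (hunion.trans ?_)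
    · rintro ω ⟨hadj, τ, hτ, hroot, hin⟩
      have h2 := hs.two_le_inner ha (hs.card_le ha (hpow r (by omega))) hb2 hb hadj hτ hroot
      -- With this `M` both parts have at most three quarters of the inner nodes, including the
      -- effect of rounding.
      obtain ⟨σ, τ', h3, h4, h5, h6, h7, h8, h9⟩ :=
        hτ.exists_split IsEdgeAxiom.mono (Or.inl rfl) (M := 3 * τ.inner / 4) (by omega) (by omega)
      have hsplit := Finset.card_filter_add_card_filter_not (s := P) (· ∈ σ.root)
      have hbound : ∀ n, 4 * n ≤ 3 * τ.inner → 3 ^ h * n ≤ 4 ^ h := by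
        intro n hn
        have h10 := Nat.mul_le_mul_left (3 ^ h) hn
        rw [pow_succ, pow_succ] at hin
        nlinarith
      -- The larger half is kept. Inside the label the subtree `σ` claims to rule it out, outside
      -- the label the remaining tree `τ'` does.
      rcases le_total (P.filter (· ∉ σ.root)).card (P.filter (· ∈ σ.root)).card with hle | hle
      · refine ⟨(σ.root, true), Finset.mem_product.2 ⟨h3, Finset.mem_univ _⟩, ?_, hadj, σ, ?_, ?_,
          hbound _ (by omega)⟩
        · simp only [half, if_true]; omega
        · exact h4.mono IsEdgeAxiom.mono (Finset.coe_subset.2 (hhalf _ _))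
        · intro x hx
          simp only [half, if_true, Finset.coe_filter] at hx
          exact hx.2
      · refine ⟨(σ.root, false), Finset.mem_product.2 ⟨h3, Finset.mem_univ _⟩, ?_, hadj, τ', ?_, ?_,
          hbound _ (by omega)⟩
        · simp only [half, Bool.false_eq_true, if_false]; omega
        · refine h8.mono IsEdgeAxiom.mono ?_
          intro x hx
          simp only [half, Bool.false_eq_true, if_false, Finset.coe_filter] at hx
          exact hx
        · rw [h7]
          exact (Finset.coe_subset.2 (hhalf _ _)).trans hroot
    · rw [Finset.card_product]
      push_cast
      simp only [Finset.card_univ, Fintype.card_bool, Nat.cast_ofNat]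
      calc (F.card : ℝ) * 2 * ((1 + X) * Y ^ h * p₁) ≤ f * 2 * ((1 + X) * Y ^ h * p₁) := by
            gcongr
        _ = Y ^ (h + 1) * p₁ := by rw [pow_succ, hY]; ring

end game

/-! ### The initial state -/

section initial

variable {I V : Type*} [LinearOrder I] [Fintype I] [Fintype V]

theorem isState_univ [Nonempty V] {a : ℝ} (ha : 8 ≤ a) :
    IsState a 0 (∅ : Finset I) (fun _ => Finset.univ) (Finset.univ : Finset (I → V)) := by
  classical
  have hN : (0 : ℝ) < Fintype.card V := by exact_mod_cast Fintype.card_pos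
  refine ⟨Finset.univ_nonempty, by simp, by simp, by simp, ?_, ?_⟩
  · intro S v _
    have h1 := card_le_prod_card (T := S) (W := fun _ => (Finset.univ : Finset V))
      (P := slice id (Finset.univ : Finset (I → V)) S v) (by simp) (by
        intro x hx y hy j hj
        exact ((mem_slice.1 hx).2 j hj).trans ((mem_slice.1 hy).2 j hj).symm)
    have h2 : ((slice id (Finset.univ : Finset (I → V)) S v).card : ℝ) ≤
        ∏ j ∈ Sᶜ, (Fintype.card V : ℝ) := by exact_mod_cast h1
    calc _ ≤ (∏ j ∈ Sᶜ, (Fintype.card V : ℝ)) * ∏ j ∈ S, (Fintype.card V : ℝ) := by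
          refine mul_le_mul h2 (Finset.prod_le_prod (fun j _ => ?_) fun j _ => ?_)
            (Finset.prod_nonneg fun j _ => ?_) (Finset.prod_nonneg fun j _ => hN.le)
          all_goals
            simp only [spreadParam, Finset.notMem_empty, if_false, Finset.card_univ,
              Finset.card_empty, pow_zero, mul_one]
          · positivity
          · exact div_le_self hN.le (by linarith)
          · positivity
      _ = _ := by
          rw [mul_comm, Finset.prod_mul_prod_compl]
          simp
  · simp

end initial

/-! ## From tree-like refutations to proof trees -/

theorem SemRefutation.le_of_reflTransGen {X : Type} {F : Set (BoolFun X)} {A : CNF X}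
    (π : SemRefutation F A) {i j : Fin π.length} (h : Relation.ReflTransGen π.Uses i j) :
    j ≤ i := by
  induction h with
  | refl => exact le_rfl
  | tail _ hbc ih =>
    obtain ⟨⟨p, p'⟩, hp, h⟩ := hbc
    have := π.derived_line _ _ _ hp
    rcases h with rfl | rfl
    · exact this.2.1.le.trans ih
    · exact this.2.2.1.le.trans ih

/-- In a tree-like refutation the two premises of a line have disjoint derivations. -/
theorem SemRefutation.TreeLike.not_reach_both {X : Type} {F : Set (BoolFun X)} {A : CNF X}
    {π : SemRefutation F A} (hπ : π.TreeLike) {i j k d : Fin π.length} (hj : π.Uses i j)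
    (hk : π.Uses i k) (hjk : j ≠ k) (hjd : Relation.ReflTransGen π.Uses j d)
    (hkd : Relation.ReflTransGen π.Uses k d) : False := by
  have hlt : ∀ {l}, π.Uses i l → l < i := by
    rintro l ⟨⟨p, p'⟩, hp, h⟩
    have := π.derived_line _ _ _ hp
    rcases h with rfl | rfl
    exacts [this.2.1, this.2.2.1]
  have hno : ∀ {j k}, π.Uses i j → π.Uses i k → j ≠ k →
      ¬ Relation.ReflTransGen π.Uses j k := by
    intro j k hj hk hne h
    rcases h.cases_tail with rfl | ⟨y, hjy, hyk⟩
    · exact hne rfl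
    · have := hπ k y i hyk hk
      subst this
      exact absurd (π.le_of_reflTransGen hjy) (not_le.2 (hlt hj))
  -- Each line is used at most once, so the lines depending on `d` form a chain and `j`, `k` are
  -- comparable. But a derivation path reaching one of them from the other would have to pass
  -- through `i`, which comes later than both.
  have hswap := Relation.ReflTransGen.total_of_right_unique (r := Function.swap π.Uses)
    (fun a b c hab hac => hπ a b c hab hac) (Relation.reflTransGen_swap.2 hjd)
    (Relation.reflTransGen_swap.2 hkd)
  rcases hswap with h | h
  · exact hno hk hj hjk.symm (Relation.reflTransGen_swap.1 h)
  · exact hno hj hk hjk (Relation.reflTransGen_swap.1 h)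

/-- Unfolding copies no line: `D` collects the derived lines on which line `i` depends, and the sets
of two distinct premises are disjoint. Hence the inner nodes are counted by the lines. -/
theorem SemRefutation.TreeLike.exists_tree {X : Type} {F : Set (BoolFun X)} {A : CNF X}
    {π : SemRefutation F A} (hπ : π.TreeLike) {Y : Type*} (e : Y → X → Bool)
    {ax : Set Y → Prop} (hax0 : ax ∅) (hA : ∀ C ∈ A, ax {y | ¬ Clause.Sat C (e y)}) :
    ∃ τ : PTree Y, τ.Valid ax ((fun f : BoolFun X => {y | f (e y) = true}) '' F) Set.univ ∧
      τ.root = Set.univ ∧ τ.inner ≤ π.length := by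
  classical
  have key : ∀ i : Fin π.length, ∃ (τ : PTree Y) (D : Finset (Fin π.length)),
      τ.Valid ax ((fun f : BoolFun X => {y | f (e y) = true}) '' F) Set.univ ∧
      τ.root = {y | π.line i (e y) = true} ∧ τ.inner ≤ D.card ∧
      ∀ d ∈ D, Relation.ReflTransGen π.Uses i d := by
    intro i
    induction i using WellFoundedLT.induction with
    | _ i ih =>
    rcases hp : π.premises i with _ | ⟨j, k⟩
    · obtain ⟨C, hC, hline⟩ := π.initial_line i hp
      refine ⟨.leaf {y | π.line i (e y) = true}, ∅, ?_, rfl, le_rfl, by simp⟩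
      have : {y | π.line i (e y) = true} = {y | ¬ Clause.Sat C (e y)} := by
        ext y; exact hline (e y)
      rw [PTree.Valid, Set.univ_inter, this]
      exact hA C hC
    · obtain ⟨hF, hj, hk, himp⟩ := π.derived_line i j k hp
      have huj : π.Uses i j := ⟨_, hp, Or.inl rfl⟩
      have huk : π.Uses i k := ⟨_, hp, Or.inr rfl⟩
      obtain ⟨τj, Dj, hj1, hj2, hj3, hj4⟩ := ih j hj
      have hiD : ∀ {l} {D : Finset (Fin π.length)}, l < i →
          (∀ d ∈ D, Relation.ReflTransGen π.Uses l d) → i ∉ D := fun hl hD hi =>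
        absurd (π.le_of_reflTransGen (hD i hi)) (not_le.2 hl)
      -- Using the same line as both premises is compatible with tree-likeness, so its tree must not
      -- be copied; an empty leaf replaces the second copy.
      by_cases hjk : j = k
      · subst hjk
        refine ⟨.node {y | π.line i (e y) = true} τj (.leaf ∅), insert i Dj,
          ⟨⟨_, hF, rfl⟩, ?_, hj1, ?_⟩, rfl, ?_, ?_⟩
        · rintro y ⟨-, hy⟩
          left
          rw [hj2]
          simpa using himp (e y) hy
        · rwa [PTree.Valid, Set.inter_empty]
        · rw [Finset.card_insert_of_notMem (hiD hj hj4)]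
          simpa [PTree.inner] using hj3
        · intro d hd
          rcases Finset.mem_insert.1 hd with rfl | hd
          · exact .refl
          · exact .head huj (hj4 d hd)
      · obtain ⟨τk, Dk, hk1, hk2, hk3, hk4⟩ := ih k hk
        have hdisj : Disjoint Dj Dk := Finset.disjoint_left.2 fun d hdj hdk =>
          hπ.not_reach_both huj huk hjk (hj4 d hdj) (hk4 d hdk)
        refine ⟨.node {y | π.line i (e y) = true} τj τk, insert i (Dj ∪ Dk),
          ⟨⟨_, hF, rfl⟩, ?_, hj1, hk1⟩, rfl, ?_, ?_⟩
        · rintro y ⟨-, hy⟩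
          rw [hj2, hk2]
          exact himp (e y) hy
        · rw [Finset.card_insert_of_notMem (by
            rw [Finset.mem_union, not_or]; exact ⟨hiD hj hj4, hiD hk hk4⟩),
            Finset.card_union_of_disjoint hdisj]
          simp only [PTree.inner]
          omega
        · intro d hd
          rcases Finset.mem_insert.1 hd with rfl | hd
          · exact .refl
          · rcases Finset.mem_union.1 hd with hd | hd
            · exact .head huj (hj4 d hd)
            · exact .head huk (hk4 d hd)
  obtain ⟨τ, D, h1, h2, h3, -⟩ := key ⟨π.length - 1, Nat.sub_lt π.length_pos Nat.one_pos⟩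
  refine ⟨τ, h1, ?_, h3.trans ?_⟩
  · rw [h2]
    exact Set.eq_univ_of_forall fun y => π.final (e y)
  · simpa using Finset.card_le_univ D

/-! ## Clique formulas of random graphs -/

section encoding

variable {k c m : ℕ}

/-- The block graph whose edges between different blocks are those marked by `ω`. -/
def graphOf (ω : Sym2 (BlockVertex k c m) → Bool) : SimpleGraph (BlockVertex k c m) where
  Adj u v := u.1 ≠ v.1 ∧ ω s(u, v) = true
  symm := ⟨fun u v h => ⟨h.1.symm, by rw [Sym2.eq_swap]; exact h.2⟩⟩
  loopless := ⟨fun u h => h.1 rfl⟩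

theorem isBlockGraph_graphOf (ω : Sym2 (BlockVertex k c m) → Bool) :
    IsBlockGraph (graphOf ω) := fun _ _ h => h.1

theorem mem_vertexClause {v : BlockVertex k c m} {l : CliqueVar k c m × Bool} :
    l ∈ vertexClause v ↔ ∃ j, l = (Sum.inl (v.1, j, v.2 j), false) := by
  simp [vertexClause, eq_comm]

theorem inl_mem_vertexClause {v : BlockVertex k c m} {i : Fin k} {j : Fin c} {a : Fin m} :
    ((Sum.inl (i, j, a), false) : CliqueVar k c m × Bool) ∈ vertexClause v ↔
      i = v.1 ∧ a = v.2 j := by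
  rw [mem_vertexClause]
  constructor
  · rintro ⟨j', h⟩
    simp only [Prod.mk.injEq, Sum.inl.injEq, and_true] at h
    obtain ⟨rfl, rfl, rfl⟩ := h
    exact ⟨rfl, rfl⟩
  · rintro ⟨rfl, rfl⟩
    exact ⟨j, rfl⟩

theorem mem_rangeCNF {i : Fin k} {j : Fin c} {C : Clause (CliqueVar k c m)} :
    C ∈ rangeCNF i j ↔ C = {(Sum.inr (i, j, 0), false)} ∨
      C = {(Sum.inr (i, j, Fin.last m), true)} ∨
      ∃ a : Fin m, C = {(Sum.inr (i, j, a.castSucc), true), (Sum.inl (i, j, a), true),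
        (Sum.inr (i, j, a.succ), false)} := by
  classical
  simp only [rangeCNF, Finset.mem_union, Finset.mem_insert, Finset.mem_singleton,
    Finset.mem_image, Finset.mem_univ, true_and, or_assoc, @eq_comm _ C]

theorem mem_cliqueCNF {G : SimpleGraph (BlockVertex k c m)} {C : Clause (CliqueVar k c m)} :
    C ∈ cliqueCNF G ↔ (∃ u v, u ≠ v ∧ ¬ G.Adj u v ∧ C = vertexClause u ∪ vertexClause v) ∨
      ∃ i j, C ∈ rangeCNF i j := by
  classical
  rw [cliqueCNF, Finset.mem_union, Finset.mem_image, Finset.mem_biUnion]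
  constructor
  · rintro (⟨⟨u, v⟩, h, rfl⟩ | ⟨p, -, h⟩)
    · rw [Finset.mem_filter] at h
      exact Or.inl ⟨u, v, h.2.1, h.2.2, by ext; simp⟩
    · exact Or.inr ⟨p.1, p.2, h⟩
  · rintro (⟨u, v, h1, h2, rfl⟩ | ⟨i, j, h⟩)
    · exact Or.inl ⟨(u, v), by simp [h1, h2], by ext; simp⟩
    · exact Or.inr ⟨(i, j), Finset.mem_univ _, h⟩

/-- Makes the graph readable from its formula. For `c = 0` all vertex clauses would be empty and
this would fail. -/
theorem vertexClause_union_mem_cliqueCNF (hc : 0 < c) {G : SimpleGraph (BlockVertex k c m)}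
    {u v : BlockVertex k c m} (huv : u.1 ≠ v.1) :
    vertexClause u ∪ vertexClause v ∈ cliqueCNF G ↔ ¬ G.Adj u v := by
  classical
  rw [mem_cliqueCNF]
  constructor
  · rintro (⟨u', v', hne, hadj, h⟩ | ⟨i, j, h⟩)
    · have hu : ∀ j, (u.1 = u'.1 ∧ u.2 j = u'.2 j) ∨ (u.1 = v'.1 ∧ u.2 j = v'.2 j) := fun j => by
        have : ((Sum.inl (u.1, j, u.2 j), false) : CliqueVar k c m × Bool) ∈
            vertexClause u ∪ vertexClause v :=
          Finset.mem_union_left _ (inl_mem_vertexClause.2 ⟨rfl, rfl⟩)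
        rw [h, Finset.mem_union] at this
        simpa only [inl_mem_vertexClause] using this
      have hv : ∀ j, (v.1 = u'.1 ∧ v.2 j = u'.2 j) ∨ (v.1 = v'.1 ∧ v.2 j = v'.2 j) := fun j => by
        have : ((Sum.inl (v.1, j, v.2 j), false) : CliqueVar k c m × Bool) ∈
            vertexClause u ∪ vertexClause v :=
          Finset.mem_union_right _ (inl_mem_vertexClause.2 ⟨rfl, rfl⟩)
        rw [h, Finset.mem_union] at this
        simpa only [inl_mem_vertexClause] using this
      by_cases h1 : u.1 = u'.1
      · have h2 : v.1 ≠ u'.1 := fun h2 => huv (h1.trans h2.symm)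
        have h3 : v.1 = v'.1 := ((hv ⟨0, hc⟩).resolve_left fun h => h2 h.1).1
        have h4 : u.1 ≠ v'.1 := fun h4 => huv (h4.trans h3.symm)
        have e1 : u = u' := Prod.ext h1 (funext fun j => ((hu j).resolve_right fun h => h4 h.1).2)
        have e2 : v = v' := Prod.ext h3 (funext fun j => ((hv j).resolve_left fun h => h2 h.1).2)
        rwa [e1, e2]
      · have h2 : u.1 = v'.1 := ((hu ⟨0, hc⟩).resolve_left fun h => h1 h.1).1
        have h3 : v.1 ≠ v'.1 := fun h => huv (h2.trans h.symm)
        have h4 : v.1 = u'.1 := ((hv ⟨0, hc⟩).resolve_right fun h => h3 h.1).1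
        have e1 : u = v' := Prod.ext h2 (funext fun j => ((hu j).resolve_left fun h => h1 h.1).2)
        have e2 : v = u' := Prod.ext h4 (funext fun j => ((hv j).resolve_right fun h => h3 h.1).2)
        rw [e1, e2]
        exact fun h => hadj h.symm
    · exfalso
      have key : ∀ (w : _) (b : Bool), ((Sum.inr w, b) : CliqueVar k c m × Bool) ∉
          vertexClause u ∪ vertexClause v := by
        intro w b hw
        rw [Finset.mem_union, mem_vertexClause, mem_vertexClause] at hw
        rcases hw with ⟨_, hw⟩ | ⟨_, hw⟩ <;> simp at hw
      rw [mem_rangeCNF] at h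
      rcases h with h | h | ⟨a, h⟩ <;> rw [h] at key
      · exact key _ _ (Finset.mem_singleton_self _)
      · exact key _ _ (Finset.mem_singleton_self _)
      · exact key _ _ (Finset.mem_insert_self _ _)
  · intro h
    exact Or.inl ⟨u, v, fun h => huv (congrArg _ h), h, by ext; simp⟩

theorem adj_iff_of_cliqueCNF_eq (hc : 0 < c) {G G' : SimpleGraph (BlockVertex k c m)}
    (h : cliqueCNF G = cliqueCNF G') {u v : BlockVertex k c m} (huv : u.1 ≠ v.1) :
    G.Adj u v ↔ G'.Adj u v := by
  rw [← not_iff_not, ← vertexClause_union_mem_cliqueCNF hc huv, h,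
    vertexClause_union_mem_cliqueCNF hc huv]

theorem CNF.rename_injective {X Y : Type} (e : X ↪ Y) :
    Function.Injective (CNF.rename e) := Finset.map_injective _

theorem CNF.mem_rename {X Y : Type} {e : X ↪ Y} {A : CNF X} {C : Clause Y} :
    C ∈ A.rename e ↔
      ∃ D ∈ A, C = Finset.map (e.prodMap (Function.Embedding.refl Bool)) D := by
  simp [CNF.rename, eq_comm]

theorem Clause.sat_map {X Y : Type} {e : X ↪ Y} {D : Clause X} {α : Y → Bool} :
    Clause.Sat (Finset.map (e.prodMap (Function.Embedding.refl Bool)) D) α ↔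
      Clause.Sat D (fun x => α (e x)) := by
  constructor
  · rintro ⟨l, hl, h⟩
    obtain ⟨l', hl', rfl⟩ := Finset.mem_map.1 hl
    exact ⟨l', hl', h⟩
  · rintro ⟨l, hl, h⟩
    exact ⟨_, Finset.mem_map_of_mem _ hl, h⟩

theorem CNF.sat_rename {X Y : Type} {e : X ↪ Y} {A : CNF X} {α : Y → Bool} :
    (A.rename e).Sat α ↔ A.Sat (fun x => α (e x)) := by
  constructor
  · intro h D hD
    exact Clause.sat_map.1 (h _ (CNF.mem_rename.2 ⟨D, hD, rfl⟩))
  · intro h C hC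
    obtain ⟨D, hD, rfl⟩ := CNF.mem_rename.1 hC
    exact Clause.sat_map.2 (h D hD)

theorem CNF.IsKCNF.rename {X Y : Type} {e : X ↪ Y} {A : CNF X} {ℓ : ℕ} (h : A.IsKCNF ℓ) :
    (A.rename e).IsKCNF ℓ := by
  intro C hC
  obtain ⟨D, hD, rfl⟩ := CNF.mem_rename.1 hC
  refine ⟨by rw [Finset.card_map]; exact (h D hD).1, ?_⟩
  rintro y ⟨h1, h2⟩
  obtain ⟨⟨x, b⟩, hx, hxy⟩ := Finset.mem_map.1 h1
  obtain ⟨⟨x', b'⟩, hx', hxy'⟩ := Finset.mem_map.1 h2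
  simp only [Function.Embedding.coe_prodMap, Prod.map_apply, Function.Embedding.refl_apply,
    Prod.mk.injEq] at hxy hxy'
  obtain ⟨rfl, rfl⟩ := hxy
  obtain ⟨h3, rfl⟩ := hxy'
  rw [e.injective h3] at hx'
  exact (h D hD).2 x ⟨hx, hx'⟩

theorem isKCNF_cliqueCNF {ℓ : ℕ} (hℓ : 3 ≤ ℓ) (hc : 2 * c ≤ ℓ)
    (G : SimpleGraph (BlockVertex k c m)) : (cliqueCNF G).IsKCNF ℓ := by
  classical
  intro C hC
  rcases mem_cliqueCNF.1 hC with ⟨u, v, -, -, rfl⟩ | ⟨i, j, h⟩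
  · constructor
    · have hcard : ∀ w : BlockVertex k c m, (vertexClause w).card ≤ c := fun w => by
        unfold vertexClause
        exact Finset.card_image_le.trans (by simp)
      refine le_trans ?_ hc
      rw [two_mul]
      exact (Finset.card_union_le _ _).trans (Nat.add_le_add (hcard u) (hcard v))
    · rintro x ⟨h, -⟩
      rw [Finset.mem_union, mem_vertexClause, mem_vertexClause] at h
      rcases h with ⟨_, h⟩ | ⟨_, h⟩ <;> simp at h
  · rcases mem_rangeCNF.1 h with rfl | rfl | ⟨a, rfl⟩
    · exact ⟨by simp; omega, by simp⟩
    · exact ⟨by simp; omega, by simp⟩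
    · refine ⟨Finset.card_le_three.trans hℓ, ?_⟩
      rintro x ⟨h1, h2⟩
      simp only [Finset.mem_insert, Finset.mem_singleton, Prod.mk.injEq] at h1 h2
      simp only [Bool.false_eq_true, and_false, and_true, false_or] at h2
      subst h2
      simp [Fin.ext_iff] at h1

/-- The assignment that selects the vertex with coordinates `x i` in the `i`th block. -/
def selection (x : Fin k → Fin c → Fin m) : CliqueVar k c m → Bool
  | Sum.inl (i, j, a) => decide (x i j = a)
  -- The only values of the extension variables compatible with the range clauses.
  | Sum.inr (i, j, a) => decide ((x i j : ℕ) < a)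

theorem not_sat_vertexClause_union {u v : BlockVertex k c m} {x : Fin k → Fin c → Fin m}
    (h : ¬ Clause.Sat (vertexClause u ∪ vertexClause v) (selection x)) :
    x u.1 = u.2 ∧ x v.1 = v.2 := by
  classical
  constructor <;> funext j <;> by_contra hne <;> apply h
  · exact ⟨(Sum.inl (u.1, j, u.2 j), false),
      Finset.mem_union_left _ (mem_vertexClause.2 ⟨j, rfl⟩), by simp [selection, hne]⟩
  · exact ⟨(Sum.inl (v.1, j, v.2 j), false),
      Finset.mem_union_right _ (mem_vertexClause.2 ⟨j, rfl⟩), by simp [selection, hne]⟩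

theorem sat_rangeCNF {i : Fin k} {j : Fin c} {C : Clause (CliqueVar k c m)}
    (h : C ∈ rangeCNF i j) (x : Fin k → Fin c → Fin m) : Clause.Sat C (selection x) := by
  rcases mem_rangeCNF.1 h with rfl | rfl | ⟨a, rfl⟩
  · exact ⟨_, Finset.mem_singleton_self _, by simp [selection]⟩
  · exact ⟨_, Finset.mem_singleton_self _, by simp [selection]⟩
  · rcases lt_trichotomy (x i j) a with h | h | h
    · exact ⟨(Sum.inr (i, j, a.castSucc), true), by simp, by simpa [selection] using h⟩
    · exact ⟨(Sum.inl (i, j, a), true), by simp, by simpa [selection] using h⟩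
    · refine ⟨(Sum.inr (i, j, a.succ), false), by simp, ?_⟩
      simp only [selection, Fin.val_succ, decide_eq_false_iff_not, not_lt]
      exact h

/-- Selections satisfy all range clauses, and no selection contains two vertices of one block. Only
non-edges between different blocks rule out anything. -/
theorem isEdgeAxiom_of_mem_cliqueCNF {ω : Sym2 (BlockVertex k c m) → Bool}
    {C : Clause (CliqueVar k c m)} (hC : C ∈ cliqueCNF (graphOf ω)) :
    IsEdgeAxiom ω {x : Fin k → Fin c → Fin m | ¬ Clause.Sat C (selection x)} := by
  rcases mem_cliqueCNF.1 hC with ⟨u, v, hne, hadj, rfl⟩ | ⟨i, j, h⟩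
  · by_cases huv : u.1 = v.1
    · left
      refine Set.eq_empty_of_forall_notMem fun x hx => hne ?_
      obtain ⟨h1, h2⟩ := not_sat_vertexClause_union hx
      exact Prod.ext huv (by rw [← h1, ← h2, huv])
    · right
      refine ⟨u.1, v.1, u.2, v.2, huv, ?_, fun x hx => not_sat_vertexClause_union hx⟩
      by_contra h
      exact hadj ⟨huv, by simpa using h⟩
  · left
    refine Set.eq_empty_of_forall_notMem fun x hx => hx (sat_rangeCNF h x)

/-- If all `x_{i,j,a}` were false, the range clauses would propagate falsity from `y_{i,j,0}` up to
`y_{i,j,m}`. -/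
theorem exists_clique_of_sat {G : SimpleGraph (BlockVertex k c m)} {α : CliqueVar k c m → Bool}
    (h : (cliqueCNF G).Sat α) :
    ∃ x : Fin k → Fin c → Fin m, ∀ i i', i ≠ i' → G.Adj (i, x i) (i', x i') := by
  classical
  have hr : ∀ i j, ∃ a, α (Sum.inl (i, j, a)) = true := by
    intro i j
    have hC : ∀ C ∈ rangeCNF (m := m) i j, Clause.Sat C α := fun C hC =>
      h C (mem_cliqueCNF.2 (Or.inr ⟨i, j, hC⟩))
    by_contra hno
    push Not at hno
    have hy : ∀ b : Fin (m + 1), α (Sum.inr (i, j, b)) = false := by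
      intro b
      induction b using Fin.induction with
      | zero =>
        obtain ⟨l, hl, hs⟩ := hC _ (mem_rangeCNF.2 (Or.inl rfl))
        rw [Finset.mem_singleton.1 hl] at hs
        exact hs
      | succ a ih =>
        obtain ⟨l, hl, hs⟩ := hC _ (mem_rangeCNF.2 (Or.inr (Or.inr ⟨a, rfl⟩)))
        simp only [Finset.mem_insert, Finset.mem_singleton] at hl
        rcases hl with rfl | rfl | rfl
        · simp [ih] at hs
        · exact absurd hs (hno a)
        · exact hs
    obtain ⟨l, hl, hs⟩ := hC _ (mem_rangeCNF.2 (Or.inr (Or.inl rfl)))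
    rw [Finset.mem_singleton.1 hl] at hs
    simp [hy] at hs
  choose x hx using hr
  refine ⟨x, fun i i' hne => ?_⟩
  by_contra hadj
  obtain ⟨l, hl, hs⟩ := h _ (mem_cliqueCNF.2 (Or.inl ⟨(i, x i), (i', x i'),
    fun h => hne (congrArg Prod.fst h), hadj, rfl⟩))
  rcases Finset.mem_union.1 hl with hl | hl <;> obtain ⟨j, rfl⟩ := mem_vertexClause.1 hl <;>
    simp [hx] at hs

end encoding

theorem uniformProb_range {Ω α : Type} {Ψ : Ω → α} (hΨ : Function.Injective Ψ) (P : α → Prop) :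
    uniformProb (Set.range Ψ) P = prob (fun ω => P (Ψ ω)) := by
  unfold uniformProb prob
  congr 2
  · have : {a ∈ Set.range Ψ | P a} = Ψ '' {ω | P (Ψ ω)} := by
      ext a
      constructor
      · rintro ⟨⟨ω, rfl⟩, h⟩
        exact ⟨ω, h, rfl⟩
      · rintro ⟨ω, h, rfl⟩
        exact ⟨⟨ω, rfl⟩, h⟩
    rw [this, Set.ncard_image_of_injective _ hΨ]
    rfl
  · rw [← Set.image_univ, Set.ncard_image_of_injective _ hΨ, Set.ncard_univ]

/-- The random formula: the clique formula of the random block graph. -/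
noncomputable def randomFormula (c n : ℕ)
    (ω : Sym2 (BlockVertex (cliqueSize c (coordRange c n)) c (coordRange c n)) → Bool) :
    CNF (Fin n) :=
  (cliqueCNF (graphOf ω)).rename (cliqueVarEmb c n)

/-- Distinct block graphs have distinct formulas, so a uniform formula amounts to independent
uniform bits for the pairs in different blocks. The bits of `ω` for other pairs are ignored by
`graphOf` and do not affect probabilities. -/
theorem uniformProb_cliqueFamily {c : ℕ} (hc : 0 < c) (n : ℕ) (P : CNF (Fin n) → Prop) :
    uniformProb (cliqueFamily c n) P = prob (fun ω => P (randomFormula c n ω)) := by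
  classical
  set k := cliqueSize c (coordRange c n) with hk
  set m := coordRange c n with hm
  let cross : Sym2 (BlockVertex k c m) → Prop := fun e => ¬ (e.map Prod.fst).IsDiag
  have hcross : ∀ u v : BlockVertex k c m, cross s(u, v) ↔ u.1 ≠ v.1 := fun u v => by
    simp [cross]
  let ext : ({e // cross e} → Bool) → Sym2 (BlockVertex k c m) → Bool :=
    fun χ e => if h : cross e then χ ⟨e, h⟩ else false
  let Ψ : ({e // cross e} → Bool) → CNF (Fin n) := fun χ => randomFormula c n (ext χ)
  have hinj : Function.Injective Ψ := by
    intro χ χ' h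
    have h1 := CNF.rename_injective _ h
    funext ⟨e, he⟩
    induction e using Sym2.inductionOn with
    | hf u v =>
    have h2 := adj_iff_of_cliqueCNF_eq hc h1 ((hcross u v).1 he)
    have h3 : ∀ χ, (graphOf (ext χ)).Adj u v ↔ χ ⟨s(u, v), he⟩ = true := fun χ => by
      change (u.1 ≠ v.1 ∧ ext χ s(u, v) = true) ↔ _
      simp only [ext, he, dif_pos, (hcross u v).1 he, ne_eq, not_false_eq_true, true_and]
    rw [h3, h3] at h2
    exact Bool.eq_iff_iff.2 h2
  have hadj : ∀ ω : Sym2 (BlockVertex k c m) → Bool,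
      graphOf (ext fun e => ω e) = graphOf ω := by
    intro ω
    ext u v
    change (u.1 ≠ v.1 ∧ ext (fun e => ω e) s(u, v) = true) ↔ (u.1 ≠ v.1 ∧ ω s(u, v) = true)
    refine and_congr_right fun h => ?_
    simp only [ext, (hcross u v).2 h, dif_pos]
  have hrange : cliqueFamily c n = Set.range Ψ := by
    ext A
    constructor
    · rintro ⟨G, hG, rfl⟩
      have : ∃ ω, G = graphOf ω := by
        refine ⟨fun e => decide (e ∈ G.edgeSet), ?_⟩
        ext u v
        change G.Adj u v ↔ (u.1 ≠ v.1 ∧ decide _ = true)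
        simp only [SimpleGraph.mem_edgeSet, decide_eq_true_eq]
        exact ⟨fun h => ⟨hG _ _ h, h⟩, fun h => h.2⟩
      obtain ⟨ω, rfl⟩ := this
      exact ⟨fun e => ω e, by simp only [Ψ, randomFormula]; rw [hadj]⟩
    · rintro ⟨χ, rfl⟩
      exact ⟨_, isBlockGraph_graphOf _, rfl⟩
  rw [hrange, uniformProb_range hinj,
    ← prob.comp_injective (φ := (Subtype.val : {e // cross e} → _)) Subtype.val_injective]
  refine prob.congr fun ω => ?_
  simp only [Ψ, randomFormula]
  rw [hadj]

theorem isKCNF_of_mem_cliqueFamily {ℓ c n : ℕ} (hℓ : 3 ≤ ℓ) (hc : 2 * c ≤ ℓ) {A : CNF (Fin n)}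
    (hA : A ∈ cliqueFamily c n) : A.IsKCNF ℓ := by
  obtain ⟨G, -, rfl⟩ := hA
  exact (isKCNF_cliqueCNF hℓ hc G).rename

/-- First moment: a union bound over the tuples, each of which is a clique with probability `2 ^
(-k.choose 2)`. -/
theorem prob_satisfiable_le {c : ℕ} (n : ℕ) :
    prob (fun ω => ¬ (randomFormula c n ω).Unsat) ≤
      ((coordRange c n ^ c : ℕ) : ℝ) ^ cliqueSize c (coordRange c n) *
        (1 / 2) ^ (cliqueSize c (coordRange c n)).choose 2 := by
  classical
  set k := cliqueSize c (coordRange c n)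
  set m := coordRange c n
  let E := {e : Fin k × Fin k // e.1 < e.2}
  have hE : Fintype.card E = k.choose 2 := by
    rw [Fintype.card_subtype]
    have := Fintype.card_finset_len (α := Fin k) 2
    have h2 : (Finset.univ.filter fun e : Fin k × Fin k => e.1 < e.2).card =
        ∑ i : Fin k, (i : ℕ) := by
      rw [Finset.card_filter, ← Finset.univ_product_univ, Finset.sum_product_right]
      refine Finset.sum_congr rfl fun i _ => ?_
      rw [← Finset.card_filter]
      have : (Finset.univ.filter fun x => x < i) = Finset.Iio i := by ext; simp
      simp [this]
    rw [h2, Fin.sum_univ_eq_sum_range (fun i => i), Finset.sum_range_id, Nat.choose_two_right]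
  have h1 : ∀ x : Fin k → Fin c → Fin m,
      prob (fun ω : Sym2 (BlockVertex k c m) → Bool =>
        ∀ e : E, ω s((e.1.1, x e.1.1), (e.1.2, x e.1.2)) = true) ≤ (1 / 2) ^ k.choose 2 := by
    intro x
    rw [← hE, ← prob_forall_true E]
    refine (prob.comp_injective (φ := fun e : E =>
      (s((e.1.1, x e.1.1), (e.1.2, x e.1.2)) : Sym2 (BlockVertex k c m))) ?_
      (fun ω : E → Bool => ∀ e, ω e = true)).le
    rintro ⟨⟨s, t⟩, hlt⟩ ⟨⟨s', t'⟩, hlt'⟩ h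
    simp only [Sym2.eq_iff, Prod.mk.injEq] at h
    simp only at hlt hlt'
    rcases h with ⟨⟨rfl, -⟩, rfl, -⟩ | ⟨⟨rfl, -⟩, rfl, -⟩
    · rfl
    · exact absurd hlt hlt'.asymm
  have h2 := prob.exists_le_card _ h1
  refine (prob.mono ?_).trans (h2.trans (le_of_eq ?_))
  · intro ω hω
    unfold CNF.Unsat at hω
    push Not at hω
    obtain ⟨α, hα⟩ := hω
    obtain ⟨x, hx⟩ := exists_clique_of_sat (CNF.sat_rename.1 hα)
    exact ⟨x, fun e => (hx e.1.1 e.1.2 e.2.ne).2⟩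
  · simp [k, m]

/-- Short tree-like refutations of the random formula yield small proof trees. -/
theorem prob_exists_refutation_le {c n : ℕ} (F : Set (BoolFun (Fin n))) {B : ℝ} (h : ℕ)
    (hB : ∀ F' : Finset (Set (Fin (cliqueSize c (coordRange c n)) → Fin c → Fin (coordRange c n))),
      F'.card ≤ F.ncard → prob (fun ω => StarAdj ω (∅ : Finset (Fin _)) Finset.univ ∧
        ∃ τ : PTree (Fin (cliqueSize c (coordRange c n)) → Fin c → Fin (coordRange c n)),
          τ.Valid (IsEdgeAxiom ω) F' Set.univ ∧ Set.univ ⊆ τ.root ∧ 3 ^ h * τ.inner ≤ 4 ^ h) ≤ B) :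
    prob (fun ω => ∃ π : SemRefutation F (randomFormula c n ω), π.TreeLike ∧
      3 ^ h * π.length ≤ 4 ^ h) ≤ B := by
  classical
  let e : (Fin (cliqueSize c (coordRange c n)) → Fin c → Fin (coordRange c n)) → Fin n → Bool :=
    fun x => Function.extend (cliqueVarEmb c n) (selection x) (fun _ => false)
  have he : ∀ x, (fun v => e x (cliqueVarEmb c n v)) = selection x := fun x => funext fun v =>
    (cliqueVarEmb c n).injective.extend_apply _ _ _
  have hfin : ((fun f : BoolFun (Fin n) => {y | f (e y) = true}) '' F).Finite := Set.toFinite _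
  refine (prob.mono ?_).trans (hB hfin.toFinset ?_)
  · rintro ω ⟨π, hπ, hlen⟩
    refine ⟨?_, ?_⟩
    · intro x _ t ht
      simp at ht
    · obtain ⟨τ, h1, h2, h3⟩ := hπ.exists_tree e (ax := IsEdgeAxiom ω) (Or.inl rfl) (by
        intro C hC
        obtain ⟨D, hD, rfl⟩ := CNF.mem_rename.1 hC
        have := isEdgeAxiom_of_mem_cliqueCNF hD
        convert this using 4 with x
        rw [Clause.sat_map, he])
      refine ⟨τ, by simpa using h1, by simp [h2], (Nat.mul_le_mul_left _ h3).trans hlen⟩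
  · rw [← Set.ncard_eq_toFinset_card _ hfin]
    exact Set.ncard_image_le (Set.toFinite _)

/-! ## The choice of parameters -/

section numeric

variable {I V : Type*} [LinearOrder I] [Fintype I] [Fintype V]

/-- For `θ = 1 / (4 k)` the quotient is at most `1 + 4 θ ≤ exp (1 / k)`, and `e ^ 2 < 8`. -/
theorem ratio_pow_le_eight {k : ℕ} (hk : 1 ≤ k) :
    ((1 + 1 / (4 * (k : ℝ))) / (1 - 1 / (4 * (k : ℝ)))) ^ (2 * k) ≤ 8 := by
  have hk' : (1 : ℝ) ≤ k := by exact_mod_cast hk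
  have h1 : 1 / (4 * (k : ℝ)) ≤ 1 / 4 := by
    apply one_div_le_one_div_of_le <;> linarith
  have h2 : (1 + 1 / (4 * (k : ℝ))) / (1 - 1 / (4 * (k : ℝ))) ≤ Real.exp (1 / k) := by
    refine le_trans ?_ (Real.add_one_le_exp _)
    rw [div_le_iff₀ (by linarith)]
    have h3 : 1 / (k : ℝ) = 4 * (1 / (4 * (k : ℝ))) := by field_simp
    have h4 : 0 ≤ 1 / (4 * (k : ℝ)) := by positivity
    rw [h3]
    nlinarith
  calc _ ≤ Real.exp (1 / k) ^ (2 * k) :=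
        pow_le_pow_left₀ (div_nonneg (by positivity) (by linarith)) h2 _
    _ = Real.exp 1 ^ 2 := by
        rw [← Real.exp_nat_mul, ← Real.exp_nat_mul]
        congr 1
        push_cast
        field_simp
    _ ≤ 2.7182818286 ^ 2 := pow_le_pow_left₀ (Real.exp_pos _).le Real.exp_one_lt_d9.le _
    _ ≤ 8 := by norm_num

-- All parameters are powers of `y = N ^ (1 / M)`: `a = y`, `b = y ^ (M - 2)`, `m = ⌊y ^ (M - 3)⌋`,
-- `p = exp (-y ^ (M - 3))`, with `D * k` queries. Constants and polynomials in `k` are at most `y`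
-- and cost one in the exponent. A step fails with probability governed by `exp (-y ^ (2 * M - 7))`,
-- which beats the factors `exp (y ^ (2 * M - 15))` from the number of plays and from the families
-- of cliques. There are about `exp (N k)` candidate blocks, so `y ^ M ≤ y ^ (2 * M - 16)` is
-- needed, whence `16 ≤ M`.
set_option maxHeartbeats 2000000 in
theorem prob_exists_tree_le_of_large [Nonempty V] {M D q : ℕ} {y : ℝ} (hM : 16 ≤ M)
    (hq : q = 8 * M * D + 1) (hyM : y ^ M = Fintype.card V) (hI : 1 ≤ Fintype.card I)
    (hV : (Fintype.card V : ℝ) ^ 4 ≤ 2 ^ Fintype.card I)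
    (hV' : (2 : ℝ) ^ Fintype.card I ≤ 2 * (Fintype.card V : ℝ) ^ 4) (h8 : 8 ≤ y)
    (hy1 : 8 ^ (q + 1) * 4 ^ D < y) (hy2 : 32 ^ q ≤ y)
    (hy3 : 1024 * 2 ^ q * ((Fintype.card I : ℝ) + 1) ^ 2 ≤ y)
    (hy4 : 8 * q * ((Fintype.card I : ℝ) + 1) ^ q ≤ y)
    (hy5 : 8 * D * ((Fintype.card I : ℝ) + 1) ^ 3 ≤ y)
    (hy6 : 8 * 2 ^ (q ^ 2) * q ^ 2 * ((Fintype.card I : ℝ) + 1) ^ q ≤ y)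
    (F : Finset (Set (I → V))) (hF : (F.card : ℝ) ≤ Real.exp (y ^ (2 * M - 16))) :
    prob (fun ω => StarAdj ω (∅ : Finset I) Finset.univ ∧ ∃ τ : PTree (I → V),
      τ.Valid (IsEdgeAxiom ω) F (Finset.univ : Finset (I → V)) ∧
      ((Finset.univ : Finset (I → V)) : Set (I → V)) ⊆ τ.root ∧
      3 ^ (D * Fintype.card I) * τ.inner ≤ 4 ^ (D * Fintype.card I)) ≤ 2 / y := by
  have hexp1 : (1 : ℝ) ≤ Real.exp 1 := Real.one_le_exp (by norm_num)
  have hexp2 : (2 : ℝ) ≤ Real.exp 1 := by have := Real.add_one_le_exp (1 : ℝ); linarith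
  set k := Fintype.card I with hk
  obtain ⟨N, hN⟩ : ∃ N : ℝ, N = (Fintype.card V : ℝ) := ⟨_, rfl⟩
  rw [← hN] at hyM hV hV'
  have hk1 : (1 : ℝ) ≤ k := by exact_mod_cast hI
  have hq1 : 1 ≤ q := by omega
  have hq1' : (1 : ℝ) ≤ q := by exact_mod_cast hq1
  have hy0 : 1 ≤ y := by linarith
  have hypos : 0 < y := by linarith
  have hmono : ∀ {i j : ℕ}, i ≤ j → y ^ i ≤ y ^ j := fun h => pow_le_pow_right₀ hy0 h
  have hstep : ∀ {C : ℝ} {i j : ℕ}, C ≤ y → i + 1 = j → C * y ^ i ≤ y ^ j := by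
    rintro C i j hC rfl
    rw [pow_succ']
    exact mul_le_mul_of_nonneg_right hC (by positivity)
  have hN1 : 1 ≤ N := by rw [← hyM]; exact one_le_pow₀ hy0
  have hNk : N ≤ Real.exp k := by
    calc N ≤ N ^ 4 := le_self_pow₀ hN1 (by norm_num)
      _ ≤ 2 ^ k := hV
      _ ≤ Real.exp 1 ^ k := pow_le_pow_left₀ (by norm_num) hexp2 _
      _ = Real.exp k := by rw [← Real.exp_nat_mul, mul_one]
  have h2k : (2 : ℝ) ^ k ≤ Real.exp k := by
    calc (2 : ℝ) ^ k ≤ Real.exp 1 ^ k := pow_le_pow_left₀ (by norm_num) hexp2 _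
      _ = Real.exp k := by rw [← Real.exp_nat_mul, mul_one]
  have hNkk : N ^ k ≤ Real.exp (k ^ 2) := by
    calc N ^ k ≤ Real.exp k ^ k := pow_le_pow_left₀ (by linarith) hNk _
      _ = _ := by rw [← Real.exp_nat_mul, sq]
  have hk2y : 2 * ((k : ℝ) + 1) ^ 2 ≤ y := by
    refine le_trans ?_ hy3
    have : (1 : ℝ) ≤ 2 ^ q := one_le_pow₀ (by norm_num)
    exact mul_le_mul_of_nonneg_right (by linarith) (by positivity)
  have hcT : (Fintype.card (I → V) : ℝ) = N ^ k := by simp [hN, hk]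
  have hcS : (Fintype.card (Finset I × (I → V)) : ℝ) = 2 ^ k * N ^ k := by simp [hN, hk]
  have hcU : (Fintype.card (Finset I × (I → V) × (I → Finset V)) : ℝ) ≤
      Real.exp (k + k ^ 2 + N * k) := by
    have h1 : (Fintype.card (Finset I × (I → V) × (I → Finset V)) : ℝ) =
        2 ^ k * (N ^ k * (2 ^ Fintype.card V) ^ k) := by simp [hN, hk]
    have h2 : ((2 : ℝ) ^ Fintype.card V) ^ k ≤ Real.exp (N * k) := by
      calc ((2 : ℝ) ^ Fintype.card V) ^ k ≤ (Real.exp 1 ^ Fintype.card V) ^ k :=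
            pow_le_pow_left₀ (by positivity)
              (pow_le_pow_left₀ (by norm_num) hexp2 _) _
        _ = _ := by
            rw [← Real.exp_nat_mul, ← Real.exp_nat_mul, hN]
            congr 1
            ring
    rw [h1, add_assoc, Real.exp_add, Real.exp_add]
    exact mul_le_mul h2k (mul_le_mul hNkk h2 (by positivity) (Real.exp_pos _).le) (by positivity)
      (Real.exp_pos _).le
  set m := ⌊y ^ (M - 3)⌋₊ with hm
  have hm1 : (m : ℝ) ≤ y ^ (M - 3) := Nat.floor_le (by positivity)
  have hm2 : y ^ (M - 3) / 2 ≤ m := by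
    have h1 := Nat.lt_floor_add_one (y ^ (M - 3))
    have h2 : (8 : ℝ) ≤ y ^ (M - 3) := h8.trans (le_self_pow₀ hy0 (by omega))
    rw [← hm] at h1
    linarith
  set p := Real.exp (-y ^ (M - 3)) with hp
  set f := Real.exp (y ^ (2 * M - 16)) with hf
  have hf1 : 1 ≤ f := Real.one_le_exp (by positivity)
  clear_value m p f
  -- The total loss `4 ^ (D * k) = (2 ^ k) ^ (2 * D)` is at most `4 ^ D * y ^ (8 * M * D)`; this
  -- determines `q`.
  have A1 : (4 : ℝ) ^ (D * k) < (y / 8) ^ (q + 1) := by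
    have h1 : (4 : ℝ) ^ (D * k) ≤ 4 ^ D * y ^ (8 * M * D) := by
      calc (4 : ℝ) ^ (D * k) = (2 ^ k) ^ (2 * D) := by
            rw [← pow_mul, show (4 : ℝ) = 2 ^ 2 by norm_num, ← pow_mul]
            congr 1; ring
        _ ≤ (2 * N ^ 4) ^ (2 * D) := pow_le_pow_left₀ (by positivity) hV' _
        _ = _ := by
            rw [mul_pow, pow_mul 2 2 D, show 8 * M * D = M * (4 * (2 * D)) by ring, pow_mul y,
              pow_mul _ 4, hyM]
            norm_num
    refine h1.trans_lt ?_
    rw [div_pow, lt_div_iff₀ (by positivity), show q + 1 = 8 * M * D + 2 by omega, pow_add y]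
    rw [show q + 1 = 8 * M * D + 2 by omega] at hy1
    have h2 : 8 ^ (8 * M * D + 2) * 4 ^ D < y ^ 2 := hy1.trans_le (le_self_pow₀ hy0 (by norm_num))
    calc 4 ^ D * y ^ (8 * M * D) * 8 ^ (8 * M * D + 2)
        = y ^ (8 * M * D) * (8 ^ (8 * M * D + 2) * 4 ^ D) := by ring
      _ < _ := mul_lt_mul_of_pos_left h2 (by positivity)
  have A2 : 2 < y ^ (M - 2) := by
    have : (8 : ℝ) ≤ y ^ (M - 2) := h8.trans (le_self_pow₀ hy0 (by omega))
    linarith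
  have A3 : y ^ (M - 2) * (4 ^ q * (y * 8 ^ q)) ≤ Fintype.card V := by
    rw [← hN, ← hyM]
    calc y ^ (M - 2) * (4 ^ q * (y * 8 ^ q)) = 32 ^ q * y ^ (M - 1) := by
          rw [show M - 1 = M - 2 + 1 by omega, pow_succ, show (32 : ℝ) = 4 * 8 by norm_num,
            mul_pow]
          ring
      _ ≤ _ := hstep hy2 (by omega)
  have A4 : k * ((Fintype.card (Finset I × (I → V)) + 3) *
      Real.exp (-((1 / (4 * (k : ℝ))) ^ 2 * (1 / 2) ^ q * y ^ (M - 2) / 32))) ≤ p := by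
    have h1 : 2 * y ^ (M - 3) ≤ (1 / (4 * (k : ℝ))) ^ 2 * (1 / 2) ^ q * y ^ (M - 2) / 32 := by
      have h2 : (1024 * 2 ^ q * (k : ℝ) ^ 2) * y ^ (M - 3) ≤ y ^ (M - 2) := by
        refine hstep (le_trans ?_ hy3) (by omega)
        refine mul_le_mul_of_nonneg_left (pow_le_pow_left₀ (by linarith) (by linarith) _)
          (by positivity)
      have h3 : (1 / (4 * (k : ℝ))) ^ 2 * (1 / 2) ^ q * y ^ (M - 2) / 32 =
          y ^ (M - 2) / (512 * 2 ^ q * (k : ℝ) ^ 2) := by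
        rw [div_pow, div_pow, mul_pow]
        field_simp
        norm_num
      rw [h3, le_div_iff₀ (by positivity)]
      linarith
    have h4 : (k : ℝ) * (2 ^ k * N ^ k + 3) ≤ Real.exp (y ^ (M - 3)) := by
      have h5 : (2 : ℝ) ^ k * N ^ k + 3 ≤ Real.exp (k + k ^ 2 + 2) := by
        have h6 : (2 : ℝ) ^ k * N ^ k ≤ Real.exp (k + k ^ 2) := by
          rw [Real.exp_add]
          exact mul_le_mul h2k hNkk (by positivity) (Real.exp_pos _).le
        have h7 : (1 : ℝ) ≤ Real.exp (k + k ^ 2) := Real.one_le_exp (by positivity)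
        have h8 : (4 : ℝ) ≤ Real.exp 2 := by
          rw [show (2 : ℝ) = 1 + 1 by norm_num, Real.exp_add]
          linarith [mul_le_mul hexp2 hexp2 (by norm_num) (Real.exp_pos 1).le]
        rw [Real.exp_add]
        linarith [mul_le_mul_of_nonneg_left h8 (Real.exp_pos (k + (k : ℝ) ^ 2)).le]
      have h6 : (k : ℝ) ≤ Real.exp k := by linarith [Real.add_one_le_exp (k : ℝ)]
      calc (k : ℝ) * (2 ^ k * N ^ k + 3) ≤ Real.exp k * Real.exp (k + k ^ 2 + 2) :=
            mul_le_mul h6 h5 (by positivity) (Real.exp_pos _).le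
        _ = Real.exp (k + (k + k ^ 2 + 2)) := (Real.exp_add _ _).symm
        _ ≤ Real.exp (y ^ (M - 3)) := by
            apply Real.exp_le_exp.2
            refine le_trans ?_ (le_self_pow₀ hy0 (by omega))
            refine le_trans ?_ hk2y
            linarith [sq_nonneg (k : ℝ), (by ring : 2 * ((k : ℝ) + 1) ^ 2 = 2 * k ^ 2 + 4 * k + 2)]
    rw [hcS, ← mul_assoc]
    calc k * (2 ^ k * N ^ k + 3) *
          Real.exp (-((1 / (4 * (k : ℝ))) ^ 2 * (1 / 2) ^ q * y ^ (M - 2) / 32)) ≤ Real.exp (y ^ (M - 3)) * Real.exp (-(2 * y ^ (M - 3))) :=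
          mul_le_mul h4 (Real.exp_le_exp.2 (neg_le_neg h1)) (Real.exp_pos _).le
            (Real.exp_pos _).le
      _ = p := by rw [← Real.exp_add, hp]; congr 1; ring
  have A5 : 2 * (4 * ((k : ℝ) + 1) ^ q) * (m * q) ≤ y ^ (M - 2) := by
    calc 2 * (4 * ((k : ℝ) + 1) ^ q) * (m * q) = (8 * q * ((k : ℝ) + 1) ^ q) * m := by ring
      _ ≤ (8 * q * ((k : ℝ) + 1) ^ q) * y ^ (M - 3) :=
          mul_le_mul_of_nonneg_left hm1 (by positivity)
      _ ≤ _ := hstep hy4 (by omega)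
  have hθ1 : 1 / (4 * (k : ℝ)) ≤ 1 / 2 := one_div_le_one_div_of_le (by norm_num) (by linarith)
  have hθ0 : 0 < 1 / (4 * (k : ℝ)) := by positivity
  have main := prob_exists_tree_le (I := I) (V := V) (a := y) (q := q) (b := y ^ (M - 2))
    (H := D * k) (m := m) (θ := 1 / (4 * (k : ℝ))) (p := p) (f := f) h8 A1 A2 A3 hθ0 hθ1
    (ratio_pow_le_eight hI) A4 A5 F hf1 hF (D * k) 0 ∅ (fun _ => Finset.univ) Finset.univ
    (by omega) (isState_univ h8)
  refine main.trans ?_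
  have B1 : (2 * f * (1 + Fintype.card (Finset I × (I → V) × (I → Finset V)))) ^ (D * k) ≤
      Real.exp (y ^ (2 * M - 15)) := by
    have h1 : 2 * f * (1 + Fintype.card (Finset I × (I → V) × (I → Finset V))) ≤
        Real.exp (1 + y ^ (2 * M - 16) + (1 + (k + k ^ 2 + N * k))) := by
      have h2 : (1 : ℝ) + Fintype.card (Finset I × (I → V) × (I → Finset V)) ≤
          Real.exp (1 + (k + k ^ 2 + N * k)) := by
        have h3 : 1 ≤ Real.exp (k + k ^ 2 + N * k) := Real.one_le_exp (by positivity)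
        rw [Real.exp_add 1]
        linarith [mul_le_mul_of_nonneg_right hexp2 (Real.exp_pos (k + (k : ℝ) ^ 2 + N * k)).le]
      rw [Real.exp_add, Real.exp_add, ← hf]
      exact mul_le_mul (mul_le_mul_of_nonneg_right hexp2 (by linarith)) h2 (by positivity)
        (mul_nonneg (Real.exp_pos 1).le (by linarith))
    refine (pow_le_pow_left₀ (mul_nonneg (by linarith) (by positivity)) h1 _).trans ?_
    rw [← Real.exp_nat_mul]
    apply Real.exp_le_exp.2
    have h4 : N ≤ y ^ (2 * M - 16) := by rw [← hyM]; exact hmono (by omega)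
    have h5 : (1 : ℝ) ≤ y ^ (2 * M - 16) := one_le_pow₀ hy0
    have h6 : 1 + y ^ (2 * M - 16) + (1 + (k + (k : ℝ) ^ 2 + N * k)) ≤
        (3 + 2 * k + k ^ 2) * y ^ (2 * M - 16) := by
      have h7 := mul_le_mul_of_nonneg_right h4 (by linarith : (0 : ℝ) ≤ k)
      have h8 := mul_le_mul_of_nonneg_left h5 (by positivity : (0 : ℝ) ≤ 2 + k + (k : ℝ) ^ 2)
      linarith
    calc ((D * k : ℕ) : ℝ) * (1 + y ^ (2 * M - 16) + (1 + (k + (k : ℝ) ^ 2 + N * k)))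
        ≤ ((D * k : ℕ) : ℝ) * ((3 + 2 * k + k ^ 2) * y ^ (2 * M - 16)) :=
          mul_le_mul_of_nonneg_left h6 (by positivity)
      _ = (D * (k * (3 + 2 * k + k ^ 2))) * y ^ (2 * M - 16) := by push_cast; ring
      _ ≤ (8 * D * ((k : ℝ) + 1) ^ 3) * y ^ (2 * M - 16) := by
          refine mul_le_mul_of_nonneg_right ?_ (by positivity)
          rw [mul_comm 8 (D : ℝ), mul_assoc]
          refine mul_le_mul_of_nonneg_left ?_ (by positivity)
          have h7 : (0 : ℝ) ≤ 7 * k ^ 3 + 22 * k ^ 2 + 21 * k + 8 := by positivity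
          linarith [(by ring : 8 * ((k : ℝ) + 1) ^ 3 =
            k * (3 + 2 * k + k ^ 2) + (7 * k ^ 3 + 22 * k ^ 2 + 21 * k + 8))]
      _ ≤ _ := hstep hy5 (by omega)
  have B2 : ((Fintype.card (I → V) : ℝ) + 1) ^ m ≤ Real.exp (y ^ (2 * M - 15)) := by
    have h1 : (Fintype.card (I → V) : ℝ) + 1 ≤ Real.exp (k ^ 2 + 1) := by
      have h2 : 1 ≤ Real.exp ((k : ℝ) ^ 2) := Real.one_le_exp (by positivity)
      rw [hcT, Real.exp_add]
      linarith [mul_le_mul_of_nonneg_left hexp2 (Real.exp_pos ((k : ℝ) ^ 2)).le]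
    refine (pow_le_pow_left₀ (by positivity) h1 _).trans ?_
    rw [← Real.exp_nat_mul]
    apply Real.exp_le_exp.2
    calc (m : ℝ) * (k ^ 2 + 1) ≤ y ^ (M - 3) * (k ^ 2 + 1) :=
          mul_le_mul_of_nonneg_right hm1 (by positivity)
      _ = (k ^ 2 + 1) * y ^ (M - 3) := mul_comm _ _
      _ ≤ y ^ (M - 2) := hstep (le_trans (by
          linarith [sq_nonneg (k : ℝ), (by ring : 2 * ((k : ℝ) + 1) ^ 2 = 2 * k ^ 2 + 4 * k + 2)])
          hk2y) (by omega)
      _ ≤ _ := hmono (by omega)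
  have B3 : Real.exp (-((1 / 2) ^ (q ^ 2) *
      ((y ^ (M - 2)) ^ 2 / (2 * (4 * ((k : ℝ) + 1) ^ q) * q ^ 2)))) ≤
      Real.exp (-y ^ (2 * M - 7)) := by
    apply Real.exp_le_exp.2 (neg_le_neg _)
    have h1 : (1 / 2 : ℝ) ^ (q ^ 2) * ((y ^ (M - 2)) ^ 2 / (2 * (4 * ((k : ℝ) + 1) ^ q) * q ^ 2)) =
        y ^ (2 * M - 4) / (8 * 2 ^ (q ^ 2) * q ^ 2 * ((k : ℝ) + 1) ^ q) := by
      rw [← pow_mul, show (M - 2) * 2 = 2 * M - 4 by omega, div_pow]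
      field_simp
      norm_num
    rw [h1, le_div_iff₀ (by positivity), mul_comm]
    exact (mul_le_mul_of_nonneg_left (hmono (by omega : 2 * M - 7 ≤ 2 * M - 5))
      (by positivity)).trans (hstep hy6 (by omega))
  have B4 : p ^ m ≤ Real.exp (-y ^ (2 * M - 7)) := by
    rw [hp, ← Real.exp_nat_mul]
    apply Real.exp_le_exp.2
    rw [mul_neg]
    apply neg_le_neg
    have h1 : 2 * y ^ (2 * M - 7) ≤ y ^ (2 * M - 6) := hstep (by linarith) (by omega)
    have h2 : y ^ (2 * M - 6) = y ^ (M - 3) * y ^ (M - 3) := by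
      rw [← pow_add]; congr 1; omega
    have h3 := mul_le_mul_of_nonneg_right hm2 (by positivity : 0 ≤ y ^ (M - 3))
    linarith
  have B5 : 2 * y ^ (2 * M - 15) + y ≤ y ^ (2 * M - 7) := by
    have h1 : 3 * y ^ (2 * M - 15) ≤ y ^ (2 * M - 14) := hstep (by linarith) (by omega)
    have h2 : y ≤ y ^ (2 * M - 15) := le_self_pow₀ hy0 (by omega)
    have h3 : y ^ (2 * M - 14) ≤ y ^ (2 * M - 7) := hmono (by omega)
    linarith
  calc _ ≤ Real.exp (y ^ (2 * M - 15)) * (Real.exp (y ^ (2 * M - 15)) *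
        (Real.exp (-y ^ (2 * M - 7)) + Real.exp (-y ^ (2 * M - 7)))) :=
        mul_le_mul B1 (mul_le_mul B2 (add_le_add B3 B4) (add_nonneg (Real.exp_pos _).le
            (pow_nonneg (hp ▸ (Real.exp_pos _).le) _)) (Real.exp_pos _).le)
          (mul_nonneg (by positivity) (add_nonneg (Real.exp_pos _).le
            (pow_nonneg (hp ▸ (Real.exp_pos _).le) _))) (Real.exp_pos _).le
    _ = 2 * Real.exp (y ^ (2 * M - 15) + y ^ (2 * M - 15) + -y ^ (2 * M - 7)) := by
        rw [Real.exp_add, Real.exp_add]; ring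
    _ ≤ 2 * Real.exp (-y) := by
        refine mul_le_mul_of_nonneg_left (Real.exp_le_exp.2 ?_) (by norm_num)
        linarith
    _ ≤ 2 / y := by
        rw [Real.exp_neg, div_eq_mul_inv]
        refine mul_le_mul_of_nonneg_left (inv_anti₀ hypos ?_) (by norm_num)
        linarith [Real.add_one_le_exp y]

end numeric

/-! ## Asymptotics -/

theorem eventually_poly_le_two_pow (C : ℝ) (j : ℕ) :
    ∀ᶠ k : ℕ in atTop, C * ((k : ℝ) + 1) ^ j ≤ 2 ^ k := by
  have h := (tendsto_pow_const_div_const_pow_of_one_lt j (by norm_num : (1 : ℝ) < 2)).comp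
    (tendsto_add_atTop_nat 1)
  have hpos : (0 : ℝ) < 1 / (2 * (|C| + 1)) := by positivity
  filter_upwards [h.eventually_lt_const hpos] with k hk
  simp only [Function.comp_apply, Nat.cast_add, Nat.cast_one] at hk
  rw [div_lt_div_iff₀ (by positivity) (by positivity), pow_succ] at hk
  have h1 : C * ((k : ℝ) + 1) ^ j ≤ (|C| + 1) * ((k : ℝ) + 1) ^ j :=
    mul_le_mul_of_nonneg_right (by linarith [le_abs_self C]) (by positivity)
  linarith

/-- The clique size is logarithmic in the block size, so its polynomials stay below every fixed root
of the block size. -/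
theorem eventually_poly_le_root {C : ℝ} (hC : 0 ≤ C) (e : ℕ) {M : ℕ} (hM : 0 < M) :
    ∀ᶠ k : ℕ in atTop, ∀ y : ℝ, 0 ≤ y → (2 : ℝ) ^ k ≤ 2 * (y ^ M) ^ 4 →
      C * ((k : ℝ) + 1) ^ e ≤ y := by
  filter_upwards [eventually_poly_le_two_pow (2 * C ^ (M * 4)) (e * (M * 4))] with k hk y hy h
  by_contra! hlt
  have h1 : y ^ (M * 4) < (C * ((k : ℝ) + 1) ^ e) ^ (M * 4) :=
    pow_lt_pow_left₀ hlt hy (by omega)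
  rw [mul_pow, ← pow_mul] at h1
  rw [← pow_mul] at h
  linarith

theorem numCliqueVars_eq (c m : ℕ) :
    numCliqueVars c m = cliqueSize c m * (c * (2 * m + 1)) := by
  simp [numCliqueVars]
  ring

theorem tendsto_coordRange {c : ℕ} : Tendsto (coordRange c) atTop atTop := by
  refine tendsto_atTop.2 fun b => ?_
  filter_upwards [eventually_ge_atTop (numCliqueVars c b), eventually_ge_atTop b] with n h1 h2
  exact Nat.le_findGreatest h2 h1

theorem pow_four_le_two_pow_cliqueSize (c m : ℕ) : (m ^ c) ^ 4 ≤ 2 ^ cliqueSize c m :=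
  Nat.le_pow_clog (by norm_num) _

theorem two_pow_cliqueSize_le {c m : ℕ} (hc : 0 < c) (hm : 2 ≤ m) :
    2 ^ cliqueSize c m ≤ 2 * (m ^ c) ^ 4 := by
  have h1 : 1 < (m ^ c) ^ 4 := Nat.one_lt_pow (by norm_num) (Nat.one_lt_pow hc.ne' (by omega))
  have h2 := Nat.pow_pred_clog_lt_self (by norm_num : 1 < 2) h1
  have h3 := Nat.clog_pos (by norm_num : 1 < 2) h1
  unfold cliqueSize
  calc 2 ^ Nat.clog 2 ((m ^ c) ^ 4) = 2 * 2 ^ (Nat.clog 2 ((m ^ c) ^ 4)).pred := by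
        rw [← pow_succ']
        congr 1
        simp only [Nat.pred_eq_sub_one]
        omega
    _ ≤ _ := by omega

theorem tendsto_cliqueSize {c : ℕ} (hc : 0 < c) : Tendsto (cliqueSize c) atTop atTop := by
  refine tendsto_atTop.2 fun b => ?_
  filter_upwards [eventually_ge_atTop (2 ^ b)] with m hm
  refine (Nat.pow_le_pow_iff_right (a := 2) (by norm_num)).1 ?_
  refine hm.trans (le_trans ?_ (pow_four_le_two_pow_cliqueSize c m))
  calc m ≤ m ^ c := Nat.le_self_pow hc.ne' m
    _ ≤ _ := Nat.le_self_pow (by norm_num) _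

/-- By maximality of `m = coordRange c n`, `n` is less than the number of variables for `m + 1`,
hence at most `3 * c * k * m` with `k` logarithmic in `m`. Large `E` makes the exponent `1 + 4 * c /
E` in `n ≤ m ^ (1 + 4 * c / E)` close to one. -/
theorem eventually_pow_le_coordRange_pow {c : ℕ} (hc : 0 < c) (E : ℕ) :
    ∀ᶠ n : ℕ in atTop, n ^ E ≤ coordRange c n ^ (E + 4 * c) := by
  have h1 : Tendsto (fun n => cliqueSize c (coordRange c n + 1)) atTop atTop :=
    (tendsto_cliqueSize hc).comp ((tendsto_add_atTop_nat 1).comp tendsto_coordRange)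
  filter_upwards [h1.eventually (eventually_poly_le_two_pow (2 * 2 ^ (4 * c) * (3 * c) ^ E) E),
    tendsto_coordRange.eventually (eventually_ge_atTop 3), eventually_ge_atTop 2] with n h2 h3 hn
  have hlt : coordRange c n < n := by
    refine lt_of_le_of_ne (Nat.findGreatest_le n) fun h => ?_
    have h4 := numCliqueVars_coordRange_le c n
    rw [h, numCliqueVars_eq] at h4
    have h5 : 0 < cliqueSize c n :=
      Nat.clog_pos (by norm_num) (Nat.one_lt_pow (by norm_num) (Nat.one_lt_pow hc.ne' (by omega)))
    nlinarith [Nat.mul_le_mul (show 1 ≤ cliqueSize c n from h5)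
      (Nat.mul_le_mul_right (2 * n + 1) (show 1 ≤ c from hc))]
  have h4 : n < numCliqueVars c (coordRange c n + 1) := by
    by_contra! h
    exact Nat.findGreatest_is_greatest (P := fun m => numCliqueVars c m ≤ n) (Nat.lt_succ_self _)
      hlt h
  rw [numCliqueVars_eq] at h4
  set m := coordRange c n
  set k := cliqueSize c (m + 1)
  have h5 : n ≤ 3 * c * k * m := by
    have : k * (c * (2 * (m + 1) + 1)) ≤ k * (c * (3 * m)) :=
      Nat.mul_le_mul_left _ (Nat.mul_le_mul_left _ (by omega))
    calc n ≤ k * (c * (3 * m)) := h4.le.trans this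
      _ = _ := by ring
  have h6 : (3 * c * k) ^ E ≤ m ^ (4 * c) := by
    have h7 : (2 : ℝ) ^ k ≤ 2 * ((2 * m) ^ c) ^ 4 := by
      have h8 := two_pow_cliqueSize_le hc (by omega : 2 ≤ m + 1)
      have h9 : 2 * ((m + 1) ^ c) ^ 4 ≤ 2 * ((2 * m) ^ c) ^ 4 :=
        Nat.mul_le_mul_left _ (Nat.pow_le_pow_left (Nat.pow_le_pow_left (by omega) _) _)
      exact_mod_cast h8.trans h9
    have h8 : ((2 * (m : ℝ)) ^ c) ^ 4 = 2 ^ (4 * c) * m ^ (4 * c) := by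
      rw [← pow_mul, mul_comm c, mul_pow]
    rw [h8] at h7
    have h9 : (k : ℝ) ^ E ≤ (k + 1) ^ E := pow_le_pow_left₀ (by positivity) (by linarith) _
    have h10 : 2 * 2 ^ (4 * c) * ((3 * c) ^ E * (k : ℝ) ^ E) ≤
        2 * 2 ^ (4 * c) * (m : ℝ) ^ (4 * c) := by
      calc 2 * 2 ^ (4 * c) * ((3 * c) ^ E * (k : ℝ) ^ E) ≤
            2 * 2 ^ (4 * c) * ((3 * c) ^ E * (k + 1 : ℝ) ^ E) :=
            mul_le_mul_of_nonneg_left (mul_le_mul_of_nonneg_left h9 (by positivity)) (by positivity)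
        _ = 2 * 2 ^ (4 * c) * (3 * c) ^ E * (k + 1 : ℝ) ^ E := by ring
        _ ≤ 2 * (2 ^ (4 * c) * m ^ (4 * c)) := h2.trans h7
        _ = _ := by ring
    have h11 := le_of_mul_le_mul_left h10 (by positivity)
    rw [← mul_pow] at h11
    exact_mod_cast h11
  calc n ^ E ≤ (3 * c * k * m) ^ E := Nat.pow_le_pow_left h5 _
    _ = m ^ E * (3 * c * k) ^ E := by rw [mul_pow, mul_comm]
    _ ≤ m ^ E * m ^ (4 * c) := Nat.mul_le_mul_left _ h6
    _ = _ := (pow_add _ _ _).symm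

/-! ## Unsatisfiability of random formulas -/

theorem eventually_prob_satisfiable_le {c : ℕ} (hc : 0 < c) {η : ℝ} (hη : 0 < η) :
    ∀ᶠ n : ℕ in atTop, prob (fun ω => ¬ (randomFormula c n ω).Unsat) ≤ η := by
  have h1 : Tendsto (fun n => cliqueSize c (coordRange c n)) atTop atTop :=
    (tendsto_cliqueSize hc).comp tendsto_coordRange
  have h2 := (tendsto_pow_atTop_nhds_zero_of_lt_one (by norm_num : (0 : ℝ) ≤ 1 / 2)
    (by norm_num)).eventually_lt_const (show 0 < η ^ 4 by positivity)
  filter_upwards [h1.eventually h2, h1.eventually (eventually_ge_atTop 3)] with n h3 h4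
  refine (prob_satisfiable_le n).trans ?_
  have hN : (((coordRange c n ^ c : ℕ) : ℝ)) ^ 4 ≤ 2 ^ cliqueSize c (coordRange c n) := by
    exact_mod_cast pow_four_le_two_pow_cliqueSize c (coordRange c n)
  generalize ((coordRange c n ^ c : ℕ) : ℝ) = N at *
  generalize cliqueSize c (coordRange c n) = k at *
  by_contra! hlt
  have h5 := pow_lt_pow_left₀ hlt hη.le (by norm_num : 4 ≠ 0)
  -- Fourth powers allow `N ^ 4 ≤ 2 ^ k` to be used directly; `4 * k.choose 2 ≥ k ^ 2 + k` holds
  -- from `k = 3` on.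
  have h6 : (N ^ k * (1 / 2) ^ k.choose 2) ^ 4 ≤ (1 / 2) ^ k := by
    have h7 : k.choose 2 * 2 = k * (k - 1) := by
      rw [Nat.choose_two_right, Nat.div_mul_cancel (Nat.even_mul_pred_self k).two_dvd]
    have h8 : k * k + k ≤ k.choose 2 * 4 := by
      obtain ⟨j, rfl⟩ : ∃ j, k = j + 3 := ⟨k - 3, by omega⟩
      have : j + 3 - 1 = j + 2 := by omega
      rw [this] at h7
      nlinarith
    calc (N ^ k * (1 / 2) ^ k.choose 2) ^ 4 = (N ^ 4) ^ k * (1 / 2) ^ (k.choose 2 * 4) := by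
          rw [mul_pow, ← pow_mul, ← pow_mul, ← pow_mul, mul_comm 4]
      _ ≤ (2 ^ k) ^ k * (1 / 2) ^ (k * k + k) :=
          mul_le_mul (pow_le_pow_left₀ (by positivity) hN _)
            (pow_le_pow_of_le_one (by norm_num) (by norm_num) h8) (by positivity) (by positivity)
      _ = (1 / 2) ^ k := by
          rw [pow_add, ← mul_assoc, ← pow_mul, ← mul_pow]
          norm_num
  linarith

theorem uniformProb_cliqueFamily_le_one {c : ℕ} (hc : 0 < c) (n : ℕ) (P : CNF (Fin n) → Prop) :
    uniformProb (cliqueFamily c n) P ≤ 1 := by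
  rw [uniformProb_cliqueFamily hc]
  exact prob.le_one _

theorem one_sub_le_uniformProb_cliqueFamily {c n : ℕ} (hc : 0 < c) {P : CNF (Fin n) → Prop}
    {η : ℝ} (h : prob (fun ω => ¬ P (randomFormula c n ω)) ≤ η) :
    1 - η ≤ uniformProb (cliqueFamily c n) P := by
  rw [uniformProb_cliqueFamily hc]
  linarith [prob.add_not fun ω => P (randomFormula c n ω)]

theorem aas_unsat {c : ℕ} (hc : 0 < c) : AAS (cliqueFamily c) (fun _ A => A.Unsat) := by
  refine tendsto_order.2 ⟨fun a ha => ?_, fun a ha => Eventually.of_forall fun n =>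
    (uniformProb_cliqueFamily_le_one hc n _).trans_lt ha⟩
  filter_upwards [eventually_prob_satisfiable_le hc (show 0 < (1 - a) / 2 by linarith)] with n hn
  have := one_sub_le_uniformProb_cliqueFamily hc hn
  linarith

/-! ## Length of tree-like refutations of random formulas -/

theorem eventually_prob_refutation_le {c : ℕ} (hc : 0 < c) {M : ℕ} (hM : 16 ≤ M) (D : ℕ)
    {η : ℝ} (hη : 0 < η) :
    ∀ᶠ n : ℕ in atTop, ∀ F : Set (BoolFun (Fin n)), ∀ y : ℝ, 0 ≤ y →
      y ^ M = (coordRange c n : ℝ) ^ c → (F.ncard : ℝ) ≤ Real.exp (y ^ (2 * M - 16)) →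
      prob (fun ω => ∃ π : SemRefutation F (randomFormula c n ω), π.TreeLike ∧
        3 ^ (D * cliqueSize c (coordRange c n)) * π.length ≤
          4 ^ (D * cliqueSize c (coordRange c n))) ≤ η := by
  have hk : Tendsto (fun n => cliqueSize c (coordRange c n)) atTop atTop :=
    (tendsto_cliqueSize hc).comp tendsto_coordRange
  obtain ⟨q, hq⟩ : ∃ q, q = 8 * M * D + 1 := ⟨_, rfl⟩
  have ev : ∀ {C : ℝ}, 0 ≤ C → ∀ e : ℕ, ∀ᶠ n : ℕ in atTop, ∀ y : ℝ, 0 ≤ y →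
      (2 : ℝ) ^ cliqueSize c (coordRange c n) ≤ 2 * (y ^ M) ^ 4 →
      C * ((cliqueSize c (coordRange c n) : ℝ) + 1) ^ e ≤ y := fun hC e =>
    hk.eventually (eventually_poly_le_root hC e (by omega))
  filter_upwards [hk.eventually (eventually_ge_atTop 1),
    tendsto_coordRange.eventually (eventually_ge_atTop 2),
    ev (C := 8) (by norm_num) 0, ev (C := 8 ^ (q + 1) * 4 ^ D + 1) (by positivity) 0,
    ev (C := 32 ^ q) (by positivity) 0, ev (C := 1024 * 2 ^ q) (by positivity) 2,
    ev (C := 8 * q) (by positivity) q, ev (C := 8 * D) (by positivity) 3,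
    ev (C := 8 * 2 ^ (q ^ 2) * q ^ 2) (by positivity) q, ev (C := 2 / η) (by positivity) 0]
    with n h1 h2 e1 e2 e3 e4 e5 e6 e7 e8 F y hy hyM hF
  have hV : (Fintype.card (Fin c → Fin (coordRange c n)) : ℝ) = (coordRange c n : ℝ) ^ c := by
    simp
  have hI : Fintype.card (Fin (cliqueSize c (coordRange c n))) = cliqueSize c (coordRange c n) := by
    simp
  have hlow : ((coordRange c n : ℝ) ^ c) ^ 4 ≤ 2 ^ cliqueSize c (coordRange c n) := by
    exact_mod_cast pow_four_le_two_pow_cliqueSize c (coordRange c n)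
  have hup : (2 : ℝ) ^ cliqueSize c (coordRange c n) ≤ 2 * ((coordRange c n : ℝ) ^ c) ^ 4 := by
    exact_mod_cast two_pow_cliqueSize_le hc h2
  have hup' := hup
  rw [← hyM] at hup'
  have d1 := e1 y hy hup'
  have d2 := e2 y hy hup'
  have d3 := e3 y hy hup'
  have d8 := e8 y hy hup'
  rw [pow_zero, mul_one] at d1 d2 d3 d8
  have : Nonempty (Fin (coordRange c n)) := ⟨⟨0, by omega⟩⟩
  refine prob_exists_refutation_le F _ fun F' hF' => ?_
  have main := prob_exists_tree_le_of_large (I := Fin (cliqueSize c (coordRange c n)))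
    (V := Fin c → Fin (coordRange c n)) (D := D) hM hq (hyM.trans hV.symm) (by rw [hI]; exact h1)
    (by rw [hI, hV]; exact hlow) (by rw [hI, hV]; exact hup) d1 (by linarith) d3
    (by rw [hI]; exact e4 y hy hup') (by rw [hI]; exact e5 y hy hup')
    (by rw [hI]; exact e6 y hy hup') (by rw [hI]; exact e7 y hy hup') F'
    (le_trans (by exact_mod_cast hF') hF)
  rw [hI, Finset.coe_univ] at main
  refine main.trans ?_
  rw [div_le_iff₀ hη] at d8
  rw [div_le_iff₀ (by linarith)]
  linarith

/-- One half of `ε` pays for `n ≤ m ^ (1 + 4 * c / E)`, the other for `y ^ (2 * M - 16) = m ^ (2 * c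
- 16 * c / M)`. -/
theorem rpow_le_root_pow {c n m E M : ℕ} {ε y : ℝ} (hε : 0 < ε) (hε1 : ε ≤ 1) (hc : 0 < c)
    (hm : 1 ≤ m) (hE : 0 < E) (hE' : 16 * (c : ℝ) ^ 2 ≤ ε * E) (hM : 16 ≤ M)
    (hM' : 32 * (c : ℝ) ≤ ε * M) (hn : n ^ E ≤ m ^ (E + 4 * c)) (hy : 0 ≤ y)
    (hyM : y ^ M = (m : ℝ) ^ c) : (n : ℝ) ^ (2 * (c : ℝ) - ε) ≤ y ^ (2 * M - 16) := by
  have hc1 : (1 : ℝ) ≤ c := by exact_mod_cast hc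
  have hm1 : (1 : ℝ) ≤ m := by exact_mod_cast hm
  have hm0 : (0 : ℝ) ≤ m := by linarith
  have hE0 : (0 : ℝ) < E := by exact_mod_cast hE
  have hM0 : (0 : ℝ) < M := by exact_mod_cast (by omega : 0 < M)
  have hn' : (n : ℝ) ^ E ≤ (m : ℝ) ^ (E + 4 * c) := by exact_mod_cast hn
  have h1 : (n : ℝ) ^ (2 * (c : ℝ) - ε) ≤ (m : ℝ) ^ (2 * (c : ℝ) - ε / 2) := by
    calc (n : ℝ) ^ (2 * (c : ℝ) - ε) = ((n : ℝ) ^ E) ^ ((2 * (c : ℝ) - ε) / E) := by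
          rw [← Real.rpow_natCast, ← Real.rpow_mul (by positivity)]
          congr 1
          field_simp
      _ ≤ ((m : ℝ) ^ (E + 4 * c)) ^ ((2 * (c : ℝ) - ε) / E) :=
          Real.rpow_le_rpow (by positivity) hn' (div_nonneg (by linarith) hE0.le)
      _ = (m : ℝ) ^ (((E + 4 * c : ℕ) : ℝ) * ((2 * (c : ℝ) - ε) / E)) := by
          rw [← Real.rpow_natCast, ← Real.rpow_mul hm0]
      _ ≤ (m : ℝ) ^ (2 * (c : ℝ) - ε / 2) := by
          apply Real.rpow_le_rpow_of_exponent_le hm1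
          rw [← mul_div_assoc, div_le_iff₀ hE0]
          push_cast
          nlinarith
  have h2 : y ^ (2 * M - 16) = (m : ℝ) ^ ((c : ℝ) * ((2 * M - 16 : ℕ) : ℝ) / M) := by
    have h3 : y = (m : ℝ) ^ ((c : ℝ) / M) := by
      have h4 : y = (y ^ M) ^ ((1 : ℝ) / M) := by
        rw [← Real.rpow_natCast, ← Real.rpow_mul hy]
        field_simp
        simp
      rw [h4, hyM, ← Real.rpow_natCast, ← Real.rpow_mul hm0]
      congr 1
      ring
    rw [h3, ← Real.rpow_natCast, ← Real.rpow_mul hm0]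
    congr 1
    ring
  rw [h2]
  refine h1.trans (Real.rpow_le_rpow_of_exponent_le hm1 ?_)
  rw [le_div_iff₀ hM0, Nat.cast_sub (by omega)]
  push_cast
  nlinarith

/-- `D = 3 * K` suffices: `(4 / 3) ^ 3 > 2`, and `2 ^ k ≥ m ^ (4 * c) ≥ m ^ 2 ≥ n` for large `n`. -/
theorem eventually_le_uniformProb {c : ℕ} (hc : 0 < c) {ε : ℝ} (hε : 0 < ε) (K : ℕ) {η : ℝ}
    (hη : 0 < η) :
    ∀ᶠ n : ℕ in atTop, ∀ F : Set (BoolFun (Fin n)),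
      (F.ncard : ℝ) ≤ Real.exp ((n : ℝ) ^ (2 * (c : ℝ) - ε)) →
      1 - η ≤ uniformProb (cliqueFamily c n)
        (fun A => ∀ π : SemRefutation F A, π.TreeLike → n ^ K ≤ π.length) := by
  -- Capping `ε` at one keeps the exponent `2 * c - δ` nonnegative.
  obtain ⟨δ, hδ0, hδ1, hδε⟩ : ∃ δ : ℝ, 0 < δ ∧ δ ≤ 1 ∧ δ ≤ ε :=
    ⟨min ε 1, lt_min hε one_pos, min_le_right _ _, min_le_left _ _⟩
  obtain ⟨M, hM, hM'⟩ : ∃ M : ℕ, 16 ≤ M ∧ 32 * (c : ℝ) ≤ δ * M := by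
    obtain ⟨M, hM⟩ := exists_nat_ge (32 * (c : ℝ) / δ)
    rw [div_le_iff₀ hδ0] at hM
    refine ⟨M + 16, by omega, ?_⟩
    push_cast
    nlinarith
  obtain ⟨E, hE, hE'⟩ : ∃ E : ℕ, 0 < E ∧ 16 * (c : ℝ) ^ 2 ≤ δ * E := by
    obtain ⟨E, hE⟩ := exists_nat_ge (16 * (c : ℝ) ^ 2 / δ)
    rw [div_le_iff₀ hδ0] at hE
    refine ⟨E + 1, by omega, ?_⟩
    push_cast
    nlinarith
  filter_upwards [eventually_prob_refutation_le hc hM (3 * K) hη,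
    eventually_pow_le_coordRange_pow hc E, eventually_pow_le_coordRange_pow hc (4 * c),
    tendsto_coordRange.eventually (eventually_ge_atTop 1), eventually_ge_atTop 1]
    with n h1 h2 h3 h4 hn F hF
  set m := coordRange c n
  set k := cliqueSize c m
  obtain ⟨y, hy, hyM⟩ : ∃ y : ℝ, 0 ≤ y ∧ y ^ M = (m : ℝ) ^ c := by
    refine ⟨((m : ℝ) ^ c) ^ ((1 : ℝ) / M), by positivity, ?_⟩
    rw [one_div, Real.rpow_inv_natCast_pow (by positivity) (by omega)]
  have hn1 : (1 : ℝ) ≤ n := by exact_mod_cast hn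
  apply one_sub_le_uniformProb_cliqueFamily hc
  refine (prob.mono ?_).trans (h1 F y hy hyM (hF.trans (Real.exp_le_exp.2 ?_)))
  · intro ω hω
    push Not at hω
    obtain ⟨π, hπ, hlen⟩ := hω
    refine ⟨π, hπ, ?_⟩
    have h5 : n ≤ m ^ 2 := by
      refine (Nat.pow_le_pow_iff_left (n := 4 * c) (by omega)).1 ?_
      rw [← pow_mul]
      convert h3 using 2
      ring
    have h6 : n ^ K ≤ 2 ^ (K * k) := by
      calc n ^ K ≤ (m ^ 2) ^ K := Nat.pow_le_pow_left h5 _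
        _ ≤ ((m ^ c) ^ 4) ^ K := by
            refine Nat.pow_le_pow_left ?_ _
            rw [← pow_mul]
            exact Nat.pow_le_pow_right h4 (by omega)
        _ ≤ (2 ^ k) ^ K := Nat.pow_le_pow_left (pow_four_le_two_pow_cliqueSize c m) _
        _ = _ := by rw [← pow_mul, mul_comm]
    change 3 ^ (3 * K * k) * π.length ≤ 4 ^ (3 * K * k)
    calc 3 ^ (3 * K * k) * π.length ≤ 3 ^ (3 * K * k) * 2 ^ (K * k) :=
          Nat.mul_le_mul_left _ (hlen.le.trans h6)
      _ = 54 ^ (K * k) := by rw [mul_assoc, pow_mul, ← mul_pow]; norm_num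
      _ ≤ 64 ^ (K * k) := Nat.pow_le_pow_left (by norm_num) _
      _ = _ := by rw [mul_assoc, pow_mul 4]; norm_num
  · exact (Real.rpow_le_rpow_of_exponent_le hn1 (by linarith)).trans
      (rpow_le_root_pow hδ0 hδ1 hc h4 hE hE' hM hM' h2 hy hyM)

/-- Diagonal choice: `κ n` is the largest `K ≤ n` whose threshold `n` has passed. -/
theorem exists_tendsto_of_eventually {Q : ℕ → ℕ → Prop} (h : ∀ K, ∀ᶠ n in atTop, Q K n) :
    ∃ κ : ℕ → ℕ, Tendsto κ atTop atTop ∧ ∀ᶠ n in atTop, Q (κ n) n := by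
  classical
  simp only [eventually_atTop] at h
  choose t ht using h
  refine ⟨fun n => Nat.findGreatest (fun K => t K ≤ n) n, tendsto_atTop.2 fun b => ?_, ?_⟩
  · filter_upwards [eventually_ge_atTop b, eventually_ge_atTop (t b)] with n h1 h2
    exact Nat.le_findGreatest h1 h2
  · filter_upwards [eventually_ge_atTop (t 0)] with n hn
    exact ht _ n (Nat.findGreatest_spec (P := fun K => t K ≤ n) (Nat.zero_le n) hn)

/-- The polynomial bounds are uniform in `F`, so the diagonal exponent `κ` and hence `L n = n ^ κ n`
do not depend on the sequence. -/
theorem exists_superpolynomial_bound {c : ℕ} (hc : 0 < c) {ε : ℝ} (hε : 0 < ε) :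
    ∃ L : ℕ → ℕ, IsSuperpolynomial L ∧ ∀ F : ∀ n : ℕ, Set (BoolFun (Fin n)),
      (∀ᶠ n : ℕ in atTop, ((F n).ncard : ℝ) ≤ Real.exp ((n : ℝ) ^ (2 * (c : ℝ) - ε))) →
      AAS (cliqueFamily c)
        (fun n A => ∀ π : SemRefutation (F n) A, π.TreeLike → L n ≤ π.length) := by
  obtain ⟨κ, hκ, h⟩ := exists_tendsto_of_eventually fun K =>
    eventually_le_uniformProb hc hε K (η := 1 / ((K : ℝ) + 1)) (by positivity)
  refine ⟨fun n => n ^ κ n, fun K => ?_, fun F hF => ?_⟩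
  · filter_upwards [hκ.eventually (eventually_ge_atTop K), eventually_ge_atTop 1] with n h1 h2
    exact Nat.pow_le_pow_right h2 h1
  · have h1 : Tendsto (fun n => 1 - 1 / ((κ n : ℝ) + 1)) atTop (𝓝 1) := by
      have := (tendsto_one_div_add_atTop_nhds_zero_nat (𝕜 := ℝ)).comp hκ
      simpa using this.const_sub 1
    refine tendsto_of_tendsto_of_tendsto_of_le_of_le' h1 tendsto_const_nhds ?_
      (Eventually.of_forall fun n => uniformProb_cliqueFamily_le_one hc n _)
    filter_upwards [h, hF] with n h2 h3
    exact h2 (F n) h3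

/-! ## The hierarchy -/

theorem CNF.IsKCNF.mono {X : Type} {k ℓ : ℕ} (hkℓ : k ≤ ℓ) {A : CNF X} (h : A.IsKCNF k) :
    A.IsKCNF ℓ := fun C hC => ⟨(h C hC).1.trans hkℓ, (h C hC).2⟩

/-- The indicators of the sets of assignments falsifying some `k`-CNF formula. -/
def cnfLines (k n : ℕ) : Set (BoolFun (Fin n)) :=
  {f | ∃ A : CNF (Fin n), A.IsKCNF k ∧ ∀ α, f α = true ↔ ¬ A.Sat α}

theorem cnfLines_mono {k ℓ n : ℕ} (h : k ≤ ℓ) : cnfLines k n ⊆ cnfLines ℓ n := by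
  rintro f ⟨A, hA, hf⟩
  exact ⟨A, hA.mono h, hf⟩

theorem CNF.IsKCNF.subset_filter {n k : ℕ} {A : CNF (Fin n)} (hA : A.IsKCNF k) :
    A ⊆ Finset.univ.filter fun C : Clause (Fin n) => C.card ≤ k := fun C hC => by
  simpa using (hA C hC).1

theorem CNF.IsKCNF.card_le {n k : ℕ} {A : CNF (Fin n)} (hA : A.IsKCNF k) :
    A.card ≤ (2 * n + 1) ^ k := by
  refine (Finset.card_le_card hA.subset_filter).trans ((card_finset_card_le k).trans (le_of_eq ?_))
  simp [mul_comm]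

theorem ncard_cnfLines_le (k n : ℕ) : (cnfLines k n).ncard ≤ 2 ^ ((2 * n + 1) ^ k) := by
  classical
  let S := Finset.univ.filter fun C : Clause (Fin n) => C.card ≤ k
  have h1 : cnfLines k n ⊆
      ((S.powerset.image fun A : CNF (Fin n) => fun α => decide (¬ A.Sat α) :
        Finset (BoolFun (Fin n))) : Set (BoolFun (Fin n))) := by
    rintro f ⟨A, hA, hf⟩
    simp only [Finset.coe_image, Set.mem_image, Finset.mem_coe, Finset.mem_powerset]
    refine ⟨A, hA.subset_filter, funext fun α => ?_⟩
    rw [Bool.eq_iff_iff, hf, decide_eq_true_iff]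
  refine (Set.ncard_le_ncard h1 (Finset.finite_toSet _)).trans ?_
  rw [Set.ncard_coe_finset]
  refine Finset.card_image_le.trans ?_
  rw [Finset.card_powerset]
  refine Nat.pow_le_pow_right (by norm_num) ((card_finset_card_le k).trans (le_of_eq ?_))
  simp [mul_comm]

/-- The exponent is only of order `n ^ (ℓ - 1)`, and the spare factor `n ^ (1 / 2)` absorbs the
constant. -/
theorem eventually_ncard_cnfLines_le {ℓ : ℕ} (hℓ : 1 ≤ ℓ) :
    ∀ᶠ n : ℕ in atTop,
      ((cnfLines (ℓ - 1) n).ncard : ℝ) ≤ Real.exp ((n : ℝ) ^ ((ℓ : ℝ) - 1 / 2)) := by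
  filter_upwards [eventually_ge_atTop (9 ^ (ℓ - 1)), eventually_ge_atTop 1] with n h1 h2
  have hn0 : (0 : ℝ) < n := by exact_mod_cast h2
  have hexp : (2 : ℝ) ≤ Real.exp 1 := by have := Real.add_one_le_exp (1 : ℝ); linarith
  have h3 : (((2 * n + 1) ^ (ℓ - 1) : ℕ) : ℝ) ≤ (n : ℝ) ^ ((ℓ : ℝ) - 1 / 2) := by
    have h4 : (3 : ℝ) ^ (ℓ - 1) ≤ (n : ℝ) ^ (1 / 2 : ℝ) := by
      rw [← Real.sqrt_eq_rpow]
      apply Real.le_sqrt_of_sq_le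
      rw [← pow_mul, mul_comm, pow_mul]
      norm_num
      exact_mod_cast h1
    calc (((2 * n + 1) ^ (ℓ - 1) : ℕ) : ℝ) ≤ (((3 * n) ^ (ℓ - 1) : ℕ) : ℝ) := by
          exact_mod_cast Nat.pow_le_pow_left (by omega) _
      _ = 3 ^ (ℓ - 1) * (n : ℝ) ^ (ℓ - 1) := by push_cast; rw [mul_pow]
      _ ≤ (n : ℝ) ^ (1 / 2 : ℝ) * (n : ℝ) ^ (ℓ - 1) :=
          mul_le_mul_of_nonneg_right h4 (by positivity)
      _ = _ := by
          rw [← Real.rpow_natCast, ← Real.rpow_add hn0, Nat.cast_sub hℓ]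
          congr 1
          push_cast
          ring
  calc ((cnfLines (ℓ - 1) n).ncard : ℝ) ≤ 2 ^ ((2 * n + 1) ^ (ℓ - 1)) := by
        exact_mod_cast ncard_cnfLines_le (ℓ - 1) n
    _ ≤ Real.exp 1 ^ ((2 * n + 1) ^ (ℓ - 1)) := pow_le_pow_left₀ (by norm_num) hexp _
    _ = Real.exp (((2 * n + 1) ^ (ℓ - 1) : ℕ) : ℝ) := by rw [← Real.exp_nat_mul, mul_one]
    _ ≤ _ := Real.exp_le_exp.2 h3

/-- An unsatisfiable `k`-CNF formula is refuted by conjoining its clauses one at a time. -/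
theorem exists_treeLike_refutation {k n : ℕ} {A : CNF (Fin n)} (hA : A.IsKCNF k)
    (hunsat : A.Unsat) :
    ∃ π : SemRefutation (cnfLines k n) A, π.TreeLike ∧ π.length ≤ 2 * A.card := by
  classical
  obtain ⟨s, hs⟩ : ∃ s, s = A.card := ⟨_, rfl⟩
  have hs0 : 0 < s := by
    rw [hs, Finset.card_pos]
    by_contra h
    rw [Finset.not_nonempty_iff_eq_empty] at h
    subst h
    exact hunsat (fun _ => true) (fun C hC => by simp at hC)
  let e : A ≃ Fin s := A.equivFinOfCardEq hs.symm
  -- Lines below `s` are the clauses. Line `t ≥ s` conjoins clause `s - 1` with the clauses `0, …, t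
  -- - s`, and follows from line `t - 1` and clause `t - s`. Starting from the last clause makes
  -- line `t - 1` the right premise already for `t = s`, and no line is used twice.
  let used : ℕ → Fin s → Prop := fun t j =>
    if t < s then (j : ℕ) = t else (j : ℕ) = s - 1 ∨ (j : ℕ) ≤ t - s
  let fal : (Fin n → Bool) → Fin s → Prop := fun α j => ¬ Clause.Sat (e.symm j).1 α
  let π : SemRefutation (cnfLines k n) A :=
    { length := 2 * s - 1
      length_pos := by omega
      line := fun t α => decide (∃ j, used t j ∧ fal α j)
      premises := fun t =>
        if h : (t : ℕ) < s then none
        else some (⟨t - 1, by omega⟩, ⟨t - s, by omega⟩)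
      initial_line := by
        intro t ht
        have hts : (t : ℕ) < s := by
          by_contra h
          simp [h] at ht
        refine ⟨(e.symm ⟨t, hts⟩).1, (e.symm ⟨t, hts⟩).2, fun α => ?_⟩
        rw [decide_eq_true_iff]
        constructor
        · rintro ⟨j, hj, hf⟩
          simp only [used, hts, if_true] at hj
          rwa [show j = ⟨t, hts⟩ from Fin.ext hj] at hf
        · intro hf
          exact ⟨⟨t, hts⟩, by simp [used, hts], hf⟩
      derived_line := by
        intro t u v h
        have hts : ¬ (t : ℕ) < s := fun hts => by simp [hts] at h
        simp only [hts, dif_neg, not_false_eq_true, Option.some.injEq, Prod.mk.injEq] at h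
        obtain ⟨rfl, rfl⟩ := h
        have htl := t.2
        refine ⟨?_, ?_, ?_, ?_⟩
        · refine ⟨(Finset.univ.filter (used t)).image fun j => (e.symm j).1, ?_, fun α => ?_⟩
          · intro C hC
            obtain ⟨j, -, rfl⟩ := Finset.mem_image.1 hC
            exact hA _ (e.symm j).2
          · rw [decide_eq_true_iff]
            unfold CNF.Sat
            push Not
            constructor
            · rintro ⟨j, hj, hf⟩
              exact ⟨_, Finset.mem_image.2 ⟨j, by simpa using hj, rfl⟩, hf⟩
            · rintro ⟨C, hC, hf⟩
              obtain ⟨j, hj, rfl⟩ := Finset.mem_image.1 hC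
              exact ⟨j, by simpa using hj, hf⟩
        · rw [Fin.lt_def]; simp only; omega
        · rw [Fin.lt_def]; simp only; omega
        · intro α hα
          rw [decide_eq_true_iff] at hα ⊢
          rw [decide_eq_true_iff]
          obtain ⟨j, hj, hf⟩ := hα
          simp only [used, hts, if_false] at hj
          by_cases hjt : (j : ℕ) = t - s
          · right
            refine ⟨j, ?_, hf⟩
            have : (t : ℕ) - s < s := by omega
            simp only [used, this, if_true]
            exact hjt
          · left
            refine ⟨j, ?_, hf⟩
            simp only [used]
            split_ifs <;> omega
      final := by
        intro α
        have := hunsat α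
        unfold CNF.Sat at this
        push Not at this
        obtain ⟨C, hC, hf⟩ := this
        rw [decide_eq_true_iff]
        refine ⟨e ⟨C, hC⟩, ?_, by simpa [fal] using hf⟩
        have := (e ⟨C, hC⟩).2
        simp only [used]
        split_ifs <;> omega }
  refine ⟨π, ?_, by change 2 * s - 1 ≤ _; omega⟩
  have huse : ∀ {t j : Fin (2 * s - 1)}, π.Uses t j →
      ¬ (t : ℕ) < s ∧ ((j : ℕ) = t - 1 ∨ (j : ℕ) = t - s) := by
    rintro t j ⟨⟨u, v⟩, hp, h⟩
    have hts : ¬ (t : ℕ) < s := fun hts => by simp [π, hts] at hp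
    simp only [π, hts, dif_neg, not_false_eq_true, Option.some.injEq, Prod.mk.injEq] at hp
    obtain ⟨rfl, rfl⟩ := hp
    refine ⟨hts, ?_⟩
    rcases h with rfl | rfl
    · exact Or.inl rfl
    · exact Or.inr rfl
  intro j t t' h h'
  have h1 := huse h
  have h2 := huse h'
  have h3 : (t : ℕ) < 2 * s - 1 := t.2
  have h4 : (t' : ℕ) < 2 * s - 1 := t'.2
  exact Fin.ext (by omega)

theorem exists_of_uniformProb_gt_half {α : Type} [Finite α] {S : Set α} {P Q : α → Prop}
    (hP : 1 / 2 < uniformProb S P) (hQ : 1 / 2 < uniformProb S Q) : ∃ a ∈ S, P a ∧ Q a := by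
  by_contra! hno
  unfold uniformProb at hP hQ
  have hdisj : Disjoint {a ∈ S | P a} {a ∈ S | Q a} :=
    Set.disjoint_left.2 fun a ha hb => hno a ha.1 ha.2 hb.2
  have h1 : {a ∈ S | P a}.ncard + {a ∈ S | Q a}.ncard ≤ S.ncard := by
    rw [← Set.ncard_union_eq hdisj]
    exact Set.ncard_le_ncard (Set.union_subset (fun a h => h.1) (fun a h => h.1))
  have h2 : ({a ∈ S | P a}.ncard : ℝ) + {a ∈ S | Q a}.ncard ≤ S.ncard := by exact_mod_cast h1
  have h3 : (0 : ℝ) < S.ncard := by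
    rcases Nat.eq_zero_or_pos S.ncard with h | h
    · rw [h] at hP
      norm_num at hP
    · exact_mod_cast h
  rw [lt_div_iff₀ h3] at hP hQ
  linarith

/-- Unsatisfiability and hardness both have probability above one half, so some formula has both. It
has at most `(2 * n + 1) ^ ℓ` clauses, so superpolynomial in `n` is superpolynomial in `n + A.card`.
-/
theorem eventually_exists_hard_formula {ℓ c : ℕ} (hℓ : 4 ≤ ℓ) (hc : ℓ = 2 * c) (K : ℕ) :
    ∀ᶠ n in atTop, ∃ A : CNF (Fin n), A.IsKCNF ℓ ∧ A.Unsat ∧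
      ∀ π : SemRefutation (cnfLines (ℓ - 1) n) A, π.TreeLike →
        (n + A.card) ^ K < π.length := by
  have hc0 : 0 < c := by omega
  obtain ⟨L, hL, h⟩ := exists_superpolynomial_bound hc0 (by norm_num : (0 : ℝ) < 1 / 2)
  have hlen := h (fun n => cnfLines (ℓ - 1) n) (by
    have := eventually_ncard_cnfLines_le (by omega : 1 ≤ ℓ)
    rw [hc] at this ⊢
    push_cast at this
    exact this)
  filter_upwards [(aas_unsat hc0).eventually_const_lt (by norm_num : (1 / 2 : ℝ) < 1),
    hlen.eventually_const_lt (by norm_num : (1 / 2 : ℝ) < 1), hL ((ℓ + 2) * K + 1),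
    eventually_ge_atTop (3 ^ ℓ + 2)] with n h1 h2 h3 h4
  obtain ⟨A, hAS, hA1, hA2⟩ := exists_of_uniformProb_gt_half h1 h2
  have hA := isKCNF_of_mem_cliqueFamily (ℓ := ℓ) (by omega) hc.symm.le hAS
  refine ⟨A, hA, hA1, fun π hπ => ?_⟩
  have hpos : 0 < 3 ^ ℓ := by positivity
  have h5 : n + A.card ≤ n ^ (ℓ + 2) := by
    have h6 : A.card ≤ n ^ (ℓ + 1) := by
      calc A.card ≤ (2 * n + 1) ^ ℓ := hA.card_le
        _ ≤ (3 * n) ^ ℓ := Nat.pow_le_pow_left (by omega) _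
        _ = 3 ^ ℓ * n ^ ℓ := mul_pow _ _ _
        _ ≤ n * n ^ ℓ := Nat.mul_le_mul_right _ (by omega)
        _ = _ := (pow_succ' _ _).symm
    have h7 : n ≤ n ^ (ℓ + 1) := Nat.le_self_pow (by omega) n
    calc n + A.card ≤ 2 * n ^ (ℓ + 1) := by omega
      _ ≤ n * n ^ (ℓ + 1) := Nat.mul_le_mul_right _ (by omega)
      _ = _ := (pow_succ' _ _).symm
  calc (n + A.card) ^ K ≤ (n ^ (ℓ + 2)) ^ K := Nat.pow_le_pow_left h5 _
    _ = n ^ ((ℓ + 2) * K) := (pow_mul _ _ _).symm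
    _ < n ^ ((ℓ + 2) * K + 1) := Nat.pow_lt_pow_right (by omega) (by omega)
    _ ≤ L n := h3
    _ ≤ π.length := hA2 π hπ

theorem theorem1p2 :
    -- random `c`-ary clique formulas, `ℓ = 2 * c`
    (∀ ℓ c : ℕ, 4 ≤ ℓ → ℓ = 2 * c →
      (∀ n, ∀ A ∈ cliqueFamily c n, A.IsKCNF ℓ) ∧
      AAS (cliqueFamily c) (fun _ A => A.Unsat) ∧
      ∀ ε : ℝ, 0 < ε → ∃ L : ℕ → ℕ, IsSuperpolynomial L ∧
        ∀ F : ∀ n : ℕ, Set (BoolFun (Fin n)),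
          (∀ᶠ n : ℕ in atTop, ((F n).ncard : ℝ) ≤ Real.exp ((n : ℝ) ^ ((ℓ : ℝ) - ε))) →
          AAS (cliqueFamily c)
            (fun n A => ∀ π : SemRefutation (F n) A, π.TreeLike → L n ≤ π.length)) ∧
    -- the strict hierarchy of tree-like semantic systems
    (∃ F : ℕ → ∀ n : ℕ, Set (BoolFun (Fin n)),
      ∀ ℓ : ℕ, 4 ≤ ℓ → Even ℓ →
        (∀ n, F ℓ n ⊆ F (ℓ + 2) n) ∧
        (∃ C : ℕ, ∀ k < ℓ, ∀ n, ∀ A : CNF (Fin n), A.IsKCNF k → A.Unsat →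
          ∃ π : SemRefutation (F ℓ n) A, π.TreeLike ∧ π.length ≤ C * A.card) ∧
        (∀ K : ℕ, ∀ᶠ n in atTop, ∃ A : CNF (Fin n), A.IsKCNF ℓ ∧ A.Unsat ∧
          ∀ π : SemRefutation (F ℓ n) A, π.TreeLike → (n + A.card) ^ K < π.length)) := by
  -- Level `ℓ` consists of the `(ℓ - 1)`-CNF functions: closed enough to refute `k`-CNF formulas for
  -- `k < ℓ`, and few enough for the first part with `ε = 1 / 2`.
  refine ⟨fun ℓ c hℓ hc => ?_, fun ℓ n => cnfLines (ℓ - 1) n, fun ℓ hℓ heven => ?_⟩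
  · refine ⟨fun n A hA => isKCNF_of_mem_cliqueFamily (by omega) hc.symm.le hA,
      aas_unsat (by omega), fun ε hε => ?_⟩
    subst hc
    push_cast
    exact exists_superpolynomial_bound (by omega) hε
  · obtain ⟨c, hc⟩ := heven
    exact ⟨fun n => cnfLines_mono (by omega),
      ⟨2, fun k hk n A hA hunsat => exists_treeLike_refutation (hA.mono (by omega)) hunsat⟩,
      fun K => eventually_exists_hard_formula hℓ (hc.trans (two_mul c).symm) K⟩
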